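/- Let $T:[0,1]\to[0,1]$, $T(x)=\frac1x \bmod 1$ for $x\ne0$, $T(0)=0$, be the Gauss map, let $m$ be Lebesgue measure on $[0,1]$, and let $z=\frac{\sqrt5-1}2$, the rightmost fixed point of $T$. A sequence $(a_n)$ of nonnegative reals is said to *decay like* $\lambda^n$, where $0<\lambda<1$, if $\lim_{n\to\infty}a_n/\lambda^n$ exists and is a positive real number; $\lambda$ is then determined by $(a_n)$. For $I\subseteq[0,1]$, the *decay rate for the hole $I$* is the number $\lambda\in(0,1)$ (if it exists) such that $m\{x\in[0,1]: T^jx\notin I\text{ for }0\le j<n\}$ decays like $\lambda^n$. (1) For $k\ge1$ let $m_{k,n}$ be the Lebesgue measure of the set of those $x\in[0,1]$ whose continued fraction expansion does not contain a block of $k$ consecutive $1$'s among the first $n$ digits. Then for each $k\ge1$ there is $\lambda_k\in(0,1)$ such that $m_{k,n}$ decays like $\lambda_k^n$ as $n\to\infty$. The same $\lambda_k$ is the decay rate for the hole $I_k$, the compact interval with endpoints $f^{-k}(0)$ and $f^{-k}(1)$, where $f(x)=\frac1x-1$ is the rightmost branch of $T$ and $f^{-1}(y)=\frac1{1+y}$.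 Moreover $$\lim_{k\to\infty}\frac{1-\lambda_k}{z^{2k}}=\frac{z^3(1+z^2)^2}{\ln 2}\approx 0.6504,$$ the numerical value being correct to four decimals. (2) For each $\varepsilon\in\{\frac12,\frac13,\frac14,\dots\}$ the hole $[0,\varepsilon]$ has a decay rate $\lambda_\varepsilon\in(0,1)$, and, as $\varepsilon\to0$ through these values, $$\frac{1-\lambda_\varepsilon}{\varepsilon}\to\frac1{\ln2}.$$ (3) For small $\varepsilon>0$ let $I_\varepsilon=[\alpha_\varepsilon,\beta_\varepsilon]\ni z$ be an interval of length $\varepsilon$, such that $$\liminf_{\varepsilon\to0}\frac{\min\{z-\alpha_\varepsilon,\ \beta_\varepsilon-z\}}{\varepsilon}\ \ge\ \frac{z^2}{1+z^2}$$ (for instance, $I_\varepsilon$ centred at $z$). Then for all sufficiently small $\varepsilon>0$ the hole $I_\varepsilon$ has a decay rate $\lambda_\varepsilon\in(0,1)$, and $$\lim_{\varepsilon\to0}\frac{1-\lambda_\varepsilon}{\varepsilon}=\frac{z^2}{\ln2}.$$ -/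

import Mathlib

open Set Filter Topology MeasureTheory

noncomputable section

namespace GaussHoles

/-- The Gauss map `x ↦ 1/x mod 1` (with the usual convention that `0` is sent to `0`). -/
def gaussMap (x : ℝ) : ℝ := Int.fract (1 / x)

/-- The rightmost fixed point of the Gauss map. -/
def z : ℝ := (√5 - 1) / 2

/-- The sequence `a n` decreases asymptotically like `lam ^ n`. The number `lam` is determined
by `a`. -/
def IsDecayRate (a : ℕ → ℝ) (lam : ℝ) : Prop :=
  0 < lam ∧ lam < 1 ∧ ∃ C : ℝ, 0 < C ∧ Tendsto (fun n => a n / lam ^ n) atTop (𝓝 C)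

/-- The Lebesgue measure of the set of points of `[0,1]` that do not fall into the hole `I`
during the first `n` steps of the Gauss map. -/
def survival (I : Set ℝ) (n : ℕ) : ℝ :=
  volume.real {x : ℝ | x ∈ Icc (0 : ℝ) 1 ∧ ∀ j < n, gaussMap^[j] x ∉ I}

/-- Among the first `n` continued fraction digits of `x` there are `k` consecutive ones.
(The entry of `partDens` with index `j` is the digit number `j + 1` after the integer part.) -/
def HasOnesBlock (k n : ℕ) (x : ℝ) : Prop :=
  ∃ i : ℕ, i + k ≤ n ∧ ∀ j < k, (GenContFract.of x).partDens.get? (i + j) = some 1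

/-- The Lebesgue measure of the set of points of `[0,1]` with no block of `k` consecutive ones
among their first `n` continued fraction digits. -/
def blockFreeMeasure (k n : ℕ) : ℝ :=
  volume.real {x : ℝ | x ∈ Icc (0 : ℝ) 1 ∧ ¬ HasOnesBlock k n x}

/-- The inverse `y ↦ 1/(1+y)` of the rightmost branch `x ↦ 1/x - 1` of the Gauss map. -/
def rightInverseBranch (y : ℝ) : ℝ := 1 / (1 + y)

/-- The compact interval around `z` whose interior is mapped onto `(0,1)` by the `k`-th iterate
of the rightmost branch of the Gauss map. -/
def onesHole (k : ℕ) : Set ℝ :=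
  uIcc (rightInverseBranch^[k] 0) (rightInverseBranch^[k] 1)

end GaussHoles

end

noncomputable section

namespace GaussHoles

/-! Normalised by the Gauss density `1 / (log 2 * (1 + x))`, the transfer operator becomes an
averaging operator: it fixes constants, preserves the Gauss mean, and halves the variation
(`HasVar.gkl`). The survival measure is the mean of the `n`-th iterate of the open operator, which
first erases the function on the hole and then averages (`survival_eq_mean`).

Existence of decay rates comes from a contraction argument on cones,
`exists_hasGeometricDecay_of_cone`, used twice. For short intervals near `z` the cone consists of
nonnegative functions whose variation is at most four times their mean (`bvCone`); a Lasota–Yorke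
inequality keeps it invariant. The holes `[0,1/N]` and the holes of blocks of ones are described
exactly by finite automata reading digits, and these act on products of cones of log-Lipschitz
functions (`distCone`), so that no smallness of the hole is needed (`isDecayRate_runs`).

For the size of `1 - lam`, fix `M` and let the hole shrink. Densities in `bvCone` relax to constants
exponentially fast, so the share of mass lost in `M` steps is about `M` times the measure of those
points of the hole that do not return soon (`decay_bounds`). Letting `M` tend to infinity afterwards
(`tendsto_rate`) shows that `1 - lam` is asymptotic to the Gauss measure of the hole times the
limiting proportion of points without return.

At `0` this proportion is `1` and the density is `1 / log 2`. At `z` a proportion `z ^ 2` returns at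
once, because the right inverse branch contracts by `z ^ 2`; as `1 - z ^ 2 = z ^ 2 * (1 + z)`,
multiplying by the density `1 / (log 2 * (1 + z))` gives `z ^ 2 / log 2`. Later returns are
negligible if the preimage of the hole in the right branch exceeds the hole by `o(ε)` only; this is
what the centring condition ensures. For blocks of ones the inverse branch maps the hole into
itself, and the length of the hole is found by linearising a Möbius map. -/

/-! ### The normalised transfer operator of the Gauss map -/

/-- The `n`-th inverse branch of the Gauss map (the digit is `n + 1`). -/
def branch (n : ℕ) (x : ℝ) : ℝ := 1 / (n + 1 + x)

/-- The weight of the `n`-th inverse branch in the transfer operator normalised by the Gauss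
measure. -/
def weight (n : ℕ) (x : ℝ) : ℝ := (1 + x) / ((n + 1 + x) * (n + 2 + x))

lemma weight_nonneg (n : ℕ) {x : ℝ} (hx : 0 ≤ x) : 0 ≤ weight n x := by
  unfold weight; positivity

lemma branch_pos (n : ℕ) {x : ℝ} (hx : 0 ≤ x) : 0 < branch n x := by
  unfold branch; positivity

lemma branch_mem_Icc (n : ℕ) {x : ℝ} (hx : 0 ≤ x) : branch n x ∈ Icc (0 : ℝ) 1 := by
  refine ⟨(branch_pos n hx).le, ?_⟩
  unfold branch
  rw [div_le_one (by positivity)]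
  have : (0 : ℝ) ≤ n := n.cast_nonneg
  linarith

lemma branch_mem_Ioo (n : ℕ) {x : ℝ} (hx : x ∈ Ioo (0 : ℝ) 1) :
    branch n x ∈ Ioo (0 : ℝ) 1 := by
  refine ⟨branch_pos n hx.1.le, ?_⟩
  have h0 := hx.1
  unfold branch
  rw [div_lt_one (by positivity)]
  have : (0 : ℝ) ≤ n := n.cast_nonneg
  linarith

lemma branch_succ_le_half (n : ℕ) {x : ℝ} (hx : 0 ≤ x) : branch (n + 1) x ≤ 1 / 2 := by
  unfold branch
  apply one_div_le_one_div_of_le (by norm_num)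
  push_cast
  have : (0 : ℝ) ≤ n := n.cast_nonneg
  linarith

lemma branch_antitone (n : ℕ) {x y : ℝ} (hx : 0 ≤ x) (hxy : x ≤ y) :
    branch n y ≤ branch n x := by
  unfold branch
  apply one_div_le_one_div_of_le (by positivity)
  linarith

lemma branch_antitone_index {m n : ℕ} (hmn : m ≤ n) {x : ℝ} (hx : 0 ≤ x) :
    branch n x ≤ branch m x := by
  unfold branch
  apply one_div_le_one_div_of_le (by positivity)
  have : (m : ℝ) ≤ n := by exact_mod_cast hmn
  linarith

/-- The sum telescopes, since the weight is `(1 + x) * (1 / (n + 1 + x) - 1 / (n + 2 + x))`. -/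
lemma sum_weight (N : ℕ) {x : ℝ} (hx : 0 ≤ x) :
    ∑ n ∈ Finset.range N, weight n x = 1 - (1 + x) / (N + 1 + x) := by
  induction N with
  | zero =>
    have : (1 + x) ≠ 0 := by positivity
    simp [this]
  | succ N ih =>
    rw [Finset.sum_range_succ, ih, weight]
    have h1 : (N : ℝ) + 1 + x ≠ 0 := by positivity
    have h2 : (N : ℝ) + 2 + x ≠ 0 := by positivity
    have h3 : ((N + 1 : ℕ) : ℝ) + 1 + x = N + 2 + x := by push_cast; ring
    rw [h3]
    field_simp
    ring

lemma tendsto_sum_weight {x : ℝ} (hx : 0 ≤ x) :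
    Tendsto (fun N => ∑ n ∈ Finset.range N, weight n x) atTop (𝓝 1) := by
  have h : Tendsto (fun N : ℕ => 1 - (1 + x) / ((N : ℝ) + 1 + x)) atTop (𝓝 (1 - 0)) := by
    apply Tendsto.const_sub
    apply Tendsto.const_div_atTop
    apply tendsto_atTop_add_const_right
    apply tendsto_atTop_add_const_right
    exact tendsto_natCast_atTop_atTop
  rw [sub_zero] at h
  exact h.congr fun N => (sum_weight N hx).symm

lemma hasSum_weight {x : ℝ} (hx : 0 ≤ x) : HasSum (fun n => weight n x) 1 :=
  (hasSum_iff_tendsto_nat_of_nonneg (fun n => weight_nonneg n hx) 1).2 (tendsto_sum_weight hx)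

lemma summable_weight_mul {x B : ℝ} (hx : 0 ≤ x) {c : ℕ → ℝ} (hc : ∀ n, |c n| ≤ B) :
    Summable fun n => weight n x * c n := by
  refine Summable.of_norm_bounded (g := fun n => weight n x * B)
    ((hasSum_weight hx).summable.mul_right B) fun n => ?_
  rw [Real.norm_eq_abs, abs_mul, abs_of_nonneg (weight_nonneg n hx)]
  exact mul_le_mul_of_nonneg_left (hc n) (weight_nonneg n hx)

/-- The Gauss–Kuzmin–Lévy operator: the transfer operator of the Gauss map with respect to the
Gauss measure. -/
def gkl (f : ℝ → ℝ) (x : ℝ) : ℝ := ∑' n, weight n x * f (branch n x)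

lemma summable_gkl {f : ℝ → ℝ} {B x : ℝ} (hf : ∀ y ∈ Icc (0 : ℝ) 1, |f y| ≤ B) (hx : 0 ≤ x) :
    Summable fun n => weight n x * f (branch n x) :=
  summable_weight_mul hx fun n => hf _ (branch_mem_Icc n hx)

lemma gkl_le {f : ℝ → ℝ} {B S x : ℝ} (hf : ∀ y ∈ Icc (0 : ℝ) 1, |f y| ≤ B)
    (hS : ∀ y ∈ Icc (0 : ℝ) 1, f y ≤ S) (hx : 0 ≤ x) : gkl f x ≤ S := by
  have h := (hasSum_weight hx).mul_right S
  rw [one_mul] at h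
  refine hasSum_le (fun n => ?_) (summable_gkl hf hx).hasSum h
  exact mul_le_mul_of_nonneg_left (hS _ (branch_mem_Icc n hx)) (weight_nonneg n hx)

lemma gkl_nonneg {f : ℝ → ℝ} {x : ℝ} (hS : ∀ y ∈ Icc (0 : ℝ) 1, 0 ≤ f y) (hx : 0 ≤ x) :
    0 ≤ gkl f x :=
  tsum_nonneg fun n => mul_nonneg (weight_nonneg n hx) (hS _ (branch_mem_Icc n hx))

lemma gkl_add {f g : ℝ → ℝ} {B C x : ℝ} (hf : ∀ y ∈ Icc (0 : ℝ) 1, |f y| ≤ B)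
    (hg : ∀ y ∈ Icc (0 : ℝ) 1, |g y| ≤ C) (hx : 0 ≤ x) :
    gkl (fun y => f y + g y) x = gkl f x + gkl g x := by
  unfold gkl
  rw [← (summable_gkl hf hx).tsum_add (summable_gkl hg hx)]
  simp only [mul_add]

lemma gkl_sub {f g : ℝ → ℝ} {B C x : ℝ} (hf : ∀ y ∈ Icc (0 : ℝ) 1, |f y| ≤ B)
    (hg : ∀ y ∈ Icc (0 : ℝ) 1, |g y| ≤ C) (hx : 0 ≤ x) :
    gkl (fun y => f y - g y) x = gkl f x - gkl g x := by
  unfold gkl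
  rw [← (summable_gkl hf hx).tsum_sub (summable_gkl hg hx)]
  simp only [mul_sub]

lemma gkl_smul (a : ℝ) (f : ℝ → ℝ) (x : ℝ) : gkl (fun y => a * f y) x = a * gkl f x := by
  unfold gkl
  rw [← tsum_mul_left]
  congr 1; ext n; ring

lemma gkl_congr {f g : ℝ → ℝ} {x : ℝ} (h : ∀ y ∈ Icc (0 : ℝ) 1, f y = g y) (hx : 0 ≤ x) :
    gkl f x = gkl g x := by
  unfold gkl
  congr 1; ext n
  rw [h _ (branch_mem_Icc n hx)]

/-! ### Halving of the variation -/

/-- Abel summation. The partial sums of the weights are larger at `x` than at `y`: a smaller point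
makes small digits more likely. -/
lemma sum_weight_sub_ge {x y : ℝ} (hx : 0 ≤ x) (hxy : x ≤ y) {c : ℕ → ℝ} (hc : Antitone c)
    (N : ℕ) :
    (∑ n ∈ Finset.range N, weight n x - ∑ n ∈ Finset.range N, weight n y) * c N ≤
      ∑ n ∈ Finset.range N, weight n x * c n - ∑ n ∈ Finset.range N, weight n y * c n := by
  induction N with
  | zero => simp
  | succ N ih =>
    have hD : 0 ≤ ∑ n ∈ Finset.range (N + 1), weight n x -
        ∑ n ∈ Finset.range (N + 1), weight n y := by
      rw [sum_weight _ hx, sum_weight _ (hx.trans hxy)]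
      have h1 : (0 : ℝ) < ((N + 1 : ℕ) : ℝ) + 1 + x := by positivity
      have h2 : (0 : ℝ) < ((N + 1 : ℕ) : ℝ) + 1 + y := by linarith
      have : (1 + x) / (((N + 1 : ℕ) : ℝ) + 1 + x) ≤ (1 + y) / (((N + 1 : ℕ) : ℝ) + 1 + y) := by
        rw [div_le_div_iff₀ h1 h2]
        have : (0 : ℝ) ≤ ((N + 1 : ℕ) : ℝ) := Nat.cast_nonneg _
        nlinarith
      linarith
    have h1 := mul_le_mul_of_nonneg_left (hc (Nat.le_succ N)) hD
    refine h1.trans ?_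
    simp only [Finset.sum_range_succ] at *
    nlinarith

/-- Stochastic monotonicity of the digit distribution. -/
lemma tsum_weight_mul_antitone {x y B : ℝ} (hx : 0 ≤ x) (hxy : x ≤ y) {c : ℕ → ℝ}
    (hc : Antitone c) (hB : ∀ n, |c n| ≤ B) :
    ∑' n, weight n y * c n ≤ ∑' n, weight n x * c n := by
  have hy := hx.trans hxy
  have h1 := (summable_weight_mul hx hB).hasSum.tendsto_sum_nat
  have h2 := (summable_weight_mul hy hB).hasSum.tendsto_sum_nat
  have h3 := (tendsto_sum_weight hx).sub (tendsto_sum_weight hy)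
  rw [sub_self] at h3
  have h4 : Tendsto (fun N => (∑ n ∈ Finset.range N, weight n x -
      ∑ n ∈ Finset.range N, weight n y) * c N) atTop (𝓝 0) := by
    refine h3.zero_mul_isBoundedUnder_le ?_
    exact isBoundedUnder_of ⟨B, fun n => by simpa using hB n⟩
  have := le_of_tendsto_of_tendsto' h4 (h1.sub h2) (sum_weight_sub_ge hx hxy hc)
  linarith

lemma abs_le_of_monotoneOn {u : ℝ → ℝ} (hu : MonotoneOn u (Icc 0 1)) :
    ∀ y ∈ Icc (0 : ℝ) 1, |u y| ≤ |u 0| + |u 1| := by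
  intro y hy
  have h0 := hu (left_mem_Icc.2 zero_le_one) hy hy.1
  have h1 := hu hy (right_mem_Icc.2 zero_le_one) hy.2
  rw [abs_le]
  constructor
  · linarith [neg_abs_le (u 0), abs_nonneg (u 1)]
  · linarith [le_abs_self (u 1), abs_nonneg (u 0)]

/-- Two effects work in the same direction as `x` grows: each branch decreases, and the digit
distribution moves towards larger digits, whose branches are lower. -/
lemma gkl_antitoneOn {u : ℝ → ℝ} (hu : MonotoneOn u (Icc 0 1)) :
    AntitoneOn (gkl u) (Icc 0 1) := by
  intro x hx y hy hxy
  have hb := abs_le_of_monotoneOn hu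
  calc gkl u y ≤ ∑' n, weight n y * u (branch n x) := by
        refine (summable_gkl hb hy.1).tsum_le_tsum (fun n => ?_)
          (summable_weight_mul hy.1 fun n => hb _ (branch_mem_Icc n hx.1))
        exact mul_le_mul_of_nonneg_left (hu (branch_mem_Icc n hy.1) (branch_mem_Icc n hx.1)
          (branch_antitone n hx.1 hxy)) (weight_nonneg n hy.1)
    _ ≤ gkl u x := by
        refine tsum_weight_mul_antitone hx.1 hxy (fun m n hmn => ?_)
          fun n => hb _ (branch_mem_Icc n hx.1)
        exact hu (branch_mem_Icc n hx.1) (branch_mem_Icc m hx.1)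
          (branch_antitone_index hmn hx.1)

/-- The branches at `1` are the branches at `0` with the first one removed, and their weights are
exactly doubled. Hence `gkl u 0` is the average of `u 1` and `gkl u 1`, and the latter is at least
`u 0`. Since `gkl u` is monotone, this end-point difference is its whole variation. -/
lemma gkl_zero_sub_gkl_one {u : ℝ → ℝ} (hu : MonotoneOn u (Icc 0 1)) :
    gkl u 0 - gkl u 1 ≤ (u 1 - u 0) / 2 := by
  have hb := abs_le_of_monotoneOn hu
  have h0 := summable_gkl hb le_rfl
  have e1 : gkl u 0 = u 1 / 2 + ∑' n, weight (n + 1) 0 * u (branch (n + 1) 0) := by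
    rw [gkl, h0.tsum_eq_zero_add]
    norm_num [weight, branch]
    ring
  have e2 : gkl u 1 = 2 * ∑' n, weight (n + 1) 0 * u (branch (n + 1) 0) := by
    rw [gkl, ← tsum_mul_left]
    congr 1; ext n
    have hbr : branch n 1 = branch (n + 1) 0 := by unfold branch; push_cast; congr 1; ring
    have hw : weight n 1 = 2 * weight (n + 1) 0 := by
      unfold weight; push_cast
      have h1 : (n : ℝ) + 1 + 1 ≠ 0 := by positivity
      have h2 : (n : ℝ) + 2 + 1 ≠ 0 := by positivity
      have h3 : (n : ℝ) + 1 + 2 ≠ 0 := by positivity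
      simp only [add_zero]
      rw [show (n : ℝ) + 1 + 2 = n + 2 + 1 by ring]
      field_simp
      norm_num
    rw [hbr, hw]; ring
  have h2 : u 0 ≤ gkl u 1 := by
    have h := (hasSum_weight (zero_le_one' ℝ)).mul_right (u 0)
    rw [one_mul] at h
    refine hasSum_le (fun n => ?_) h (summable_gkl hb zero_le_one).hasSum
    exact mul_le_mul_of_nonneg_left (hu (left_mem_Icc.2 zero_le_one)
      (branch_mem_Icc n zero_le_one) (branch_mem_Icc n zero_le_one).1)
      (weight_nonneg n zero_le_one)
  linarith

/-- `f` has total variation at most `v` on `[0,1]`, witnessed by a Jordan decomposition. -/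
def HasVar (f : ℝ → ℝ) (v : ℝ) : Prop :=
  ∃ u w : ℝ → ℝ, MonotoneOn u (Icc 0 1) ∧ MonotoneOn w (Icc 0 1) ∧
    (∀ x ∈ Icc (0 : ℝ) 1, f x = u x - w x) ∧ (u 1 - u 0) + (w 1 - w 0) ≤ v

lemma HasVar.mono {f : ℝ → ℝ} {v v' : ℝ} (h : HasVar f v) (hv : v ≤ v') : HasVar f v' := by
  obtain ⟨u, w, hu, hw, hf, h⟩ := h
  exact ⟨u, w, hu, hw, hf, h.trans hv⟩

lemma HasVar.congr {f g : ℝ → ℝ} {v : ℝ} (h : HasVar f v)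
    (hfg : ∀ x ∈ Icc (0 : ℝ) 1, g x = f x) : HasVar g v := by
  obtain ⟨u, w, hu, hw, hf, h⟩ := h
  exact ⟨u, w, hu, hw, fun x hx => (hfg x hx).trans (hf x hx), h⟩

lemma HasVar.abs_sub_le {f : ℝ → ℝ} {v : ℝ} (h : HasVar f v) {x y : ℝ}
    (hx : x ∈ Icc (0 : ℝ) 1) (hy : y ∈ Icc (0 : ℝ) 1) : |f x - f y| ≤ v := by
  obtain ⟨u, w, hu, hw, hf, h⟩ := h
  have m0 : (0 : ℝ) ∈ Icc (0 : ℝ) 1 := left_mem_Icc.2 zero_le_one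
  have m1 : (1 : ℝ) ∈ Icc (0 : ℝ) 1 := right_mem_Icc.2 zero_le_one
  have a1 := hu m0 hx hx.1
  have a2 := hu hx m1 hx.2
  have a3 := hu m0 hy hy.1
  have a4 := hu hy m1 hy.2
  have b1 := hw m0 hx hx.1
  have b2 := hw hx m1 hx.2
  have b3 := hw m0 hy hy.1
  have b4 := hw hy m1 hy.2
  rw [hf x hx, hf y hy, abs_le]
  constructor <;> linarith

lemma HasVar.nonneg {f : ℝ → ℝ} {v : ℝ} (h : HasVar f v) : 0 ≤ v := by
  have m0 : (0 : ℝ) ∈ Icc (0 : ℝ) 1 := left_mem_Icc.2 zero_le_one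
  simpa using h.abs_sub_le m0 m0

lemma HasVar.add {f g : ℝ → ℝ} {v v' : ℝ} (h : HasVar f v) (h' : HasVar g v') :
    HasVar (fun x => f x + g x) (v + v') := by
  obtain ⟨u, w, hu, hw, hf, h⟩ := h
  obtain ⟨u', w', hu', hw', hf', h'⟩ := h'
  refine ⟨u + u', w + w', hu.add hu', hw.add hw', fun x hx => ?_, ?_⟩
  · simp only [hf x hx, hf' x hx, Pi.add_apply]; ring
  · simp only [Pi.add_apply]; linarith

lemma hasVar_const (c : ℝ) : HasVar (fun _ => c) 0 :=
  ⟨fun _ => c, fun _ => 0, monotoneOn_const, monotoneOn_const, fun _ _ => by simp, by simp⟩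

lemma HasVar.const_mul {f : ℝ → ℝ} {v a : ℝ} (h : HasVar f v) (ha : 0 ≤ a) :
    HasVar (fun x => a * f x) (a * v) := by
  obtain ⟨u, w, hu, hw, hf, h⟩ := h
  refine ⟨fun x => a * u x, fun x => a * w x, fun x hx y hy hxy => ?_, fun x hx y hy hxy => ?_,
    fun x hx => ?_, ?_⟩
  · exact mul_le_mul_of_nonneg_left (hu hx hy hxy) ha
  · exact mul_le_mul_of_nonneg_left (hw hx hy hxy) ha
  · simp only [hf x hx]; ring
  · nlinarith

lemma HasVar.neg {f : ℝ → ℝ} {v : ℝ} (h : HasVar f v) : HasVar (fun x => -f x) v := by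
  obtain ⟨u, w, hu, hw, hf, h⟩ := h
  exact ⟨w, u, hw, hu, fun x hx => by simp only [hf x hx]; ring, by linarith⟩

/-- The Gauss–Kuzmin–Lévy operator halves the variation. -/
lemma HasVar.gkl {f : ℝ → ℝ} {v : ℝ} (h : HasVar f v) : HasVar (gkl f) (v / 2) := by
  obtain ⟨u, w, hu, hw, hf, h⟩ := h
  refine ⟨fun x => -GaussHoles.gkl w x, fun x => -GaussHoles.gkl u x,
    (gkl_antitoneOn hw).neg, (gkl_antitoneOn hu).neg, fun x hx => ?_, ?_⟩
  · rw [gkl_congr hf hx.1, gkl_sub (abs_le_of_monotoneOn hu) (abs_le_of_monotoneOn hw) hx.1]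
    ring
  · linarith [gkl_zero_sub_gkl_one hu, gkl_zero_sub_gkl_one hw]

open Classical in
/-- Cutting an interval out of a nonnegative function increases its variation by at most twice
the supremum. -/
lemma HasVar.cut {f : ℝ → ℝ} {v S : ℝ} (h : HasVar f v) (h0 : ∀ x ∈ Icc (0 : ℝ) 1, 0 ≤ f x)
    (hS : ∀ x ∈ Icc (0 : ℝ) 1, f x ≤ S) {I : Set ℝ} (hI : I.OrdConnected) :
    HasVar (Iᶜ.indicator f) (v + 2 * S) := by
  by_cases hne : ∃ y ∈ I, y ∈ Icc (0 : ℝ) 1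
  swap
  · have hS0 : 0 ≤ S := (h0 0 (left_mem_Icc.2 zero_le_one)).trans (hS 0 (left_mem_Icc.2 zero_le_one))
    refine (h.mono (by linarith)).congr fun x hx => ?_
    rw [indicator_of_mem]
    exact fun hxI => hne ⟨x, hxI, hx⟩
  obtain ⟨c, hcI, hc⟩ := hne
  obtain ⟨u, w, hu, hw, hf, h⟩ := h
  have m0 : (0 : ℝ) ∈ Icc (0 : ℝ) 1 := left_mem_Icc.2 zero_le_one
  have m1 : (1 : ℝ) ∈ Icc (0 : ℝ) 1 := right_mem_Icc.2 zero_le_one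
  have hS0 : 0 ≤ S := (h0 0 m0).trans (hS 0 m0)
  -- Both monotone parts take the common value `u c` on `I`, so that their difference vanishes
  -- there, and both are raised by `S` to the right of `I`. The second part stays monotone because
  -- `0 ≤ f` gives `w ≤ u` on the left and `f ≤ S` gives `u ≤ w + S` on the right.
  refine ⟨fun x => if x ∈ I then u c else if x < c then u x else u x + S,
    fun x => if x ∈ I then u c else if x < c then w x else w x + S, ?_, ?_, ?_, ?_⟩
  · intro x hx y hy hxy
    have h1 := hu hx hy hxy
    have h2 := fun hxc : x ≤ c => hu hx hc hxc
    have h3 := fun hxc : c ≤ y => hu hc hy hxc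
    by_cases hxI : x ∈ I <;> by_cases hyI : y ∈ I
    · simp [hxI, hyI]
    · have : ¬ y < c := fun hyc => hyI (hI.out hxI hcI ⟨hxy, hyc.le⟩)
      simp only [hxI, hyI, this, if_true, if_false]
      linarith [h3 (not_lt.1 this)]
    · have : x < c := by
        by_contra hxc
        exact hxI (hI.out hcI hyI ⟨not_lt.1 hxc, hxy⟩)
      simp only [hxI, hyI, this, if_true, if_false]
      exact h2 this.le
    · simp only [hxI, hyI, if_false]
      split_ifs <;> linarith
  · intro x hx y hy hxy
    have h1 := hw hx hy hxy
    have fx := hf x hx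
    have fy := hf y hy
    have fx0 := h0 x hx
    have fyS := hS y hy
    have h2 := fun hxc : x ≤ c => hu hx hc hxc
    have h3 := fun hxc : c ≤ y => hu hc hy hxc
    by_cases hxI : x ∈ I <;> by_cases hyI : y ∈ I
    · simp [hxI, hyI]
    · have : ¬ y < c := fun hyc => hyI (hI.out hxI hcI ⟨hxy, hyc.le⟩)
      simp only [hxI, hyI, this, if_true, if_false]
      linarith [h3 (not_lt.1 this)]
    · have : x < c := by
        by_contra hxc
        exact hxI (hI.out hcI hyI ⟨not_lt.1 hxc, hxy⟩)
      simp only [hxI, hyI, this, if_true, if_false]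
      linarith [h2 this.le]
    · simp only [hxI, hyI, if_false]
      split_ifs <;> linarith
  · intro x hx
    by_cases hxI : x ∈ I
    · simp [hxI]
    · rw [indicator_of_mem (show x ∈ Iᶜ from hxI), hf x hx]
      simp only [hxI, if_false]
      split_ifs <;> ring
  · have a1 := hu m0 hc hc.1
    have a2 := hu hc m1 hc.2
    have b1 := hw m0 hc hc.1
    have b2 := hw hc m1 hc.2
    have fc := hf c hc
    have f0 := hf 0 m0
    have f1 := hf 1 m1
    have := h0 c hc
    have := h0 0 m0
    have := h0 1 m1
    have := hS c hc
    have := hS 0 m0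
    have := hS 1 m1
    have hc1 : ¬ (1 : ℝ) < c := not_lt.2 hc.2
    by_cases hi0 : (0 : ℝ) ∈ I <;> by_cases hi1 : (1 : ℝ) ∈ I <;> by_cases hc0 : (0 : ℝ) < c <;>
      simp only [hi0, hi1, hc0, hc1, if_true, if_false] <;> linarith

/-! ### Digits, the Gauss measure and its invariance -/

/-- The index of the inverse branch whose range contains `y`. -/
def digit (y : ℝ) : ℕ := ⌊1 / y⌋₊ - 1

lemma gaussMap_branch (n : ℕ) {x : ℝ} (hx : x ∈ Ico (0 : ℝ) 1) : gaussMap (branch n x) = x := by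
  have : (n : ℝ) + 1 + x = ((n + 1 : ℕ) : ℝ) + x := by push_cast; ring
  rw [gaussMap, branch, one_div_one_div, this, Int.fract_natCast_add, Int.fract_eq_self]
  exact hx

lemma digit_branch (n : ℕ) {x : ℝ} (hx : x ∈ Ico (0 : ℝ) 1) : digit (branch n x) = n := by
  have : (n : ℝ) + 1 + x = x + ((n + 1 : ℕ) : ℝ) := by push_cast; ring
  rw [digit, branch, one_div_one_div, this, Nat.floor_add_natCast hx.1, Nat.floor_eq_zero.2 hx.2]
  simp

lemma measurable_digit : Measurable digit :=
  (measurable_from_nat (f := fun n => n - 1)).comp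
    (Nat.measurable_floor.comp (measurable_const.div measurable_id))

lemma measurable_gaussMap : Measurable gaussMap :=
  measurable_fract.comp (measurable_const.div measurable_id)

lemma gaussMap_mem (x : ℝ) : gaussMap x ∈ Ico (0 : ℝ) 1 :=
  ⟨Int.fract_nonneg _, Int.fract_lt_one _⟩

/-- The density of the Gauss measure. -/
def density (x : ℝ) : ℝ := 1 / (Real.log 2 * (1 + x))

lemma log_two_pos : 0 < Real.log 2 := Real.log_pos one_lt_two

lemma density_pos {x : ℝ} (hx : 0 ≤ x) : 0 < density x := by
  have := log_two_pos
  unfold density; positivity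

lemma measurable_density : Measurable density := by
  unfold density; fun_prop

/-- The Gauss measure. -/
def gaussMeasure : Measure ℝ :=
  (volume.restrict (Ioo 0 1)).withDensity fun x => ENNReal.ofReal (density x)

lemma lintegral_gaussMeasure {H : ℝ → ENNReal} (hH : Measurable H) :
    ∫⁻ x, H x ∂gaussMeasure = ∫⁻ x in Ioo 0 1, ENNReal.ofReal (density x) * H x := by
  rw [gaussMeasure, lintegral_withDensity_eq_lintegral_mul _ measurable_density.ennreal_ofReal hH]
  rfl

lemma integral_density (a b : ℝ) (ha : 0 ≤ a) (hab : a ≤ b) :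
    ∫ x in a..b, density x = (Real.log (1 + b) - Real.log (1 + a)) / Real.log 2 := by
  have h : ∀ x ∈ uIcc a b,
      HasDerivAt (fun x => Real.log (1 + x) / Real.log 2) (density x) x := by
    intro x hx
    rw [uIcc_of_le hab] at hx
    have hx0 : (1 + x) ≠ 0 := by linarith [hx.1]
    have h1 : HasDerivAt (fun x : ℝ => 1 + x) 1 x := (hasDerivAt_id x).const_add 1
    refine ((h1.log hx0).div_const (Real.log 2)).congr_deriv ?_
    unfold density
    field_simp [log_two_pos.ne']
  rw [intervalIntegral.integral_eq_sub_of_hasDerivAt h]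
  · ring
  · apply ContinuousOn.intervalIntegrable
    intro x hx
    rw [uIcc_of_le hab] at hx
    have hx0 : Real.log 2 * (1 + x) ≠ 0 := by
      have := log_two_pos
      have : 0 < 1 + x := by linarith [hx.1]
      positivity
    have hx1 : 1 + x ≠ 0 := right_ne_zero_of_mul hx0
    unfold density
    fun_prop (disch := assumption)

lemma gaussMeasure_Ioo {a b : ℝ} (ha : 0 ≤ a) (hab : a ≤ b) (hb : b ≤ 1) :
    gaussMeasure (Ioo a b) =
      ENNReal.ofReal ((Real.log (1 + b) - Real.log (1 + a)) / Real.log 2) := by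
  rw [gaussMeasure, withDensity_apply _ measurableSet_Ioo, Measure.restrict_restrict
    measurableSet_Ioo, inter_eq_left.2 (Ioo_subset_Ioo ha hb), ← integral_density a b ha hab,
    intervalIntegral.integral_of_le hab, restrict_Ioo_eq_restrict_Ioc, ofReal_integral_eq_lintegral_ofReal]
  · have : IntervalIntegrable density volume a b := by
      apply ContinuousOn.intervalIntegrable
      intro x hx
      rw [uIcc_of_le hab] at hx
      have hx0 : Real.log 2 * (1 + x) ≠ 0 := by
        have := log_two_pos
        have : 0 < 1 + x := by linarith [hx.1]
        positivity
      have hx1 : 1 + x ≠ 0 := right_ne_zero_of_mul hx0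
      unfold density
      fun_prop (disch := assumption)
    exact (intervalIntegrable_iff_integrableOn_Ioc_of_le hab).1 this
  · filter_upwards [ae_restrict_mem measurableSet_Ioc] with x hx
    exact (density_pos (ha.trans hx.1.le)).le

instance : IsProbabilityMeasure gaussMeasure where
  measure_univ := by
    have h1 : gaussMeasure (Ioo 0 1) = 1 := by
      rw [gaussMeasure_Ioo le_rfl zero_le_one le_rfl]
      norm_num [log_two_pos.ne']
    have h2 : gaussMeasure (Ioo (0 : ℝ) 1)ᶜ = 0 := by
      rw [gaussMeasure, withDensity_apply _ measurableSet_Ioo.compl, Measure.restrict_restrict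
        measurableSet_Ioo.compl]
      simp
    rw [← measure_add_measure_compl measurableSet_Ioo, h1, h2, add_zero]

lemma gaussMeasure_absolutelyContinuous : gaussMeasure ≪ volume :=
  (withDensity_absolutelyContinuous _ _).trans Measure.restrict_le_self.absolutelyContinuous

lemma ae_mem_Ioo : ∀ᵐ x ∂gaussMeasure, x ∈ Ioo (0 : ℝ) 1 :=
  (withDensity_absolutelyContinuous _ _).ae_le (ae_restrict_mem measurableSet_Ioo)

lemma branch_injOn (n : ℕ) : InjOn (branch n) (Ioo 0 1) := by
  intro x hx y hy h
  rw [← gaussMap_branch n (Ioo_subset_Ico_self hx), h,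
    gaussMap_branch n (Ioo_subset_Ico_self hy)]

lemma hasDerivAt_branch (n : ℕ) {x : ℝ} (hx : 0 ≤ x) :
    HasDerivAt (branch n) (-1 / (n + 1 + x) ^ 2) x := by
  have h1 : HasDerivAt (fun x : ℝ => (n : ℝ) + 1 + x) 1 x := (hasDerivAt_id x).const_add _
  have h0 : (n : ℝ) + 1 + x ≠ 0 := by positivity
  have h2 : branch n = (fun x : ℝ => (n : ℝ) + 1 + x)⁻¹ := by
    ext y; simp [branch]
  rw [h2]
  exact h1.inv h0

/-- Only the reciprocals of integers are missed: any other `y` is the image of the fractional part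
of `1 / y` under the branch with index `⌊1 / y⌋₊ - 1`. -/
lemma iUnion_branch_ae : (⋃ n, branch n '' Ioo 0 1) =ᵐ[volume] Ioo (0 : ℝ) 1 := by
  have hsub : (⋃ n, branch n '' Ioo 0 1) ⊆ Ioo (0 : ℝ) 1 :=
    iUnion_subset fun n => image_subset_iff.2 fun x hx => branch_mem_Ioo n hx
  refine hsub.eventuallyLE.antisymm ?_
  rw [ae_le_set]
  refine measure_mono_null (t := range fun n : ℕ => 1 / (n : ℝ)) ?_
    (Set.Countable.measure_zero (countable_range _) _)
  rintro y ⟨hy, hyn⟩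
  by_contra hr
  apply hyn
  have h1 : 1 < 1 / y := by rw [lt_div_iff₀ hy.1]; linarith [hy.2]
  have hfl := Nat.floor_le (zero_le_one.trans h1.le)
  have hlt := Nat.lt_floor_add_one (1 / y)
  have hf1 : 1 ≤ ⌊1 / y⌋₊ := Nat.le_floor (by simpa using h1.le)
  have hcast : ((⌊1 / y⌋₊ - 1 : ℕ) : ℝ) = ⌊1 / y⌋₊ - 1 := by
    rw [Nat.cast_sub hf1]; simp
  refine mem_iUnion.2 ⟨⌊1 / y⌋₊ - 1, 1 / y - ⌊1 / y⌋₊, ⟨?_, ?_⟩, ?_⟩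
  · refine lt_of_le_of_ne (by linarith) fun h => hr ⟨⌊1 / y⌋₊, ?_⟩
    have : ((⌊1 / y⌋₊ : ℕ) : ℝ) = 1 / y := by linarith
    simp only [this, one_div_one_div]
  · linarith
  · rw [branch, hcast]
    have : (⌊1 / y⌋₊ : ℝ) - 1 + 1 + (1 / y - ⌊1 / y⌋₊) = 1 / y := by ring
    rw [this, one_div_one_div]

lemma measurable_branch (n : ℕ) : Measurable (branch n) := by unfold branch; fun_prop

lemma measurable_weight (n : ℕ) : Measurable (weight n) := by unfold weight; fun_prop

/-- Invariance of the Gauss measure in terms of the transfer operator. -/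
lemma lintegral_transfer {H : ℝ → ENNReal} (hH : Measurable H) :
    ∫⁻ x, ∑' n, ENNReal.ofReal (weight n x) * H (branch n x) ∂gaussMeasure =
      ∫⁻ x, H x ∂gaussMeasure := by
  have hm : ∀ n, Measurable fun x => ENNReal.ofReal (weight n x) * H (branch n x) := fun n =>
    (measurable_weight n).ennreal_ofReal.mul (hH.comp (measurable_branch n))
  rw [lintegral_tsum fun n => (hm n).aemeasurable, lintegral_gaussMeasure hH,
    ← setLIntegral_congr iUnion_branch_ae, lintegral_iUnion]
  · refine tsum_congr fun n => ?_
    rw [lintegral_gaussMeasure (hm n), lintegral_image_eq_lintegral_abs_deriv_mul measurableSet_Ioo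
      (fun x hx => (hasDerivAt_branch n hx.1.le).hasDerivWithinAt) (branch_injOn n)]
    refine setLIntegral_congr_fun measurableSet_Ioo fun x hx => ?_
    have hx0 := hx.1
    rw [← mul_assoc, ← mul_assoc, ← ENNReal.ofReal_mul (density_pos hx0.le).le,
      ← ENNReal.ofReal_mul (abs_nonneg _)]
    -- What remains is the pointwise identity `density x * weight n x = |branch n '| * density
    -- (branch n x)`, which is how the weights arise from the Jacobian.
    congr 2
    have h1 : (0 : ℝ) < n + 1 + x := by positivity
    have h2 : (0 : ℝ) < n + 2 + x := by positivity
    have h3 := log_two_pos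
    rw [abs_div, abs_neg, abs_one, abs_of_pos (pow_pos h1 2)]
    unfold density weight branch
    have h4 : 1 + 1 / ((n : ℝ) + 1 + x) = (n + 2 + x) / (n + 1 + x) := by
      field_simp; ring
    rw [h4]
    field_simp
  · intro n
    exact measurableSet_Ioo.image_of_continuousOn_injOn
      (fun x hx => (hasDerivAt_branch n hx.1.le).continuousAt.continuousWithinAt) (branch_injOn n)
  · intro m n hmn
    refine disjoint_left.2 ?_
    rintro _ ⟨x, hx, rfl⟩ ⟨y, hy, hxy⟩
    apply hmn
    rw [← digit_branch m (Ioo_subset_Ico_self hx), ← hxy,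
      digit_branch n (Ioo_subset_Ico_self hy)]

/-! ### Bounded measurable functions, mean and duality -/

/-- The space of bounded measurable functions. -/
def bddMeas : Submodule ℝ (ℝ → ℝ) where
  carrier := {f | Measurable f ∧ ∃ B, ∀ x, |f x| ≤ B}
  zero_mem' := ⟨measurable_const, 0, by simp⟩
  add_mem' := by
    rintro f g ⟨hf, B, hB⟩ ⟨hg, C, hC⟩
    exact ⟨hf.add hg, B + C, fun x => (abs_add_le _ _).trans (add_le_add (hB x) (hC x))⟩
  smul_mem' := by
    rintro a f ⟨hf, B, hB⟩
    refine ⟨hf.const_smul a, |a| * B, fun x => ?_⟩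
    simpa [abs_mul] using mul_le_mul_of_nonneg_left (hB x) (abs_nonneg a)

/-- The type of bounded measurable functions. -/
abbrev BddMeas : Type := bddMeas

instance : CoeFun BddMeas fun _ => ℝ → ℝ := ⟨Subtype.val⟩

namespace BddMeas

lemma measurable (f : BddMeas) : Measurable (f : ℝ → ℝ) := f.2.1

lemma exists_bound (f : BddMeas) : ∃ B, ∀ x, |f x| ≤ B := f.2.2

lemma integrable (f : BddMeas) : Integrable (fun x => f x) gaussMeasure := by
  obtain ⟨B, hB⟩ := f.exists_bound
  exact Integrable.of_bound f.measurable.aestronglyMeasurable B (ae_of_all _ hB)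

lemma mul_mem {f g : ℝ → ℝ} (hf : f ∈ bddMeas) (hg : g ∈ bddMeas) :
    (fun x => f x * g x) ∈ bddMeas := by
  obtain ⟨hf, B, hB⟩ := hf
  obtain ⟨hg, C, hC⟩ := hg
  refine ⟨hf.mul hg, B * C, fun x => ?_⟩
  rw [abs_mul]
  exact mul_le_mul (hB x) (hC x) (abs_nonneg _) ((abs_nonneg _).trans (hB x))

lemma comp_mem {f g : ℝ → ℝ} (hf : f ∈ bddMeas) (hg : Measurable g) :
    (fun x => f (g x)) ∈ bddMeas :=
  ⟨hf.1.comp hg, hf.2.choose, fun x => hf.2.choose_spec (g x)⟩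

lemma indicator_mem {A : Set ℝ} (hA : MeasurableSet A) {f : ℝ → ℝ} (hf : f ∈ bddMeas) :
    A.indicator f ∈ bddMeas := by
  obtain ⟨hf, B, hB⟩ := hf
  refine ⟨hf.indicator hA, B, fun x => ?_⟩
  by_cases hx : x ∈ A
  · simpa [hx] using hB x
  · simpa [hx] using (abs_nonneg _).trans (hB x)

lemma const_mem (c : ℝ) : (fun _ => c) ∈ bddMeas := ⟨measurable_const, |c|, fun _ => le_rfl⟩

/-- The constant function. -/
def const (c : ℝ) : BddMeas := ⟨fun _ => c, const_mem c⟩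

/-- The indicator function of a measurable set. -/
def ind {A : Set ℝ} (hA : MeasurableSet A) : BddMeas :=
  ⟨A.indicator fun _ => 1, indicator_mem hA (const_mem 1)⟩

/-- Multiplication by the indicator function of a measurable set. -/
def cut {A : Set ℝ} (hA : MeasurableSet A) : BddMeas →ₗ[ℝ] BddMeas where
  toFun f := ⟨A.indicator f, indicator_mem hA f.2⟩
  map_add' f g := by ext x; exact congrFun (indicator_add A f g) x
  map_smul' a f := by
    ext x
    by_cases hx : x ∈ A <;> simp [hx]

lemma cut_apply {A : Set ℝ} (hA : MeasurableSet A) (f : BddMeas) (x : ℝ) :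
    cut hA f x = A.indicator f x := rfl

lemma ind_apply {A : Set ℝ} (hA : MeasurableSet A) (x : ℝ) :
    ind hA x = A.indicator (fun _ => 1) x := rfl

/-- Integration with respect to the Gauss measure. -/
def mean : BddMeas →ₗ[ℝ] ℝ where
  toFun f := ∫ x, f x ∂gaussMeasure
  map_add' f g := integral_add f.integrable g.integrable
  map_smul' a f := by
    simpa using integral_const_mul a (fun x => f x)

lemma mean_apply (f : BddMeas) : mean f = ∫ x, f x ∂gaussMeasure := rfl

lemma mean_congr {f g : BddMeas} (h : ∀ x ∈ Ioo (0 : ℝ) 1, f x = g x) : mean f = mean g :=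
  integral_congr_ae (by filter_upwards [ae_mem_Ioo] with x hx using h x hx)

lemma mean_mono {f g : BddMeas} (h : ∀ x ∈ Ioo (0 : ℝ) 1, f x ≤ g x) : mean f ≤ mean g :=
  integral_mono_ae f.integrable g.integrable
    (by filter_upwards [ae_mem_Ioo] with x hx using h x hx)

@[simp] lemma mean_const (c : ℝ) : mean (const c) = c := by
  rw [mean_apply]; simp [const]

lemma mean_nonneg {f : BddMeas} (h : ∀ x ∈ Ioo (0 : ℝ) 1, 0 ≤ f x) : 0 ≤ mean f := by
  simpa using mean_mono (f := const 0) (g := f) h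

lemma mean_ind {A : Set ℝ} (hA : MeasurableSet A) : mean (ind hA) = gaussMeasure.real A := by
  rw [mean_apply]
  exact integral_indicator_one hA

/-- The transfer operator on bounded measurable functions. -/
def transfer : BddMeas →ₗ[ℝ] BddMeas where
  -- Truncation to `[0,1]` keeps the result bounded on the whole line: for negative `x` the weights
  -- need be neither nonnegative nor summable to `1`.
  toFun f := ⟨(Icc 0 1).indicator (gkl f), by
    obtain ⟨B, hB⟩ := f.exists_bound
    constructor
    · refine measurable_of_tendsto_metrizable
        (f := fun N => (Icc (0 : ℝ) 1).indicator fun x =>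
          ∑ n ∈ Finset.range N, weight n x * f (branch n x)) (fun N => ?_) ?_
      · refine Measurable.indicator ?_ measurableSet_Icc
        exact Finset.measurable_fun_sum _ fun n _ =>
          (measurable_weight n).mul (f.measurable.comp (measurable_branch n))
      · rw [tendsto_pi_nhds]
        intro x
        by_cases hx : x ∈ Icc (0 : ℝ) 1
        · simp only [indicator_of_mem hx]
          exact (summable_gkl (fun y _ => hB y) hx.1).hasSum.tendsto_sum_nat
        · simp only [indicator_of_notMem hx]
          exact tendsto_const_nhds
    · refine ⟨B, fun x => ?_⟩
      have hB0 := (abs_nonneg _).trans (hB 0)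
      by_cases hx : x ∈ Icc (0 : ℝ) 1
      · rw [indicator_of_mem hx, abs_le]
        constructor
        · have := gkl_le (f := fun y => -1 * f y) (B := B) (S := B) (x := x)
            (fun y _ => by simpa using hB y) (fun y _ => by linarith [(abs_le.1 (hB y)).1]) hx.1
          rw [gkl_smul] at this
          linarith
        · exact gkl_le (fun y _ => hB y) (fun y _ => (abs_le.1 (hB y)).2) hx.1
      · simpa [indicator_of_notMem hx] using hB0⟩
  map_add' f g := by
    obtain ⟨B, hB⟩ := f.exists_bound
    obtain ⟨C, hC⟩ := g.exists_bound
    ext x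
    by_cases hx : x ∈ Icc (0 : ℝ) 1
    · have := gkl_add (fun y _ => hB y) (fun y _ => hC y) hx.1
      simp only [Submodule.coe_add, indicator_of_mem hx, Pi.add_apply]
      exact this
    · simp [hx]
  map_smul' a f := by
    ext x
    by_cases hx : x ∈ Icc (0 : ℝ) 1
    · have := gkl_smul a f x
      simp only [SetLike.val_smul, indicator_of_mem hx, RingHom.id_apply, Pi.smul_apply]
      exact this
    · simp [hx]

lemma transfer_apply (f : BddMeas) {x : ℝ} (hx : x ∈ Icc (0 : ℝ) 1) : transfer f x = gkl f x :=
  indicator_of_mem hx _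

lemma summable (f : BddMeas) {x : ℝ} (hx : 0 ≤ x) :
    Summable fun n => weight n x * f (branch n x) := by
  obtain ⟨B, hB⟩ := f.exists_bound
  exact summable_gkl (fun y _ => hB y) hx

lemma hasSum_transfer (f : BddMeas) {x : ℝ} (hx : x ∈ Icc (0 : ℝ) 1) :
    HasSum (fun n => weight n x * f (branch n x)) (transfer f x) := by
  rw [transfer_apply f hx]
  exact (f.summable hx.1).hasSum

lemma transfer_const (c : ℝ) {x : ℝ} (hx : x ∈ Icc (0 : ℝ) 1) : transfer (const c) x = c := by
  have := (hasSum_weight hx.1).mul_right c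
  rw [one_mul] at this
  exact (hasSum_transfer (const c) hx).unique this

lemma transfer_mono {f g : BddMeas} (h : ∀ x ∈ Icc (0 : ℝ) 1, f x ≤ g x) {x : ℝ}
    (hx : x ∈ Icc (0 : ℝ) 1) : transfer f x ≤ transfer g x :=
  hasSum_le (fun n => mul_le_mul_of_nonneg_left (h _ (branch_mem_Icc n hx.1))
    (weight_nonneg n hx.1)) (hasSum_transfer f hx) (hasSum_transfer g hx)

lemma mean_transfer_of_nonneg {f : BddMeas} (hf : ∀ x, 0 ≤ f x) :
    mean (transfer f) = mean f := by
  rw [mean_apply, mean_apply, integral_eq_lintegral_of_nonneg_ae (ae_of_all _ hf)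
    f.measurable.aestronglyMeasurable, integral_eq_lintegral_of_nonneg_ae _
    (transfer f).measurable.aestronglyMeasurable, ← lintegral_transfer f.measurable.ennreal_ofReal]
  · congr 1
    refine lintegral_congr_ae ?_
    filter_upwards [ae_mem_Ioo] with x hx
    rw [transfer_apply f (Ioo_subset_Icc_self hx), gkl, ENNReal.ofReal_tsum_of_nonneg]
    · exact tsum_congr fun n => ENNReal.ofReal_mul (weight_nonneg n hx.1.le)
    · exact fun n => mul_nonneg (weight_nonneg n hx.1.le) (hf _)
    · exact f.summable hx.1.le
  · filter_upwards [ae_mem_Ioo] with x hx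
    rw [transfer_apply f (Ioo_subset_Icc_self hx)]
    exact gkl_nonneg (fun y _ => hf y) hx.1.le

/-- Adding a constant bound reduces to nonnegative functions, because constants are fixed on
`[0,1]`. -/
lemma mean_transfer (f : BddMeas) : mean (transfer f) = mean f := by
  obtain ⟨B, hB⟩ := f.exists_bound
  have h := mean_transfer_of_nonneg (f := f + const B) fun x => by
    have := (abs_le.1 (hB x)).1
    change 0 ≤ f x + B
    linarith
  have hc : mean (transfer (const B)) = B := by
    rw [mean_congr (g := const B) fun x hx => transfer_const B (Ioo_subset_Icc_self hx),
      mean_const]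
  simp only [map_add, mean_const] at h
  linarith

/-- The transfer operator is dual to composition with the Gauss map. -/
lemma integral_transfer_mul (f g : BddMeas) :
    ∫ x, transfer f x * g x ∂gaussMeasure = ∫ x, f x * g (gaussMap x) ∂gaussMeasure := by
  -- Since `gaussMap` undoes every branch, the transfer of `f * (g ∘ gaussMap)` is `transfer f * g`;
  -- invariance of the mean then gives the duality.
  have h := mean_transfer ⟨_, mul_mem f.2 (comp_mem g.2 measurable_gaussMap)⟩
  rw [mean_apply, mean_apply] at h
  refine (integral_congr_ae ?_).trans h
  filter_upwards [ae_mem_Ioo] with x hx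
  have hx' := Ioo_subset_Icc_self hx
  refine ((hasSum_transfer f hx').mul_right (g x)).unique ?_
  refine (hasSum_transfer _ hx').congr_fun ?_
  intro n
  simp only [gaussMap_branch n (Ioo_subset_Ico_self hx)]
  ring

end BddMeas

open BddMeas

/-! ### The open operator and the survival measure -/

/-- The open transfer operator for the hole `I`. -/
def openOp {I : Set ℝ} (hI : MeasurableSet I) : BddMeas →ₗ[ℝ] BddMeas :=
  transfer ∘ₗ cut hI.compl

lemma openOp_apply {I : Set ℝ} (hI : MeasurableSet I) (f : BddMeas) :
    openOp hI f = transfer (cut hI.compl f) := rfl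

/-- The density of the Lebesgue measure with respect to the Gauss measure. -/
def lebDensity : BddMeas :=
  ⟨(Icc 0 1).indicator fun x => Real.log 2 * (1 + x), by
    refine ⟨Measurable.indicator (by fun_prop) measurableSet_Icc, Real.log 2 * 2, fun x => ?_⟩
    have := log_two_pos
    by_cases hx : x ∈ Icc (0 : ℝ) 1
    · rw [indicator_of_mem hx, abs_of_nonneg (mul_nonneg this.le (by linarith [hx.1]))]
      exact mul_le_mul_of_nonneg_left (by linarith [hx.2]) this.le
    · rw [indicator_of_notMem hx, abs_zero]
      positivity⟩

lemma lebDensity_apply {x : ℝ} (hx : x ∈ Icc (0 : ℝ) 1) :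
    lebDensity x = Real.log 2 * (1 + x) :=
  indicator_of_mem hx (fun x => Real.log 2 * (1 + x))

lemma mean_cut_lebDensity {A : Set ℝ} (hA : MeasurableSet A) :
    mean (cut hA lebDensity) = volume.real {x | x ∈ Icc (0 : ℝ) 1 ∧ x ∈ A} := by
  have hnn : ∀ x, 0 ≤ cut hA lebDensity x := by
    intro x
    change 0 ≤ A.indicator ((Icc (0 : ℝ) 1).indicator fun x => Real.log 2 * (1 + x)) x
    refine Set.indicator_apply_nonneg (fun _ => ?_)
    refine Set.indicator_apply_nonneg (fun hx => ?_)
    exact mul_nonneg log_two_pos.le (by linarith [hx.1])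
  rw [mean_apply, integral_eq_lintegral_of_nonneg_ae (ae_of_all _ hnn)
    (cut hA lebDensity).measurable.aestronglyMeasurable,
    lintegral_gaussMeasure (cut hA lebDensity).measurable.ennreal_ofReal, Measure.real]
  congr 1
  have h1 : ∫⁻ x in Ioo (0 : ℝ) 1, ENNReal.ofReal (density x) *
      ENNReal.ofReal (cut hA lebDensity x) = ∫⁻ x in Ioo (0 : ℝ) 1, A.indicator 1 x := by
    refine setLIntegral_congr_fun measurableSet_Ioo fun x hx => ?_
    have hx0 : 0 < 1 + x := by linarith [hx.1]
    have hl := log_two_pos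
    by_cases hxA : x ∈ A
    · simp only [cut_apply, indicator_of_mem hxA, lebDensity_apply (Ioo_subset_Icc_self hx)]
      rw [← ENNReal.ofReal_mul (density_pos hx.1.le).le]
      have : density x * (Real.log 2 * (1 + x)) = 1 := by
        unfold density; field_simp
      simp [this]
    · simp [cut_apply, hxA]
  rw [h1, lintegral_indicator_one hA, Measure.restrict_apply hA]
  have : {x | x ∈ Icc (0 : ℝ) 1 ∧ x ∈ A} = A ∩ Icc (0 : ℝ) 1 := by ext; simp only [mem_ofPred_eq, mem_inter_iff, and_comm]
  rw [this]
  exact measure_congr ((ae_eq_refl A).inter Ioo_ae_eq_Icc)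

lemma measurableSet_survivors {I : Set ℝ} (hI : MeasurableSet I) (n : ℕ) :
    MeasurableSet {x : ℝ | ∀ j < n, gaussMap^[j] x ∉ I} := by
  have : {x : ℝ | ∀ j < n, gaussMap^[j] x ∉ I} =
      ⋂ j, ⋂ (_ : j < n), (gaussMap^[j]) ⁻¹' Iᶜ := by ext; simp
  rw [this]
  exact MeasurableSet.iInter fun j => MeasurableSet.iInter fun _ =>
    (measurable_gaussMap.iterate j) hI.compl

/-- A point survives `n + 1` steps when it avoids the hole and its image survives `n` steps; duality
moves the second condition across one transfer. -/
lemma mean_openOp_pow {I : Set ℝ} (hI : MeasurableSet I) (n : ℕ) (f : BddMeas) :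
    mean ((openOp hI ^ n) f) = mean (cut (measurableSet_survivors hI n) f) := by
  classical
  induction n generalizing f with
  | zero =>
    refine mean_congr fun x _ => ?_
    simp [cut_apply]
  | succ n ih =>
    rw [pow_succ, Module.End.mul_apply, ih]
    have h := integral_transfer_mul (cut hI.compl f) (ind (measurableSet_survivors hI n))
    calc mean (cut (measurableSet_survivors hI n) (openOp hI f))
        = ∫ x, transfer (cut hI.compl f) x * ind (measurableSet_survivors hI n) x
            ∂gaussMeasure := by
          refine integral_congr_ae (ae_of_all _ fun x => ?_)
          simp only [cut_apply, ind_apply, indicator_apply, openOp_apply]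
          split_ifs <;> simp
      _ = _ := h
      _ = _ := by
          refine integral_congr_ae (ae_of_all _ fun x => ?_)
          have hiff : (∀ j < n + 1, gaussMap^[j] x ∉ I) ↔
              x ∉ I ∧ ∀ j < n, gaussMap^[j] (gaussMap x) ∉ I := by
            constructor
            · intro h
              exact ⟨h 0 (by omega), fun j hj => by
                simpa [Function.iterate_succ_apply] using h (j + 1) (by omega)⟩
            · rintro ⟨h0, h⟩ j hj
              cases j with
              | zero => exact h0
              | succ j => simpa [Function.iterate_succ_apply] using h j (by omega)
          simp only [cut_apply, ind_apply, indicator_apply, mem_compl_iff, mem_ofPred_eq, hiff]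
          by_cases h1 : x ∈ I <;>
            by_cases h2 : ∀ j < n, gaussMap^[j] (gaussMap x) ∉ I <;> simp [h1, h2]

lemma survival_eq_mean {I : Set ℝ} (hI : MeasurableSet I) (n : ℕ) :
    survival I n = mean ((openOp hI ^ n) lebDensity) := by
  rw [mean_openOp_pow, mean_cut_lebDensity]
  rfl

/-! ### A Perron–Frobenius theorem for cones -/

/-- Exponential asymptotics of a sequence. -/
def HasGeometricDecay (a : ℕ → ℝ) (lam : ℝ) : Prop :=
  0 < lam ∧ ∃ C : ℝ, 0 < C ∧ Tendsto (fun n => a n / lam ^ n) atTop (𝓝 C)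

/-- If the ratios of consecutive terms of a positive sequence converge fast enough, then the
sequence has exact exponential asymptotics. -/
lemma hasGeometricDecay_of_summable {s : ℕ → ℝ} (hs : ∀ n, 0 < s n) {lam a : ℝ} (ha : 0 < a)
    {N : ℕ} (hlam : a ≤ lam) (hr : ∀ n, N ≤ n → a ≤ s (n + 1) / s n) {d : ℕ → ℝ}
    (hd : Summable d) (hrd : ∀ n, N ≤ n → |s (n + 1) / s n - lam| ≤ d n) :
    HasGeometricDecay s lam := by
  have hl : 0 < lam := ha.trans_le hlam
  -- The logarithm is Lipschitz with constant `1 / a` on `[a, ∞)`; this turns summable errors of the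
  -- ratios into summable increments of `log s - n * log lam`.
  have hlip : ∀ x y : ℝ, a ≤ x → a ≤ y → |Real.log x - Real.log y| ≤ |x - y| / a := by
    have key : ∀ x y : ℝ, a ≤ x → a ≤ y → Real.log x - Real.log y ≤ |x - y| / a := by
      intro x y hx hy
      have hx0 := ha.trans_le hx
      have hy0 := ha.trans_le hy
      rw [← Real.log_div hx0.ne' hy0.ne']
      calc Real.log (x / y) ≤ x / y - 1 := Real.log_le_sub_one_of_pos (by positivity)
        _ = (x - y) / y := by field_simp
        _ ≤ |x - y| / y := by gcongr; exact le_abs_self _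
        _ ≤ |x - y| / a := by gcongr
    intro x y hx hy
    rw [abs_le]
    have h1 := key y x hy hx
    rw [abs_sub_comm] at h1
    exact ⟨by linarith, key x y hx hy⟩
  set t : ℕ → ℝ := fun n => Real.log (s (n + N)) - (n : ℝ) * Real.log lam with ht
  have hstep : ∀ n, dist (t n) (t (n + 1)) ≤ d (n + N) / a := by
    intro n
    have e : t (n + 1) - t n = Real.log (s (n + N + 1) / s (n + N)) - Real.log lam := by
      rw [Real.log_div (hs _).ne' (hs _).ne']
      simp only [ht]
      push_cast
      rw [show n + 1 + N = n + N + 1 by ring]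
      ring
    rw [dist_comm, Real.dist_eq, e]
    refine (hlip _ _ (hr _ (Nat.le_add_left _ _)) hlam).trans ?_
    gcongr
    exact hrd _ (Nat.le_add_left _ _)
  have hsum : Summable fun n => d (n + N) / a := ((summable_nat_add_iff N).2 hd).div_const a
  obtain ⟨L, hL⟩ := cauchySeq_tendsto_of_complete (cauchySeq_of_dist_le_of_summable _ hstep hsum)
  refine ⟨hl, Real.exp L / lam ^ N, by positivity, ?_⟩
  rw [← tendsto_add_atTop_iff_nat N]
  have h2 := ((Real.continuous_exp.tendsto L).comp hL).div_const (lam ^ N)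
  refine h2.congr fun n => ?_
  simp only [ht, Function.comp]
  rw [Real.exp_sub, Real.exp_log (hs _), mul_comm (n : ℝ), Real.exp_mul, Real.exp_log hl,
    Real.rpow_natCast, pow_add, div_div]

/-- The contraction is gained only once every `m` steps, so errors are powers of `θ` with exponent
`n / m` rounded down. They are at most `θ⁻¹` times the `n`-th power of `θ ^ (1 / m)`. -/
lemma summable_pow_div {θ : ℝ} (h0 : 0 < θ) (h1 : θ < 1) {m : ℕ} (hm : 0 < m) :
    Summable fun n : ℕ => θ ^ (n / m) := by
  have hm' : (0 : ℝ) < m := by exact_mod_cast hm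
  have hθ : θ ^ (1 / (m : ℝ)) < 1 := Real.rpow_lt_one h0.le h1 (by positivity)
  refine Summable.of_nonneg_of_le (fun n => by positivity) (fun n => ?_)
    ((summable_geometric_of_lt_one (by positivity) hθ).mul_left θ⁻¹)
  rw [← Real.rpow_natCast θ (n / m), ← Real.rpow_mul_natCast h0.le, ← Real.rpow_neg_one,
    ← Real.rpow_add h0]
  apply Real.rpow_le_rpow_of_exponent_ge h0 h1.le
  have h2 : (n : ℝ) < m * ((n / m : ℕ) + 1) := by
    exact_mod_cast Nat.lt_mul_div_succ n hm
  have h3 : 1 / (m : ℝ) * n ≤ (n / m : ℕ) + 1 := by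
    rw [div_mul_eq_mul_div, one_mul, div_le_iff₀ hm']
    linarith
  linarith

/-- A Perron–Frobenius theorem of Birkhoff–Hopf type: if a power of a linear operator maps a
convex cone into a part of it that is bounded in the projective sense, then the iterates of each
vector have exact exponential asymptotics when measured by a positive functional. -/
theorem exists_hasGeometricDecay_of_cone {E : Type*} [AddCommGroup E] [Module ℝ E]
    (Q : Module.End ℝ E) (C : Set E) (ℓ : E →ₗ[ℝ] ℝ) (e g : E) (m : ℕ) (R : ℝ)
    (hm : 0 < m) (hR : 1 < R)
    (hadd : ∀ f ∈ C, ∀ h ∈ C, f + h ∈ C) (hsmul : ∀ a : ℝ, 0 ≤ a → ∀ f ∈ C, a • f ∈ C)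
    (hQ : ∀ i, m ≤ i → ∀ f ∈ C, (Q ^ i) f ∈ C) (hℓ : ∀ f ∈ C, 0 ≤ ℓ f)
    (hcomp : ∀ f ∈ C, ∃ α : ℝ, 0 ≤ α ∧ (Q ^ m) f - α • e ∈ C ∧ (R * α) • e - (Q ^ m) f ∈ C)
    (hg : ∀ i, m ≤ i → (Q ^ i) g ∈ C) (he : 0 < ℓ e) (hpos : ∀ n, 0 < ℓ ((Q ^ n) g)) :
    ∃ lam, HasGeometricDecay (fun n => ℓ ((Q ^ n) g)) lam := by
  have hR0 : 0 < R := by linarith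
  have hG : ∀ n, m ≤ n → ∃ α : ℝ, 0 < α ∧ (Q ^ (m + n)) g - α • e ∈ C ∧
      (R * α) • e - (Q ^ (m + n)) g ∈ C := by
    intro n hn
    obtain ⟨α, h0, h1, h2⟩ := hcomp _ (hg n hn)
    rw [← Module.End.mul_apply, ← pow_add] at h1 h2
    -- If `α` were zero, the upper bound would put the negative of the iterate into the cone,
    -- against the positivity of `ℓ` on iterates.
    refine ⟨α, lt_of_le_of_ne h0 fun h => ?_, h1, h2⟩
    have h3 := hℓ _ h2
    rw [← h] at h3
    simp only [mul_zero, zero_smul, zero_sub, map_neg] at h3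
    linarith [hpos (m + n)]
  set θ : ℝ := 1 - 1 / R ^ 2 with hθ
  have hR2 : 1 < R ^ 2 := by nlinarith
  have hθ0 : 0 < θ := by
    rw [hθ, sub_pos, div_lt_one (by positivity)]; exact hR2
  have hθ1 : θ < 1 := by rw [hθ]; linarith [show 0 < 1 / R ^ 2 by positivity]
  -- one contraction step
  have hstep : ∀ n, m ≤ n → ∀ a b : ℝ, 0 < a → a ≤ b →
      (Q ^ (n + 1)) g - a • (Q ^ n) g ∈ C → b • (Q ^ n) g - (Q ^ (n + 1)) g ∈ C →
      ∃ a' b' : ℝ, a ≤ a' ∧ b' ≤ b ∧ a' ≤ b' ∧ b' - a' ≤ θ * (b - a) ∧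
        (Q ^ (m + n + 1)) g - a' • (Q ^ (m + n)) g ∈ C ∧
        b' • (Q ^ (m + n)) g - (Q ^ (m + n + 1)) g ∈ C := by
    intro n hn a b ha hab h1 h2
    obtain ⟨α, hα, hα1, hα2⟩ := hG n hn
    obtain ⟨α₁, h10, h11, h12⟩ := hcomp _ h1
    obtain ⟨α₂, h20, h21, h22⟩ := hcomp _ h2
    simp only [map_sub, map_smul, ← Module.End.mul_apply, ← pow_add, ← add_assoc] at h11 h12 h21 h22
    set G := (Q ^ (m + n)) g
    set G' := (Q ^ (m + n + 1)) g
    have hRα : 0 < R * α := by positivity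
    -- After `m` steps the slack of the lower bound dominates `α₁ • e`, and `e` dominates `G`
    -- divided by `R * α`, so the lower bound rises by `α₁ / (R * α)`. The upper bound falls
    -- likewise.
    have k1 : G' - (a + α₁ / (R * α)) • G ∈ C := by
      have := hadd _ h11 _ (hsmul (α₁ / (R * α)) (by positivity) _ hα2)
      convert this using 1
      rw [smul_sub, smul_smul, div_mul_cancel₀ _ hRα.ne', add_smul]
      abel
    have k2 : (b - α₂ / (R * α)) • G - G' ∈ C := by
      have := hadd _ h21 _ (hsmul (α₂ / (R * α)) (by positivity) _ hα2)
      convert this using 1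
      rw [smul_sub, smul_smul, div_mul_cancel₀ _ hRα.ne', sub_smul]
      abel
    refine ⟨a + α₁ / (R * α), b - α₂ / (R * α), by linarith [show 0 ≤ α₁ / (R * α) by positivity],
      by linarith [show 0 ≤ α₂ / (R * α) by positivity], ?_, ?_, k1, k2⟩
    · have e1 := hℓ _ k1
      have e2 := hℓ _ k2
      simp only [map_sub, map_smul, smul_eq_mul] at e1 e2
      have hp : 0 < ℓ G := hpos _
      exact le_of_mul_le_mul_right (by linarith) hp
    · -- compare the sum of the two gains with the initial width
      have e0 := hℓ _ hα1
      have e1 := hℓ _ h12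
      have e2 := hℓ _ h22
      simp only [map_sub, map_smul, smul_eq_mul] at e0 e1 e2
      -- The two slack vectors add up to `(b - a) • G`, which is at least `(b - a) * α` and at most
      -- `R * (α₁ + α₂)` times `e`. Hence the total gain is at least the fraction `1 / R ^ 2` of the
      -- width.
      have e3 : (b - a) * α * ℓ e ≤ R * (α₁ + α₂) * ℓ e := by
        have : (b - a) * (α * ℓ e) ≤ (b - a) * ℓ G :=
          mul_le_mul_of_nonneg_left (by linarith) (by linarith)
        nlinarith
      have e4 : (b - a) * α ≤ R * (α₁ + α₂) := le_of_mul_le_mul_right e3 he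
      have e5 : (b - a) / R ^ 2 ≤ (α₁ + α₂) / (R * α) := by
        rw [div_le_div_iff₀ (by positivity) hRα]
        nlinarith
      have e6 : (α₁ + α₂) / (R * α) = α₁ / (R * α) + α₂ / (R * α) := add_div _ _ _
      have e7 : θ * (b - a) = (b - a) - (b - a) / R ^ 2 := by rw [hθ]; ring
      linarith
  -- initial bounds
  have hinit : ∃ a b : ℝ, 0 < a ∧ a ≤ b ∧
      (Q ^ (m + m + 1)) g - a • (Q ^ (m + m)) g ∈ C ∧
      b • (Q ^ (m + m)) g - (Q ^ (m + m + 1)) g ∈ C := by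
    obtain ⟨α, hα, h1, h2⟩ := hG m le_rfl
    obtain ⟨α', hα', h1', h2'⟩ := hG (m + 1) (by omega)
    rw [← add_assoc] at h1' h2'
    set G := (Q ^ (m + m)) g
    set G' := (Q ^ (m + m + 1)) g
    have k1 : G' - (α' / (R * α)) • G ∈ C := by
      have := hadd _ h1' _ (hsmul (α' / (R * α)) (by positivity) _ h2)
      convert this using 1
      rw [smul_sub, smul_smul, div_mul_cancel₀ _ (by positivity)]
      abel
    have k2 : (R * α' / α) • G - G' ∈ C := by
      have := hadd _ h2' _ (hsmul (R * α' / α) (by positivity) _ h1)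
      convert this using 1
      rw [smul_sub, smul_smul, div_mul_cancel₀ _ (by positivity)]
      abel
    refine ⟨α' / (R * α), R * α' / α, by positivity, ?_, k1, k2⟩
    have e1 := hℓ _ k1
    have e2 := hℓ _ k2
    simp only [map_sub, map_smul, smul_eq_mul] at e1 e2
    exact le_of_mul_le_mul_right (by linarith) (hpos (m + m))
  obtain ⟨a₀, b₀, ha₀, hab₀, hi1, hi2⟩ := hinit
  have hseq : ∀ j : ℕ, ∃ a b : ℝ, a₀ ≤ a ∧ a ≤ b ∧ b - a ≤ θ ^ j * (b₀ - a₀) ∧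
      (Q ^ (j * m + (m + m) + 1)) g - a • (Q ^ (j * m + (m + m))) g ∈ C ∧
      b • (Q ^ (j * m + (m + m))) g - (Q ^ (j * m + (m + m) + 1)) g ∈ C := by
    intro j
    induction j with
    | zero => exact ⟨a₀, b₀, le_rfl, hab₀, by simp, by simpa using hi1, by simpa using hi2⟩
    | succ j ih =>
      obtain ⟨a, b, haa, hab, hw, h1, h2⟩ := ih
      obtain ⟨a', b', h3, h4, h5, h6, h7, h8⟩ :=
        hstep _ (by omega) a b (ha₀.trans_le haa) hab h1 h2
      rw [show m + (j * m + (m + m)) = (j + 1) * m + (m + m) by ring] at h7 h8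
      refine ⟨a', b', haa.trans h3, h5, h6.trans ?_, h7, h8⟩
      rw [pow_succ']
      nlinarith
  set s : ℕ → ℝ := fun n => ℓ ((Q ^ n) g) with hs
  -- Applying `Q ^ i` and then `ℓ` to the two cone relations traps all later ratios. The relations
  -- hold at index `j * m + 2 * m`, and `Q ^ i` is known to preserve the cone only for `m ≤ i`,
  -- whence `3 * m`.
  have hratio : ∀ j : ℕ, ∃ a b : ℝ, a₀ ≤ a ∧ b - a ≤ θ ^ j * (b₀ - a₀) ∧
      ∀ n, j * m + 3 * m ≤ n → a ≤ s (n + 1) / s n ∧ s (n + 1) / s n ≤ b := by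
    intro j
    obtain ⟨a, b, haa, hab, hw, h1, h2⟩ := hseq j
    refine ⟨a, b, haa, hw, fun n hn => ?_⟩
    obtain ⟨i, rfl⟩ : ∃ i, n = i + (j * m + (m + m)) := ⟨n - (j * m + (m + m)), by omega⟩
    have hi : m ≤ i := by omega
    have e1 := hℓ _ (hQ i hi _ h1)
    have e2 := hℓ _ (hQ i hi _ h2)
    simp only [map_sub, map_smul, smul_eq_mul, ← Module.End.mul_apply, ← pow_add,
      ← add_assoc] at e1 e2
    have hp : 0 < s (i + (j * m + (m + m))) := hpos _
    rw [le_div_iff₀ hp, div_le_iff₀ hp]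
    simp only [hs, ← add_assoc]
    constructor <;> linarith
  choose a b ha hw hab using hratio
  -- the limit of the ratios
  have hθt : Tendsto (fun j : ℕ => θ ^ j * (b₀ - a₀)) atTop (𝓝 0) := by
    simpa using (tendsto_pow_atTop_nhds_zero_of_lt_one hθ0.le hθ1).mul_const (b₀ - a₀)
  have hcauchy : CauchySeq fun n => s (n + 1) / s n := by
    rw [Metric.cauchySeq_iff']
    intro ε hε
    obtain ⟨j, hj⟩ := ((tendsto_order.1 hθt).2 ε hε).exists
    refine ⟨j * m + 3 * m, fun n hn => ?_⟩
    have h1 := hab j n hn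
    have h2 := hab j _ (le_refl (j * m + 3 * m))
    have h3 := hw j
    rw [Real.dist_eq, abs_lt]
    constructor <;> linarith
  obtain ⟨lam, hlam⟩ := cauchySeq_tendsto_of_complete hcauchy
  have hla : ∀ j, a j ≤ lam ∧ lam ≤ b j := fun j =>
    ⟨ge_of_tendsto hlam (eventually_atTop.2 ⟨_, fun n hn => (hab j n hn).1⟩),
      le_of_tendsto hlam (eventually_atTop.2 ⟨_, fun n hn => (hab j n hn).2⟩)⟩
  -- The factor `θ⁻¹ ^ 3` compensates for this delay of three blocks of length `m`.
  refine ⟨lam, hasGeometricDecay_of_summable hpos ha₀ (N := 3 * m)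
    (d := fun n => θ ^ (n / m) * (θ⁻¹ ^ 3 * (b₀ - a₀))) ((ha 0).trans (hla 0).1)
    (fun n hn => (ha 0).trans (hab 0 n (by omega)).1)
    ((summable_pow_div hθ0 hθ1 hm).mul_right _) fun n hn => ?_⟩
  have hd3 : 3 ≤ n / m := (Nat.le_div_iff_mul_le hm).2 hn
  obtain ⟨j, hj⟩ : ∃ j, n / m = j + 3 := ⟨n / m - 3, by omega⟩
  have hjn : j * m + 3 * m ≤ n := by
    rw [← add_mul, ← hj]; exact Nat.div_mul_le_self n m
  have h1 := hab j n hjn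
  have h2 := hla j
  have h3 := hw j
  have h4 : θ ^ (n / m) * (θ⁻¹ ^ 3 * (b₀ - a₀)) = θ ^ j * (b₀ - a₀) := by
    rw [hj, pow_add]
    field_simp
  rw [h4]
  change |s (n + 1) / s n - lam| ≤ _
  rw [abs_le]
  constructor <;> linarith

/-! ### Lasota–Yorke inequality and the cone of bounded variation -/

lemma HasVar.abs_sub_mean {f : BddMeas} {v : ℝ} (h : HasVar f v) {x : ℝ}
    (hx : x ∈ Icc (0 : ℝ) 1) : |f x - mean f| ≤ v := by
  have h1 : mean (BddMeas.const (f x - v)) ≤ mean f := mean_mono fun y hy => by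
    have := (abs_le.1 (h.abs_sub_le hx (Ioo_subset_Icc_self hy))).2
    change f x - v ≤ f y
    linarith
  have h2 : mean f ≤ mean (BddMeas.const (f x + v)) := mean_mono fun y hy => by
    have := (abs_le.1 (h.abs_sub_le hx (Ioo_subset_Icc_self hy))).1
    change f y ≤ f x + v
    linarith
  rw [mean_const] at h1 h2
  rw [abs_le]
  constructor <;> linarith

lemma HasVar.transfer {f : BddMeas} {v : ℝ} (h : HasVar f v) :
    HasVar (BddMeas.transfer f) (v / 2) :=
  h.gkl.congr fun _ hx => transfer_apply f hx

lemma mean_transfer_pow (f : BddMeas) (n : ℕ) : mean ((transfer ^ n) f) = mean f := by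
  induction n with
  | zero => rfl
  | succ n ih => rw [pow_succ', Module.End.mul_apply, mean_transfer, ih]

lemma HasVar.transfer_pow {f : BddMeas} {v : ℝ} (h : HasVar f v) (n : ℕ) :
    HasVar ((BddMeas.transfer ^ n) f) (v / 2 ^ n) := by
  induction n with
  | zero => simpa using h
  | succ n ih =>
    rw [_root_.pow_succ', Module.End.mul_apply, pow_succ (2 : ℝ), ← div_div]
    exact ih.transfer

lemma HasVar.abs_transfer_pow_sub_mean {f : BddMeas} {v : ℝ} (h : HasVar f v) (n : ℕ) {x : ℝ}
    (hx : x ∈ Icc (0 : ℝ) 1) : |(BddMeas.transfer ^ n) f x - mean f| ≤ v / 2 ^ n := by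
  have := (h.transfer_pow n).abs_sub_mean hx
  rwa [mean_transfer_pow] at this

/-- `f` is nonnegative on `[0,1]`. -/
def NonnegOn (f : BddMeas) : Prop := ∀ x ∈ Icc (0 : ℝ) 1, 0 ≤ f x

lemma cut_apply_of_mem {A : Set ℝ} (hA : MeasurableSet A) (f : BddMeas) {x : ℝ} (hx : x ∈ A) :
    cut hA f x = f x := indicator_of_mem hx _

lemma cut_apply_of_notMem {A : Set ℝ} (hA : MeasurableSet A) (f : BddMeas) {x : ℝ} (hx : x ∉ A) :
    cut hA f x = 0 := indicator_of_notMem hx _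

lemma NonnegOn.cut {f : BddMeas} (hf : NonnegOn f) {A : Set ℝ} (hA : MeasurableSet A) :
    NonnegOn (BddMeas.cut hA f) := fun x hx => by
  by_cases hxA : x ∈ A
  · rw [cut_apply_of_mem hA f hxA]; exact hf x hx
  · rw [cut_apply_of_notMem hA f hxA]

lemma NonnegOn.transfer {f : BddMeas} (hf : NonnegOn f) : NonnegOn (BddMeas.transfer f) :=
  fun x hx => by rw [transfer_apply f hx]; exact gkl_nonneg hf hx.1

lemma NonnegOn.transfer_pow {f : BddMeas} (hf : NonnegOn f) (n : ℕ) :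
    NonnegOn ((BddMeas.transfer ^ n) f) := by
  induction n with
  | zero => exact hf
  | succ n ih => rw [_root_.pow_succ', Module.End.mul_apply]; exact ih.transfer

lemma NonnegOn.mean {f : BddMeas} (hf : NonnegOn f) : 0 ≤ BddMeas.mean f :=
  mean_nonneg fun x hx => hf x (Ioo_subset_Icc_self hx)

lemma nonnegOn_ind {A : Set ℝ} (hA : MeasurableSet A) : NonnegOn (ind hA) := fun x _ => by
  rw [ind_apply]
  by_cases hx : x ∈ A <;> simp [hx]

lemma cut_compl_add_cut {I : Set ℝ} (hI : MeasurableSet I) (f : BddMeas) :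
    cut hI.compl f + cut hI f = f := by
  ext x
  by_cases hx : x ∈ I <;> simp [cut_apply, hx]

lemma NonnegOn.openOp {f : BddMeas} (hf : NonnegOn f) {I : Set ℝ} (hI : MeasurableSet I) :
    NonnegOn (openOp hI f) := (hf.cut hI.compl).transfer

lemma NonnegOn.openOp_pow {f : BddMeas} (hf : NonnegOn f) {I : Set ℝ} (hI : MeasurableSet I)
    (n : ℕ) : NonnegOn ((GaussHoles.openOp hI ^ n) f) := by
  induction n with
  | zero => exact hf
  | succ n ih => rw [_root_.pow_succ', Module.End.mul_apply]; exact ih.openOp hI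

lemma mean_openOp {I : Set ℝ} (hI : MeasurableSet I) (f : BddMeas) :
    mean (openOp hI f) = mean f - mean (cut hI f) := by
  rw [openOp_apply, mean_transfer, eq_sub_iff_add_eq, ← map_add, cut_compl_add_cut]

lemma openOp_le_transfer {I : Set ℝ} (hI : MeasurableSet I) {f g : BddMeas} (hf : NonnegOn f)
    (hfg : ∀ x ∈ Icc (0 : ℝ) 1, f x ≤ g x) {x : ℝ} (hx : x ∈ Icc (0 : ℝ) 1) :
    openOp hI f x ≤ transfer g x := by
  refine transfer_mono (fun y hy => ?_) hx
  by_cases hyI : y ∈ I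
  · rw [cut_apply_of_notMem _ _ (notMem_compl_iff.2 hyI)]
    exact (hf y hy).trans (hfg y hy)
  · rw [cut_apply_of_mem _ _ (mem_compl hyI)]
    exact hfg y hy

lemma openOp_pow_le {I : Set ℝ} (hI : MeasurableSet I) {f : BddMeas} (hf : NonnegOn f) (n : ℕ)
    {x : ℝ} (hx : x ∈ Icc (0 : ℝ) 1) : (openOp hI ^ n) f x ≤ (transfer ^ n) f x := by
  induction n generalizing x with
  | zero => exact le_rfl
  | succ n ih =>
    rw [pow_succ', pow_succ', Module.End.mul_apply, Module.End.mul_apply]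
    exact openOp_le_transfer hI (hf.openOp_pow hI n) (fun y hy => ih hy) hx

lemma HasVar.transfer_pow_le {f : BddMeas} {v : ℝ} (h : HasVar f v) (n : ℕ) {x : ℝ}
    (hx : x ∈ Icc (0 : ℝ) 1) : (BddMeas.transfer ^ n) f x ≤ mean f + v / 2 ^ n := by
  linarith [(abs_le.1 (h.abs_transfer_pow_sub_mean n hx)).2]

lemma HasVar.le_transfer_pow {f : BddMeas} {v : ℝ} (h : HasVar f v) (n : ℕ) {x : ℝ}
    (hx : x ∈ Icc (0 : ℝ) 1) : mean f - v / 2 ^ n ≤ (BddMeas.transfer ^ n) f x := by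
  linarith [(abs_le.1 (h.abs_transfer_pow_sub_mean n hx)).1]

lemma HasVar.openOp {f : BddMeas} {v S : ℝ} (h : HasVar f v) (hf : NonnegOn f)
    (hS : ∀ x ∈ Icc (0 : ℝ) 1, f x ≤ S) {I : Set ℝ} (hI : MeasurableSet I)
    (hIo : I.OrdConnected) : HasVar (openOp hI f) ((v + 2 * S) / 2) :=
  HasVar.transfer (f := BddMeas.cut hI.compl f) (h.cut hf hS hIo)

/-- A Lasota–Yorke inequality, uniform in the hole. -/
lemma HasVar.openOp_pow {f : BddMeas} {v : ℝ} (h : HasVar f v) (hf : NonnegOn f) {I : Set ℝ}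
    (hI : MeasurableSet I) (hIo : I.OrdConnected) (n : ℕ) :
    HasVar ((GaussHoles.openOp hI ^ n) f) ((2 * n + 1) * v / 2 ^ n + 2 * mean f) := by
  have hm := hf.mean
  -- This is the exact solution of the recursion `V (n + 1) = (V n + 2 * S n) / 2`, where `S n =
  -- mean f + v / 2 ^ n` bounds the `n`-th iterate: cutting adds `2 * S n`, the transfer halves.
  suffices HasVar ((GaussHoles.openOp hI ^ n) f)
      ((2 * n + 1) * v / 2 ^ n + 2 * (1 - 1 / 2 ^ n) * mean f) by
    refine this.mono ?_
    have h1 : 0 ≤ 1 / (2 : ℝ) ^ n * mean f := by positivity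
    nlinarith
  induction n with
  | zero => simpa using h
  | succ n ih =>
    rw [_root_.pow_succ', Module.End.mul_apply]
    refine (ih.openOp (hf.openOp_pow hI n) (S := mean f + v / 2 ^ n) (fun x hx =>
      (openOp_pow_le hI hf n hx).trans (h.transfer_pow_le n hx)) hI hIo).mono (le_of_eq ?_)
    rw [pow_succ]
    push_cast
    field_simp
    ring

lemma mean_cut_le {f : BddMeas} {S : ℝ} (hS : ∀ x ∈ Icc (0 : ℝ) 1, f x ≤ S) {I : Set ℝ}
    (hI : MeasurableSet I) : mean (cut hI f) ≤ S * gaussMeasure.real I := by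
  rw [← mean_ind hI, ← smul_eq_mul, ← map_smul]
  refine mean_mono fun x hx => ?_
  have := hS x (Ioo_subset_Icc_self hx)
  change cut hI f x ≤ S * ind hI x
  rw [ind_apply]
  by_cases hxI : x ∈ I
  · simpa [cut_apply, hxI] using this
  · simp [cut_apply, hxI]

lemma HasVar.mean_openOp_pow_ge {f : BddMeas} {v : ℝ} (h : HasVar f v) (hf : NonnegOn f)
    {I : Set ℝ} (hI : MeasurableSet I) (n : ℕ) :
    mean f - n * ((mean f + v) * gaussMeasure.real I) ≤ mean ((GaussHoles.openOp hI ^ n) f) := by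
  induction n with
  | zero => simp
  | succ n ih =>
    rw [_root_.pow_succ', Module.End.mul_apply, mean_openOp]
    have h1 := mean_cut_le (f := (GaussHoles.openOp hI ^ n) f) (S := mean f + v)
      (fun x hx => (openOp_pow_le hI hf n hx).trans ((h.transfer_pow_le n hx).trans (by
        have := div_le_self h.nonneg (one_le_pow₀ (one_le_two (α := ℝ)) (n := n))
        linarith))) hI
    push_cast
    linarith

/-- The cone of nonnegative functions with variation at most `a` times the mean. -/
def bvCone (a : ℝ) : Set BddMeas := {f | NonnegOn f ∧ HasVar f (a * mean f)}

/-- The threshold `8`, which recurs as the minimal number of steps, is the least `M` with this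
bound. -/
lemma two_mul_add_one_le_two_pow {M : ℕ} (hM : 8 ≤ M) : 10 * (2 * (M : ℝ) + 1) ≤ 2 ^ M := by
  induction M, hM using Nat.le_induction with
  | base => norm_num
  | succ n hn ih =>
    rw [pow_succ]
    have : (8 : ℝ) ≤ n := by exact_mod_cast hn
    push_cast
    linarith

/-- In this cone every transferred iterate is at most `5 * mean f`, so `M` steps lose at most `5 * M
* mean f` times the measure of the hole; the constant `25` makes this a fifth of the mean. -/
lemma mean_openOp_pow_ge_of_mem_bvCone {f : BddMeas} (hf : f ∈ bvCone 4) {I : Set ℝ}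
    (hI : MeasurableSet I) {M : ℕ} (hδ : 25 * M * gaussMeasure.real I ≤ 1) :
    4 / 5 * mean f ≤ mean ((openOp hI ^ M) f) := by
  have h1 := hf.2.mean_openOp_pow_ge hf.1 hI M
  have h2 := mul_le_mul_of_nonneg_right hδ hf.1.mean
  nlinarith

/-- The Lasota–Yorke bound gives variation at most `(2 / 5 + 2) * mean f`, which is three times the
`4 / 5 * mean f` that survive. The gap between `3` and `4` is the room used for the cone
contraction. -/
lemma openOp_pow_mem_bvCone {f : BddMeas} (hf : f ∈ bvCone 4) {I : Set ℝ}
    (hI : MeasurableSet I) (hIo : I.OrdConnected) {M : ℕ} (hM : 8 ≤ M)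
    (hδ : 25 * M * gaussMeasure.real I ≤ 1) : (openOp hI ^ M) f ∈ bvCone 3 := by
  refine ⟨hf.1.openOp_pow hI M, (hf.2.openOp_pow hf.1 hI hIo M).mono ?_⟩
  have h1 := mean_openOp_pow_ge_of_mem_bvCone hf hI hδ
  have h2 := two_mul_add_one_le_two_pow hM
  have hm := hf.1.mean
  have h3 : (2 * (M : ℝ) + 1) * (4 * mean f) / 2 ^ M ≤ 2 / 5 * mean f := by
    rw [div_le_iff₀ (by positivity)]
    nlinarith
  linarith

lemma bvCone_mono {a b : ℝ} (hab : a ≤ b) : bvCone a ⊆ bvCone b := fun _ hf =>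
  ⟨hf.1, hf.2.mono (mul_le_mul_of_nonneg_right hab hf.1.mean)⟩

lemma mean_lebDensity : mean lebDensity = 1 := by
  have h := mean_cut_lebDensity MeasurableSet.univ
  have h1 : cut MeasurableSet.univ lebDensity = lebDensity := by
    ext x; simp [cut_apply]
  have h2 : {x : ℝ | x ∈ Icc (0 : ℝ) 1 ∧ x ∈ univ} = Icc 0 1 := by ext; simp
  rw [h1, h2] at h
  rw [h]
  simp

lemma lebDensity_mem_bvCone : lebDensity ∈ bvCone 1 := by
  have hl := log_two_pos
  refine ⟨fun x hx => ?_, fun x => Real.log 2 * (1 + x), fun _ => 0, fun x _ y _ hxy => ?_,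
    monotoneOn_const, fun x hx => ?_, ?_⟩
  · rw [lebDensity_apply hx]
    exact mul_nonneg hl.le (by linarith [hx.1])
  · exact mul_le_mul_of_nonneg_left (by linarith) hl.le
  · rw [lebDensity_apply hx, sub_zero]
  · rw [mean_lebDensity]
    linarith [Real.log_two_lt_d9]

/-! ### Lost mass, returns to the hole, and bounds for the decay rate -/

/-- The measure of the part of the hole that does not return to it within `r` steps. -/
def noReturn {I : Set ℝ} (hI : MeasurableSet I) (r : ℕ) : ℝ :=
  mean ((openOp hI ^ r) (transfer (ind hI)))

lemma openOp_pow_mono {I : Set ℝ} (hI : MeasurableSet I) {f g : BddMeas}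
    (h : ∀ x ∈ Icc (0 : ℝ) 1, f x ≤ g x) (n : ℕ) {x : ℝ} (hx : x ∈ Icc (0 : ℝ) 1) :
    (openOp hI ^ n) f x ≤ (openOp hI ^ n) g x := by
  have h1 : NonnegOn (g - f) := fun x hx => sub_nonneg.2 (h x hx)
  have h2 := h1.openOp_pow hI n x hx
  rw [map_sub] at h2
  exact sub_nonneg.1 h2

lemma noReturn_nonneg {I : Set ℝ} (hI : MeasurableSet I) (r : ℕ) : 0 ≤ noReturn hI r :=
  ((nonnegOn_ind hI).transfer.openOp_pow hI r).mean

lemma noReturn_succ {I : Set ℝ} (hI : MeasurableSet I) (r : ℕ) :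
    noReturn hI (r + 1) =
      noReturn hI r - mean (cut hI ((openOp hI ^ r) (transfer (ind hI)))) := by
  rw [noReturn, pow_succ', Module.End.mul_apply, mean_openOp]
  rfl

lemma noReturn_antitone {I : Set ℝ} (hI : MeasurableSet I) : Antitone (noReturn hI) :=
  antitone_nat_of_succ_le fun r => by
    rw [noReturn_succ]
    linarith [(((nonnegOn_ind hI).transfer.openOp_pow hI r).cut hI).mean]

lemma noReturn_zero {I : Set ℝ} (hI : MeasurableSet I) :
    noReturn hI 0 = gaussMeasure.real I := by
  rw [noReturn, pow_zero, Module.End.one_apply, mean_transfer, mean_ind]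

/-- Decomposition of the lost mass according to the last visit to the hole. -/
lemma mean_sub_mean_openOp_pow {I : Set ℝ} (hI : MeasurableSet I) (M : ℕ) (f : BddMeas) :
    mean f - mean ((openOp hI ^ M) f) = ∑ j ∈ Finset.range M,
      mean ((openOp hI ^ (M - 1 - j)) (transfer (cut hI ((transfer ^ j) f)))) := by
  induction M generalizing f with
  | zero => simp
  | succ M ih =>
    have h1 : openOp hI f = transfer f - transfer (cut hI f) := by
      rw [openOp_apply, eq_sub_iff_add_eq, ← map_add, cut_compl_add_cut]
    rw [Finset.sum_range_succ', pow_succ, Module.End.mul_apply, h1, map_sub, map_sub,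
      ← mean_transfer f]
    have h2 := ih (transfer f)
    have h3 : ∀ j ∈ Finset.range M, mean ((openOp hI ^ (M + 1 - 1 - (j + 1)))
        (transfer (cut hI ((transfer ^ (j + 1)) f)))) = mean ((openOp hI ^ (M - 1 - j))
        (transfer (cut hI ((transfer ^ j) (transfer f))))) := by
      intro j _
      rw [pow_succ, Module.End.mul_apply]
      rw [show M + 1 - 1 - (j + 1) = M - 1 - j by omega]
    rw [Finset.sum_congr rfl h3, ← h2]
    simp only [Nat.add_sub_cancel, Nat.sub_zero, pow_zero, Module.End.one_apply]
    ring

lemma mean_visit_le {I : Set ℝ} (hI : MeasurableSet I) {h : BddMeas} {c : ℝ}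
    (hc : ∀ x ∈ Icc (0 : ℝ) 1, h x ≤ c) (r : ℕ) :
    mean ((openOp hI ^ r) (transfer (cut hI h))) ≤ c * noReturn hI r := by
  rw [noReturn, ← smul_eq_mul, ← map_smul, ← map_smul, ← map_smul]
  refine mean_mono fun x hx => openOp_pow_mono hI (fun y hy => transfer_mono (fun t ht => ?_) hy) r
    (Ioo_subset_Icc_self hx)
  have := hc t ht
  change cut hI h t ≤ c * ind hI t
  rw [ind_apply]
  by_cases htI : t ∈ I
  · simpa [cut_apply, htI] using this
  · simp [cut_apply, htI]

lemma mean_visit_ge {I : Set ℝ} (hI : MeasurableSet I) {h : BddMeas} {c : ℝ}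
    (hc : ∀ x ∈ Icc (0 : ℝ) 1, c ≤ h x) (r : ℕ) :
    c * noReturn hI r ≤ mean ((openOp hI ^ r) (transfer (cut hI h))) := by
  have h1 := mean_visit_le hI (h := -h) (c := -c) (fun x hx => neg_le_neg (hc x hx)) r
  simp only [map_neg] at h1
  linarith

lemma sum_range_const_div_two_pow (a : ℝ) (M : ℕ) :
    ∑ j ∈ Finset.range M, a / 2 ^ j = 2 * a - 2 * a / 2 ^ M := by
  induction M with
  | zero => simp
  | succ M ih =>
    rw [Finset.sum_range_succ, ih, pow_succ]
    field_simp
    ring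

/-- At time `j` the closed density is at least `(1 - 4 / 2 ^ j) * mean f`, and these factors sum to
at least `M - 8`. For the `j` with a negative factor it suffices that the lost mass is nonnegative.
-/
lemma lost_mass_ge {f : BddMeas} (hf : f ∈ bvCone 4) {I : Set ℝ} (hI : MeasurableSet I) (M : ℕ) :
    (M - 8) * noReturn hI M * mean f ≤ mean f - mean ((openOp hI ^ M) f) := by
  have hm := hf.1.mean
  rw [mean_sub_mean_openOp_pow]
  have hterm : ∀ j ∈ Finset.range M, (1 - 4 / 2 ^ j) * (noReturn hI M * mean f) ≤
      mean ((openOp hI ^ (M - 1 - j)) (transfer (cut hI ((transfer ^ j) f)))) := by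
    intro j _
    have h1 : 0 ≤ noReturn hI M * mean f := mul_nonneg (noReturn_nonneg hI M) hm
    rcases le_or_gt 0 (1 - 4 / (2 : ℝ) ^ j) with hc | hc
    · have h2 := mean_visit_ge hI (h := (transfer ^ j) f) (fun x hx => hf.2.le_transfer_pow j hx)
        (M - 1 - j)
      refine le_trans ?_ h2
      have h3 := noReturn_antitone hI (show M - 1 - j ≤ M by omega)
      have h4 : mean f - 4 * mean f / 2 ^ j = (1 - 4 / 2 ^ j) * mean f := by ring
      rw [h4]
      calc _ = (1 - 4 / 2 ^ j) * mean f * noReturn hI M := by ring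
        _ ≤ _ := mul_le_mul_of_nonneg_left h3 (mul_nonneg hc hm)
    · exact (mul_nonpos_of_nonpos_of_nonneg hc.le h1).trans
        (((hf.1.transfer_pow j).cut hI).transfer.openOp_pow hI _).mean
  refine le_trans ?_ (Finset.sum_le_sum hterm)
  rw [← Finset.sum_mul, Finset.sum_sub_distrib, sum_range_const_div_two_pow, mul_assoc]
  refine mul_le_mul_of_nonneg_right ?_ (mul_nonneg (noReturn_nonneg hI M) hm)
  have : 0 ≤ 2 * 4 / (2 : ℝ) ^ M := by positivity
  simp
  linarith

/-- A last visit before time `M - 1` excludes in particular a return in the next step. The visit at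
time `M - 1` has no later step and costs up to `5` times the measure of the hole. -/
lemma lost_mass_le {f : BddMeas} (hf : f ∈ bvCone 4) {I : Set ℝ} (hI : MeasurableSet I) (M : ℕ) :
    mean f - mean ((openOp hI ^ M) f) ≤
      ((M + 8) * noReturn hI 1 + 5 * gaussMeasure.real I) * mean f := by
  have hm := hf.1.mean
  have h1 := noReturn_nonneg hI 1
  have hδ : 0 ≤ gaussMeasure.real I := measureReal_nonneg
  rw [mean_sub_mean_openOp_pow]
  have hterm : ∀ j ∈ Finset.range M,
      mean ((openOp hI ^ (M - 1 - j)) (transfer (cut hI ((transfer ^ j) f)))) ≤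
      (1 + 4 / 2 ^ j) * (noReturn hI 1 * mean f) +
        if j = M - 1 then 5 * gaussMeasure.real I * mean f else 0 := by
    intro j hj
    have hj' := Finset.mem_range.1 hj
    have h2 := mean_visit_le hI (h := (transfer ^ j) f) (fun x hx => hf.2.transfer_pow_le j hx)
        (M - 1 - j)
    have h4 : mean f + 4 * mean f / 2 ^ j = (1 + 4 / 2 ^ j) * mean f := by ring
    rw [h4] at h2
    refine h2.trans ?_
    have hc : 0 ≤ 4 / (2 : ℝ) ^ j := by positivity
    split_ifs with hjM
    · rw [show M - 1 - j = 0 by omega, noReturn_zero]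
      have hc5 : 4 / (2 : ℝ) ^ j ≤ 4 := div_le_self (by norm_num) (one_le_pow₀ one_le_two)
      have h5 : (1 + 4 / 2 ^ j) * mean f * gaussMeasure.real I ≤
          5 * mean f * gaussMeasure.real I := by gcongr; linarith
      have h6 : 0 ≤ (1 + 4 / 2 ^ j) * (noReturn hI 1 * mean f) := by positivity
      linarith
    · have h3 := noReturn_antitone hI (show 1 ≤ M - 1 - j by omega)
      rw [add_zero]
      calc _ ≤ (1 + 4 / 2 ^ j) * mean f * noReturn hI 1 :=
            mul_le_mul_of_nonneg_left h3 (by positivity)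
        _ = _ := by ring
  refine (Finset.sum_le_sum hterm).trans ?_
  rw [Finset.sum_add_distrib, ← Finset.sum_mul, Finset.sum_add_distrib,
    sum_range_const_div_two_pow, add_mul _ _ (mean f), mul_assoc _ (noReturn hI 1)]
  refine add_le_add (mul_le_mul_of_nonneg_right ?_ (mul_nonneg h1 hm)) ?_
  · have : 0 ≤ 2 * 4 / (2 : ℝ) ^ M := by positivity
    simp
    linarith
  · rw [Finset.sum_ite_eq']
    split_ifs
    · exact le_rfl
    · positivity

lemma HasGeometricDecay.tendsto_ratio {s : ℕ → ℝ} {lam : ℝ} (h : HasGeometricDecay s lam)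
    {M : ℕ} (hM : 0 < M) :
    Tendsto (fun j => s (M * j + M) / s (M * j)) atTop (𝓝 (lam ^ M)) := by
  obtain ⟨hl, C, hC, ht⟩ := h
  have h1 : Tendsto (fun j => M * j) atTop atTop := 
    tendsto_atTop_mono (fun j => Nat.le_mul_of_pos_left j hM) tendsto_id
  have h2 : Tendsto (fun j => M * j + M) atTop atTop := 
    tendsto_atTop_mono (fun j => Nat.le_add_right _ _) h1
  have h3 := ((ht.comp h2).div (ht.comp h1) hC.ne').mul_const (lam ^ M)
  rw [div_self hC.ne', one_mul] at h3
  refine h3.congr fun j => ?_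
  simp only [Function.comp, Pi.div_apply, pow_add]
  have := hl.ne'
  by_cases hs : s (M * j) = 0
  · simp [hs]
  · field_simp

lemma survival_antitone {I : Set ℝ} (hI : MeasurableSet I) : Antitone (survival I) :=
  antitone_nat_of_succ_le fun n => by
    rw [survival_eq_mean hI, survival_eq_mean hI, pow_succ', Module.End.mul_apply, mean_openOp]
    linarith [((lebDensity_mem_bvCone.1.openOp_pow hI n).cut hI).mean]

lemma HasGeometricDecay.le_one {s : ℕ → ℝ} {lam : ℝ} (h : HasGeometricDecay s lam)
    (h0 : ∀ n, 0 ≤ s n) (hs : Antitone s) : lam ≤ 1 := by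
  have := h.tendsto_ratio one_pos
  rw [pow_one] at this
  exact le_of_tendsto' this fun j => div_le_one_of_le₀ (hs (by omega)) (h0 _)

/-- Invariance of the cone is available only for blocks of `M` steps, so iterates are followed along
multiples of `M`. -/
lemma survival_pos_of_small {I : Set ℝ} (hI : MeasurableSet I) (hIo : I.OrdConnected) {M : ℕ}
    (hM : 8 ≤ M) (hδ : 25 * M * gaussMeasure.real I ≤ 1) (j : ℕ) :
    (openOp hI ^ (M * j)) lebDensity ∈ bvCone 4 ∧
      0 < mean ((openOp hI ^ (M * j)) lebDensity) := by
  induction j with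
  | zero =>
    refine ⟨bvCone_mono (by norm_num) lebDensity_mem_bvCone, ?_⟩
    simp [mean_lebDensity]
  | succ j ih =>
    rw [mul_add, mul_one, add_comm, pow_add, Module.End.mul_apply]
    refine ⟨bvCone_mono (by norm_num) (openOp_pow_mem_bvCone ih.1 hI hIo hM hδ), ?_⟩
    linarith [mean_openOp_pow_ge_of_mem_bvCone ih.1 hI hδ, ih.2]

theorem decay_bounds {I : Set ℝ} (hI : MeasurableSet I) (hIo : I.OrdConnected) {M : ℕ}
    (hM : 8 ≤ M) (hδ : 25 * M * gaussMeasure.real I ≤ 1) {lam : ℝ}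
    (h : HasGeometricDecay (survival I) lam) :
    (M - 8) * noReturn hI M ≤ 1 - lam ^ M ∧
      1 - lam ^ M ≤ (M + 8) * noReturn hI 1 + 5 * gaussMeasure.real I := by
  have ht := h.tendsto_ratio (show 0 < M by omega)
  have hb : ∀ j, 1 - ((M + 8) * noReturn hI 1 + 5 * gaussMeasure.real I) ≤
      survival I (M * j + M) / survival I (M * j) ∧
      survival I (M * j + M) / survival I (M * j) ≤ 1 - (M - 8) * noReturn hI M := by
    intro j
    obtain ⟨h1, h2⟩ := survival_pos_of_small hI hIo hM hδ j
    rw [survival_eq_mean hI, survival_eq_mean hI, add_comm (M * j), pow_add, Module.End.mul_apply,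
      le_div_iff₀ h2, div_le_iff₀ h2]
    have h3 := lost_mass_ge h1 hI M
    have h4 := lost_mass_le h1 hI M
    constructor <;> linarith
  have h1 := ge_of_tendsto' ht fun j => (hb j).1
  have h2 := le_of_tendsto' ht fun j => (hb j).2
  constructor <;> linarith

/-- Passage from bounds on `1 - lam ^ M` for large `M` to the asymptotics of `1 - lam`. -/
lemma tendsto_rate {ι : Type*} {l : Filter ι} {δ lam : ι → ℝ} {r : ℕ → ι → ℝ} {κ : ℝ}
    (hδ : ∀ᶠ i in l, 0 < δ i) (hδ0 : Tendsto δ l (𝓝 0)) (hlam : ∀ᶠ i in l, 0 < lam i ∧ lam i ≤ 1)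
    (hb : ∀ M : ℕ, 8 ≤ M → ∀ᶠ i in l, (M - 8) * r M i ≤ 1 - lam i ^ M ∧
      1 - lam i ^ M ≤ (M + 8) * r 1 i + 5 * δ i)
    (hr : ∀ M : ℕ, 1 ≤ M → Tendsto (fun i => r M i / δ i) l (𝓝 κ)) :
    Tendsto (fun i => (1 - lam i) / δ i) l (𝓝 κ) := by
  rw [tendsto_order]
  constructor
  · intro a ha
    have h1 : Tendsto (fun M : ℕ => (1 - 8 / (M : ℝ)) * κ) atTop (𝓝 ((1 - 0) * κ)) :=
      ((tendsto_const_div_atTop_nhds_zero_nat 8).const_sub 1).mul_const κ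
    rw [sub_zero, one_mul] at h1
    obtain ⟨M, hMa, hM⟩ := (((tendsto_order.1 h1).1 a ha).and (eventually_ge_atTop 8)).exists
    have hMp : (0 : ℝ) < M := by exact_mod_cast (show 0 < M by omega)
    have h2 := (hr M (by omega)).const_mul (1 - 8 / (M : ℝ))
    filter_upwards [(tendsto_order.1 h2).1 a hMa, hδ, hlam, hb M hM] with i h3 h4 h5 h6
    refine h3.trans_le ?_
    rw [← mul_div_assoc]
    gcongr
    -- Bernoulli's inequality gives `1 - lam ^ M ≤ M * (1 - lam)`.
    have h7 := one_add_mul_le_pow (show (-2 : ℝ) ≤ lam i - 1 by linarith [h5.1]) M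
    rw [add_sub_cancel] at h7
    have h8 : (M : ℝ) * ((1 - 8 / M) * r M i) = (M - 8) * r M i := by field_simp
    refine le_of_mul_le_mul_left ?_ hMp
    rw [h8]
    linarith [h6.1]
  · intro a ha
    have h1 : Tendsto (fun M : ℕ => (1 + 8 / (M : ℝ)) * κ + 5 / M) atTop (𝓝 ((1 + 0) * κ + 0)) :=
      (((tendsto_const_div_atTop_nhds_zero_nat 8).const_add 1).mul_const κ).add
        (tendsto_const_div_atTop_nhds_zero_nat 5)
    rw [add_zero, add_zero, one_mul] at h1
    obtain ⟨M, hMa, hM⟩ := (((tendsto_order.1 h1).2 a ha).and (eventually_ge_atTop 8)).exists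
    have hMp : (0 : ℝ) < M := by exact_mod_cast (show 0 < M by omega)
    have hr1 := hr 1 le_rfl
    -- the power `lam ^ M` tends to `1`
    have h2 : Tendsto (fun i => 1 - ((M + 8) * (r 1 i / δ i) + 5) * δ i) l
        (𝓝 (1 - ((M + 8) * κ + 5) * 0)) :=
      (((hr1.const_mul _).add_const 5).mul hδ0).const_sub 1
    rw [mul_zero, sub_zero] at h2
    have h3 := (((hr1.const_mul (1 + 8 / (M : ℝ))).add_const (5 / (M : ℝ))).div h2 one_ne_zero)
    rw [div_one] at h3
    filter_upwards [(tendsto_order.1 h3).2 a hMa, hδ, hlam, hb M hM,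
      (tendsto_order.1 h2).1 0 one_pos] with i h4 h5 h6 h7 h8
    refine lt_of_le_of_lt ?_ h4
    rw [Pi.div_apply, div_le_div_iff₀ h5 h8]
    have e1 : ((M + 8) * (r 1 i / δ i) + 5) * δ i = (M + 8) * r 1 i + 5 * δ i := by
      field_simp
    rw [e1] at h8 ⊢
    have e2 : ((1 + 8 / (M : ℝ)) * (r 1 i / δ i) + 5 / M) * δ i =
        ((M + 8) * r 1 i + 5 * δ i) / M := by field_simp
    rw [e2, le_div_iff₀ hMp]
    -- `M * lam ^ M * (1 - lam) ≤ 1 - lam ^ M`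
    have e3 : (1 - lam i) * (M * lam i ^ M) ≤ 1 - lam i ^ M := by
      have := geom_sum_mul_neg (lam i) M
      rw [← this, mul_comm]
      refine mul_le_mul_of_nonneg_right ?_ (by linarith [h6.2])
      calc (M : ℝ) * lam i ^ M = ∑ _j ∈ Finset.range M, lam i ^ M := by simp
        _ ≤ _ := Finset.sum_le_sum fun j hj =>
          pow_le_pow_of_le_one h6.1.le h6.2 (Finset.mem_range.1 hj).le
    have e4 : (1 - lam i) * (M * (1 - ((M + 8) * r 1 i + 5 * δ i))) ≤
        (1 - lam i) * (M * lam i ^ M) := by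
      refine mul_le_mul_of_nonneg_left ?_ (by linarith [h6.2])
      refine mul_le_mul_of_nonneg_left ?_ hMp.le
      linarith [h7.2]
    linarith [h7.2]

/-! ### Exact decay for short holes near the fixed point -/

/-- The analytic continuation of the rightmost branch of the Gauss map. -/
def rightBranch (y : ℝ) : ℝ := 1 / y - 1

lemma eq_zero_of_branch_mem {n : ℕ} {x : ℝ} (hx : 0 ≤ x) (h : branch n x ∈ Ioo (1 / 2 : ℝ) 1) :
    n = 0 := by
  cases n with
  | zero => rfl
  | succ n => exact absurd h.1 (not_lt.2 (branch_succ_le_half n hx))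

lemma rightBranch_branch_zero (x : ℝ) : rightBranch (branch 0 x) = x := by
  simp [rightBranch, branch]

/-- The hole `I` stays in the rightmost branch for `k` steps. -/
def StaysRight (I : Set ℝ) (k : ℕ) : Prop :=
  ∀ y ∈ I, ∀ i < k, rightBranch^[i] y ∈ Ioo (1 / 2 : ℝ) 1

lemma StaysRight.mono {I : Set ℝ} {k k' : ℕ} (h : StaysRight I k) (hk : k' ≤ k) :
    StaysRight I k' := fun y hy i hi => h y hy i (hi.trans_le hk)

/-- Away from the forward orbit of the hole, the open operator agrees with the closed one. -/
lemma openOp_pow_eq_of_forall_ne {I : Set ℝ} (hI : MeasurableSet I) (f : BddMeas) {k : ℕ}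
    (hk : StaysRight I k) {x : ℝ} (hx : x ∈ Icc (0 : ℝ) 1)
    (h : ∀ i, 1 ≤ i → i ≤ k → ∀ y ∈ I, rightBranch^[i] y ≠ x) :
    (openOp hI ^ k) f x = (transfer ^ k) f x := by
  induction k generalizing x with
  | zero => rfl
  | succ k ih =>
    rw [pow_succ', pow_succ', Module.End.mul_apply, Module.End.mul_apply, openOp_apply]
    refine (hasSum_transfer _ hx).unique ((hasSum_transfer _ hx).congr_fun fun n => ?_)
    have hb : branch n x ∉ I := by
      intro hb
      obtain rfl := eq_zero_of_branch_mem hx.1 (hk _ hb 0 (by omega))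
      exact h 1 le_rfl (by omega) _ hb (rightBranch_branch_zero x)
    rw [cut_apply_of_mem _ _ (mem_compl hb)]
    rw [ih (hk.mono (by omega)) (branch_mem_Icc n hx.1)]
    intro i h1 hik y hy hyb
    have h2 := hk y hy i (by omega)
    rw [hyb] at h2
    obtain rfl := eq_zero_of_branch_mem hx.1 h2
    refine h (i + 1) (by omega) (by omega) y hy ?_
    rw [Function.iterate_succ_apply', hyb, rightBranch_branch_zero]

/-- As long as the orbit of the hole stays in the right branch, the pushed indicator is supported on
the image of the hole under `rightBranch^[k]`. -/
lemma transfer_pow_ind_eq_zero {I : Set ℝ} (hI : MeasurableSet I) {k : ℕ}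
    (hk : StaysRight I k) {x : ℝ} (hx : x ∈ Icc (0 : ℝ) 1)
    (h : ∀ y ∈ I, rightBranch^[k] y ≠ x) : (transfer ^ k) (ind hI) x = 0 := by
  induction k generalizing x with
  | zero =>
    have hxI : x ∉ I := fun hxI => h x hxI rfl
    simp [ind_apply, hxI]
  | succ k ih =>
    rw [pow_succ', Module.End.mul_apply]
    refine (hasSum_transfer _ hx).unique (hasSum_zero.congr_fun fun n => ?_)
    rw [ih (hk.mono (by omega)) (branch_mem_Icc n hx.1), mul_zero]
    intro y hy hyb
    have h2 := hk y hy k (by omega)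
    rw [hyb] at h2
    obtain rfl := eq_zero_of_branch_mem hx.1 h2
    refine h y hy ?_
    rw [Function.iterate_succ_apply', hyb, rightBranch_branch_zero]

lemma weight_zero_le {x : ℝ} (hx : 0 ≤ x) : weight 0 x ≤ 1 / 2 := by
  unfold weight
  rw [div_le_div_iff₀ (by positivity) (by norm_num)]
  push_cast
  nlinarith

/-- Points of `[0,1/2]` are not on the orbit of the hole during the first seven steps, so there the
open iterate equals the closed one and is close to `mean f`. In the eighth step all branches except
the rightmost one lead into `[0,1/2]` and miss the hole; their total weight is at least `1 / 2`. -/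
lemma openOp_pow_eight_ge {I : Set ℝ} (hI : MeasurableSet I) (hr : StaysRight I 8)
    {f : BddMeas} (hf : f ∈ bvCone 4) {x : ℝ} (hx : x ∈ Icc (0 : ℝ) 1) :
    mean f / 4 ≤ (openOp hI ^ 8) f x := by
  have hm := hf.1.mean
  have hseven : ∀ y ∈ Icc (0 : ℝ) 1, y ≤ 1 / 2 → mean f / 2 ≤ (openOp hI ^ 7) f y := by
    intro y hy hy2
    rw [openOp_pow_eq_of_forall_ne hI f (hr.mono (by omega)) hy]
    · have := hf.2.le_transfer_pow 7 hy
      norm_num at this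
      linarith
    · intro i _ hi t ht hty
      have := (hr t ht i (by omega)).1
      rw [hty] at this
      linarith
  rw [show (8 : ℕ) = 7 + 1 from rfl, pow_succ', Module.End.mul_apply, openOp_apply]
  have h1 : HasSum (fun n => weight n x * (mean f / 2) -
      if n = 0 then weight 0 x * (mean f / 2) else 0)
      (1 * (mean f / 2) - weight 0 x * (mean f / 2)) :=
    ((hasSum_weight hx.1).mul_right _).sub (hasSum_ite_eq 0 _)
  have h2 := hasSum_le (fun n => ?_) h1
    (hasSum_transfer (cut hI.compl ((openOp hI ^ 7) f)) hx)
  · refine le_trans ?_ h2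
    have := mul_le_mul_of_nonneg_right (weight_zero_le hx.1) (show 0 ≤ mean f / 2 by linarith)
    linarith
  · split_ifs with hn
    · subst hn
      rw [sub_self]
      exact mul_nonneg (weight_nonneg 0 hx.1)
        (((hf.1.openOp_pow hI 7).cut hI.compl) _ (branch_mem_Icc 0 hx.1))
    · rw [sub_zero]
      refine mul_le_mul_of_nonneg_left ?_ (weight_nonneg n hx.1)
      have hb : branch n x ∉ I := fun hb =>
        hn (eq_zero_of_branch_mem hx.1 (hr _ hb 0 (by omega)))
      rw [cut_apply_of_mem _ _ (mem_compl hb)]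
      refine hseven _ (branch_mem_Icc n hx.1) ?_
      cases n with
      | zero => exact absurd rfl hn
      | succ n => exact branch_succ_le_half n hx.1

/-- Every exponent from `8` on splits into blocks of length between `8` and `16`, and `400 = 25 *
16` makes the hole small enough for each of them. -/
lemma openOp_pow_mem_bvCone_of_le {I : Set ℝ} (hI : MeasurableSet I) (hIo : I.OrdConnected)
    (hδ : 400 * gaussMeasure.real I ≤ 1) (i : ℕ) (hi : 8 ≤ i) {f : BddMeas}
    (hf : f ∈ bvCone 4) : (openOp hI ^ i) f ∈ bvCone 3 := by
  induction i using Nat.strong_induction_on generalizing f with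
  | _ i ih =>
    have h0 : 0 ≤ gaussMeasure.real I := measureReal_nonneg
    rcases le_or_gt i 16 with h | h
    · refine openOp_pow_mem_bvCone hf hI hIo hi ?_
      have h16 : (i : ℝ) ≤ 16 := by exact_mod_cast h
      nlinarith
    · obtain ⟨j, rfl⟩ : ∃ j, i = j + 8 := ⟨i - 8, by omega⟩
      rw [pow_add, Module.End.mul_apply]
      exact ih j (by omega) (by omega) (bvCone_mono (by norm_num)
        (openOp_pow_mem_bvCone hf hI hIo le_rfl (by push_cast; linarith)))

lemma bvCone_add {a : ℝ} {f g : BddMeas} (hf : f ∈ bvCone a) (hg : g ∈ bvCone a) :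
    f + g ∈ bvCone a := by
  refine ⟨fun x hx => add_nonneg (hf.1 x hx) (hg.1 x hx), ?_⟩
  rw [map_add, mul_add]
  exact hf.2.add hg.2

lemma bvCone_smul {a c : ℝ} (hc : 0 ≤ c) {f : BddMeas} (hf : f ∈ bvCone a) :
    c • f ∈ bvCone a := by
  refine ⟨fun x hx => mul_nonneg hc (hf.1 x hx), ?_⟩
  rw [map_smul, smul_eq_mul, mul_left_comm]
  exact hf.2.const_mul hc

/-- Small holes near the fixed point have exact exponential escape. -/
theorem exists_decay_of_staysRight {I : Set ℝ} (hI : MeasurableSet I) (hIo : I.OrdConnected)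
    (hδ : 400 * gaussMeasure.real I ≤ 1) (hr : StaysRight I 8) :
    ∃ lam, HasGeometricDecay (survival I) lam := by
  have hQ : ∀ i, 8 ≤ i → ∀ f ∈ bvCone 4, (openOp hI ^ i) f ∈ bvCone 4 := fun i hi f hf =>
    bvCone_mono (by norm_num) (openOp_pow_mem_bvCone_of_le hI hIo hδ i hi hf)
  have h0 : 0 ≤ gaussMeasure.real I := measureReal_nonneg
  have h8 : 25 * ((8 : ℕ) : ℝ) * gaussMeasure.real I ≤ 1 := by push_cast; linarith
  have hleb : lebDensity ∈ bvCone 4 := bvCone_mono (by norm_num) lebDensity_mem_bvCone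
  have := exists_hasGeometricDecay_of_cone (openOp hI) (bvCone 4) mean (BddMeas.const 1)
    lebDensity 8 20 (by norm_num) (by norm_num) (fun f hf g hg => bvCone_add hf hg)
    (fun a ha f hf => bvCone_smul ha hf) hQ (fun f hf => hf.1.mean) ?_
    (fun i hi => hQ i hi _ hleb) (by simp) ?_
  · obtain ⟨lam, h⟩ := this
    refine ⟨lam, ?_⟩
    have e : survival I = fun n => mean ((openOp hI ^ n) lebDensity) :=
      funext fun n => survival_eq_mean hI n
    rwa [e]
  · intro f hf
    have hm := hf.1.mean
    have hG := openOp_pow_mem_bvCone hf hI hIo le_rfl h8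
    have hG1 := mean_openOp_pow_ge_of_mem_bvCone hf hI h8
    have hG2 : mean ((openOp hI ^ 8) f) ≤ mean f := by
      rw [← mean_transfer_pow f 8]
      exact mean_mono fun x hx => openOp_pow_le hI hf.1 8 (Ioo_subset_Icc_self hx)
    -- The lower bound `mean f / 4` leaves room for `mean f / 5`, which is at most a quarter of the
    -- new mean; subtracting it turns variation constant `3` into at most `4`. Above, the iterate is
    -- at most `4 * mean f = 20 * (mean f / 5)`.
    refine ⟨mean f / 5, by positivity, ⟨fun x hx => ?_, ?_⟩, fun x hx => ?_, ?_⟩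
    · have := openOp_pow_eight_ge hI hr hf hx
      change 0 ≤ (openOp hI ^ 8) f x - mean f / 5 * 1
      linarith
    · have h1 := hG.2.add (hasVar_const (-(mean f / 5)))
      refine (h1.congr fun x _ => ?_).mono ?_
      · change (openOp hI ^ 8) f x - mean f / 5 * 1 = _
        ring
      · simp only [map_sub, map_smul, mean_const, smul_eq_mul]
        linarith
    · have := (abs_le.1 (hG.2.abs_sub_mean hx)).2
      change 0 ≤ 20 * (mean f / 5) * 1 - (openOp hI ^ 8) f x
      linarith
    · have h1 := hG.2.neg.add (hasVar_const (20 * (mean f / 5)))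
      refine (h1.congr fun x _ => ?_).mono ?_
      · change 20 * (mean f / 5) * 1 - (openOp hI ^ 8) f x = _
        ring
      · simp only [map_sub, map_smul, mean_const, smul_eq_mul]
        linarith
  · intro n
    rw [← survival_eq_mean hI]
    refine lt_of_lt_of_le ?_ (survival_antitone hI (show n ≤ 8 * n by omega))
    rw [survival_eq_mean hI]
    exact (survival_pos_of_small hI hIo le_rfl h8 n).2

/-! ### First returns of a hole in the right branch -/

/-- The measure of the set of points outside of the hole in the rightmost branch that are mapped
into the hole. -/
def overhang (I : Set ℝ) : ℝ :=
  gaussMeasure.real {x | x ∈ Ioo (1 / 2 : ℝ) 1 ∧ x ∉ I ∧ gaussMap x ∈ I}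

lemma measurableSet_preimage_gaussMap {I : Set ℝ} (hI : MeasurableSet I) :
    MeasurableSet (gaussMap ⁻¹' I) := measurable_gaussMap hI

lemma mean_cut_transfer {I : Set ℝ} (hI : MeasurableSet I) (h : BddMeas) :
    mean (cut hI (transfer h)) = mean (cut (measurableSet_preimage_gaussMap hI) h) := by
  classical
  have h1 := integral_transfer_mul h (ind hI)
  have e1 : mean (cut hI (transfer h)) = ∫ x, transfer h x * ind hI x ∂gaussMeasure := by
    refine integral_congr_ae (ae_of_all _ fun x => ?_)
    by_cases hx : x ∈ I <;> simp [cut_apply, ind_apply, hx]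
  have e2 : mean (cut (measurableSet_preimage_gaussMap hI) h) =
      ∫ x, h x * ind hI (gaussMap x) ∂gaussMeasure := by
    refine integral_congr_ae (ae_of_all _ fun x => ?_)
    by_cases hx : gaussMap x ∈ I <;> simp [cut_apply, ind_apply, hx]
  rw [e1, e2, h1]

lemma noReturn_one {I : Set ℝ} (hI : MeasurableSet I) :
    noReturn hI 1 = gaussMeasure.real I - gaussMeasure.real (gaussMap ⁻¹' I ∩ I) := by
  have h1 : cut (measurableSet_preimage_gaussMap hI) (ind hI) = ind ((measurableSet_preimage_gaussMap hI).inter hI) := by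
    ext x
    change (gaussMap ⁻¹' I).indicator (I.indicator fun _ => 1) x = _
    rw [indicator_indicator]
    rfl
  rw [show (1 : ℕ) = 0 + 1 from rfl, noReturn_succ, noReturn_zero, pow_zero,
    Module.End.one_apply, mean_cut_transfer, h1, mean_ind]

lemma transfer_pow_ind_le_one {I : Set ℝ} (hI : MeasurableSet I) (n : ℕ) {x : ℝ}
    (hx : x ∈ Icc (0 : ℝ) 1) : (transfer ^ n) (ind hI) x ≤ 1 := by
  induction n generalizing x with
  | zero =>
    rw [pow_zero, Module.End.one_apply, ind_apply]
    exact indicator_le_self' (fun _ _ => zero_le_one) x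
  | succ n ih =>
    rw [pow_succ', Module.End.mul_apply, ← transfer_const 1 hx]
    exact transfer_mono (fun y hy => ih hy) hx

/-- A first return after `i + 2` steps passes just before through a point outside the hole that is
mapped into it. This point lies in the right branch, hence in the set measured by `overhang`, and
the pushed indicator is at most `1` there. -/
lemma mean_cut_openOp_le {I : Set ℝ} (hI : MeasurableSet I) {i : ℕ} (hr : StaysRight I (i + 2)) :
    mean (cut hI ((openOp hI ^ (i + 1)) (transfer (ind hI)))) ≤ overhang I := by
  have hW : MeasurableSet {x | x ∈ Ioo (1 / 2 : ℝ) 1 ∧ x ∉ I ∧ gaussMap x ∈ I} :=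
    measurableSet_Ioo.inter (hI.compl.inter (measurableSet_preimage_gaussMap hI))
  rw [pow_succ', Module.End.mul_apply, openOp_apply, mean_cut_transfer, overhang, ← mean_ind hW]
  refine mean_mono fun x hx => ?_
  have hx' := Ioo_subset_Icc_self hx
  have hle : (openOp hI ^ i) (transfer (ind hI)) x ≤ (transfer ^ (i + 1)) (ind hI) x := by
    rw [pow_succ (transfer), Module.End.mul_apply]
    exact openOp_pow_le hI (nonnegOn_ind hI).transfer i hx'
  have hpos : 0 ≤ ind hW x := nonnegOn_ind hW x hx'
  by_cases h1 : x ∈ gaussMap ⁻¹' I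
  swap
  · rw [cut_apply_of_notMem _ _ h1]; exact hpos
  rw [cut_apply_of_mem _ _ h1]
  by_cases h2 : x ∈ I
  · rw [cut_apply_of_notMem _ _ (notMem_compl_iff.2 h2)]; exact hpos
  rw [cut_apply_of_mem _ _ (mem_compl h2)]
  by_cases h3 : ∃ y ∈ I, rightBranch^[i + 1] y = x
  · obtain ⟨y, hy, hyx⟩ := h3
    have hxW : x ∈ {x | x ∈ Ioo (1 / 2 : ℝ) 1 ∧ x ∉ I ∧ gaussMap x ∈ I} :=
      ⟨hyx ▸ hr y hy (i + 1) (by omega), h2, h1⟩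
    rw [ind_apply, indicator_of_mem hxW]
    exact hle.trans (transfer_pow_ind_le_one hI _ hx')
  · push Not at h3
    exact (hle.trans_eq (transfer_pow_ind_eq_zero hI (hr.mono (by omega)) hx' h3)).trans hpos

/-- Thus immediate returns alone matter in the limit when `overhang I` is small compared with the
hole. -/
lemma noReturn_ge {I : Set ℝ} (hI : MeasurableSet I) (r : ℕ) (hr : StaysRight I (r + 1)) :
    noReturn hI 1 - r * overhang I ≤ noReturn hI (r + 1) := by
  induction r with
  | zero => simp
  | succ r ih =>
    rw [noReturn_succ hI (r + 1)]
    have h1 := ih (hr.mono (by omega))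
    have h2 := mean_cut_openOp_le hI hr
    push_cast
    linarith

/-! ### Asymptotics of holes shrinking to the fixed point -/

lemma z_sq : z ^ 2 = 1 - z := by
  have := Real.sq_sqrt (show (0 : ℝ) ≤ 5 by norm_num)
  unfold z
  nlinarith

lemma half_lt_z : 1 / 2 < z := by
  have : (2 : ℝ) < √5 := Real.lt_sqrt_of_sq_lt (by norm_num)
  unfold z
  linarith

lemma z_lt_one : z < 1 := by
  have : √5 < 3 := by rw [Real.sqrt_lt' (by norm_num)]; norm_num
  unfold z
  linarith

lemma z_pos : 0 < z := by linarith [half_lt_z]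

lemma rightInverseBranch_z : rightInverseBranch z = z := by
  have h := z_pos
  unfold rightInverseBranch
  rw [div_eq_iff (by positivity)]
  linarith [z_sq]

lemma rightBranch_z : rightBranch z = z := by
  have h := z_pos
  unfold rightBranch
  rw [sub_eq_iff_eq_add, div_eq_iff h.ne']
  linarith [z_sq]

lemma eventually_rightBranch_iterate (k : ℕ) :
    ∀ᶠ y in 𝓝 z, ∀ i < k, rightBranch^[i] y ∈ Ioo (1 / 2 : ℝ) 1 := by
  have hc : ContinuousAt rightBranch z := by
    unfold rightBranch
    exact (continuousAt_const.div continuousAt_id z_pos.ne').sub continuousAt_const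
  have hi : ∀ i : ℕ, Tendsto (rightBranch^[i]) (𝓝 z) (𝓝 z) := by
    intro i
    have h1 : Tendsto rightBranch (𝓝 z) (𝓝 z) := by
      simpa [ContinuousAt, rightBranch_z] using hc
    induction i with
    | zero => exact tendsto_id
    | succ i ih => rw [Function.iterate_succ]; exact ih.comp h1
  have h2 : ∀ i ∈ Finset.range k, ∀ᶠ y in 𝓝 z, rightBranch^[i] y ∈ Ioo (1 / 2 : ℝ) 1 :=
    fun i _ => (hi i) (Ioo_mem_nhds half_lt_z z_lt_one)
  filter_upwards [(Filter.eventually_all_finset _).2 h2] with y hy i hik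
  exact hy i (Finset.mem_range.2 hik)

lemma gaussMeasure_real_Icc {a b : ℝ} (ha : 0 ≤ a) (hab : a ≤ b) (hb : b ≤ 1) :
    gaussMeasure.real (Icc a b) = (Real.log (1 + b) - Real.log (1 + a)) / Real.log 2 := by
  have h : gaussMeasure (Icc a b) = gaussMeasure (Ioo a b) :=
    measure_congr (gaussMeasure_absolutelyContinuous.ae_eq Ioo_ae_eq_Icc.symm)
  rw [Measure.real, h, gaussMeasure_Ioo ha hab hb, ENNReal.toReal_ofReal]
  exact div_nonneg (sub_nonneg.2 (Real.log_le_log (by linarith) (by linarith))) log_two_pos.le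

lemma gaussMeasure_real_Icc_le {a b : ℝ} (ha : 0 ≤ a) (hab : a ≤ b) (hb : b ≤ 1) :
    gaussMeasure.real (Icc a b) ≤ (b - a) / (Real.log 2 * (1 + a)) := by
  have h1 : 0 < 1 + a := by linarith
  have h2 : 0 < 1 + b := by linarith
  rw [gaussMeasure_real_Icc ha hab hb, mul_comm, ← div_div, ← Real.log_div h2.ne' h1.ne']
  refine div_le_div_of_nonneg_right ?_ log_two_pos.le
  refine (Real.log_le_sub_one_of_pos (by positivity)).trans (le_of_eq ?_)
  field_simp
  ring

lemma le_gaussMeasure_real_Icc {a b : ℝ} (ha : 0 ≤ a) (hab : a ≤ b) (hb : b ≤ 1) :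
    (b - a) / (Real.log 2 * (1 + b)) ≤ gaussMeasure.real (Icc a b) := by
  have h1 : 0 < 1 + a := by linarith
  have h2 : 0 < 1 + b := by linarith
  rw [gaussMeasure_real_Icc ha hab hb, mul_comm, ← div_div, ← Real.log_div h2.ne' h1.ne']
  refine div_le_div_of_nonneg_right ?_ log_two_pos.le
  have h3 := Real.log_le_sub_one_of_pos (show 0 < (1 + a) / (1 + b) by positivity)
  have h5 : Real.log ((1 + b) / (1 + a)) = -Real.log ((1 + a) / (1 + b)) := by
    rw [← inv_div, Real.log_inv]
  have h4 : (b - a) / (1 + b) = -((1 + a) / (1 + b) - 1) := by field_simp; ring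
  linarith

lemma tendsto_gaussMeasure_Icc_div {ι : Type*} {l : Filter ι} {a b : ι → ℝ} {c : ℝ}
    (hc0 : 0 ≤ c) (hab : ∀ᶠ i in l, 0 ≤ a i ∧ a i < b i ∧ b i ≤ 1) (ha : Tendsto a l (𝓝 c))
    (hb : Tendsto b l (𝓝 c)) :
    Tendsto (fun i => gaussMeasure.real (Icc (a i) (b i)) / (b i - a i)) l
      (𝓝 (1 / (Real.log 2 * (1 + c)))) := by
  have hl := log_two_pos
  have h0 : Real.log 2 * (1 + c) ≠ 0 := by positivity
  have h1 : Tendsto (fun i => 1 / (Real.log 2 * (1 + b i))) l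
      (𝓝 (1 / (Real.log 2 * (1 + c)))) :=
    tendsto_const_nhds.div ((hb.const_add 1).const_mul _) h0
  have h2 : Tendsto (fun i => 1 / (Real.log 2 * (1 + a i))) l
      (𝓝 (1 / (Real.log 2 * (1 + c)))) :=
    tendsto_const_nhds.div ((ha.const_add 1).const_mul _) h0
  refine tendsto_of_tendsto_of_tendsto_of_le_of_le' h1 h2 ?_ ?_
  · filter_upwards [hab] with i hi
    rw [le_div_iff₀ (by linarith [hi.2.1]), one_div_mul_eq_div]
    exact le_gaussMeasure_real_Icc hi.1 hi.2.1.le hi.2.2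
  · filter_upwards [hab] with i hi
    rw [div_le_iff₀ (by linarith [hi.2.1]), one_div_mul_eq_div]
    exact gaussMeasure_real_Icc_le hi.1 hi.2.1.le hi.2.2

lemma gaussMap_eq_rightBranch {x : ℝ} (hx : x ∈ Ioo (1 / 2 : ℝ) 1) :
    gaussMap x = rightBranch x := by
  have h0 : 0 < x := by linarith [hx.1]
  have h1 : 1 < 1 / x := by rw [lt_div_iff₀ h0]; linarith [hx.2]
  have h2 : 1 / x < 2 := by rw [div_lt_iff₀ h0]; linarith [hx.1]
  rw [gaussMap, rightBranch, Int.fract, Int.floor_eq_iff (z := 1) |>.2]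
  · simp
  · push_cast
    constructor <;> linarith

lemma rightBranch_mem_Icc_iff {x α β : ℝ} (hx : 0 < x) (hα : 0 ≤ α) (hβ : 0 ≤ β) :
    rightBranch x ∈ Icc α β ↔ x ∈ Icc (rightInverseBranch β) (rightInverseBranch α) := by
  unfold rightBranch rightInverseBranch
  rw [mem_Icc, mem_Icc, and_comm, div_le_iff₀ (by positivity), le_div_iff₀ (by positivity),
    sub_le_iff_le_add, le_sub_iff_add_le, div_le_iff₀ hx, le_div_iff₀ hx]
  constructor <;> rintro ⟨h1, h2⟩ <;> constructor <;> linarith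

lemma gaussMap_mem_iff {α β : ℝ} (hα : 1 / 2 < α) (hαβ : α ≤ β) (hβ : β < 1) {x : ℝ}
    (hx : x ∈ Ioo (1 / 2 : ℝ) 1) :
    gaussMap x ∈ Icc α β ↔ x ∈ Icc (rightInverseBranch β) (rightInverseBranch α) := by
  rw [gaussMap_eq_rightBranch hx, rightBranch_mem_Icc_iff] <;> linarith [hx.1]

lemma rightInverseBranch_mem {y : ℝ} (hy : y ∈ Ioo (0 : ℝ) 1) :
    rightInverseBranch y ∈ Ioo (1 / 2 : ℝ) 1 := by
  have h := hy.1
  unfold rightInverseBranch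
  refine ⟨?_, ?_⟩
  · rw [div_lt_div_iff₀ (by norm_num) (by linarith)]; linarith [hy.2]
  · rw [div_lt_one (by linarith)]; linarith

/-- In the right branch the preimage of the hole is an interval, which splits into its parts inside
and outside the hole. -/
lemma measure_inter_add_overhang {α β : ℝ} (hα : 1 / 2 < α) (hαβ : α ≤ β) (hβ : β < 1) :
    gaussMeasure.real (gaussMap ⁻¹' Icc α β ∩ Icc α β) + overhang (Icc α β) =
      gaussMeasure.real (Icc (rightInverseBranch β) (rightInverseBranch α)) := by
  have hW : MeasurableSet {x | x ∈ Ioo (1 / 2 : ℝ) 1 ∧ x ∉ Icc α β ∧ gaussMap x ∈ Icc α β} :=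
    measurableSet_Ioo.inter (measurableSet_Icc.compl.inter (measurable_gaussMap measurableSet_Icc))
  rw [overhang, ← measureReal_union _ hW]
  · congr 1
    ext x
    have h1 := (rightInverseBranch_mem (y := α) ⟨by linarith, by linarith⟩)
    have h2 := (rightInverseBranch_mem (y := β) ⟨by linarith, by linarith⟩)
    constructor
    · rintro (⟨h3, h4⟩ | ⟨h3, _, h4⟩)
      · exact (gaussMap_mem_iff hα hαβ hβ ⟨by linarith [h4.1], by linarith [h4.2]⟩).1 h3
      · exact (gaussMap_mem_iff hα hαβ hβ h3).1 h4
    · intro h3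
      have h4 : x ∈ Ioo (1 / 2 : ℝ) 1 := ⟨by linarith [h2.1, h3.1], by linarith [h1.2, h3.2]⟩
      have h5 := (gaussMap_mem_iff hα hαβ hβ h4).2 h3
      by_cases h6 : x ∈ Icc α β
      · exact Or.inl ⟨h5, h6⟩
      · exact Or.inr ⟨h4, h6, h5⟩
  · rw [disjoint_left]
    rintro x ⟨_, h1⟩ ⟨_, h2, _⟩
    exact h2 h1

/-- The preimage interval sticks out of the hole by at most `t` on either side, and the Gauss
density is at most `1 / log 2`. -/
lemma overhang_le {α β t : ℝ} (hα : 1 / 2 < α - t) (hαβ : α ≤ β) (hβ : β + t < 1) (ht : 0 ≤ t)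
    (h1 : rightInverseBranch α ≤ β + t) (h2 : α - t ≤ rightInverseBranch β) :
    overhang (Icc α β) ≤ 2 / Real.log 2 * t := by
  have hl := log_two_pos
  have hsub : {x | x ∈ Ioo (1 / 2 : ℝ) 1 ∧ x ∉ Icc α β ∧ gaussMap x ∈ Icc α β} ⊆
      Icc (α - t) α ∪ Icc β (β + t) := by
    rintro x ⟨hx, hxI, hTx⟩
    have h3 := (gaussMap_mem_iff (by linarith) hαβ (by linarith) hx).1 hTx
    rcases le_or_gt x α with h | h
    · exact Or.inl ⟨h2.trans h3.1, h⟩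
    · refine Or.inr ⟨?_, h3.2.trans h1⟩
      by_contra hxβ
      exact hxI ⟨h.le, (not_le.1 hxβ).le⟩
  have hb : ∀ a b : ℝ, 0 ≤ a → a ≤ b → b ≤ 1 → b - a = t →
      gaussMeasure.real (Icc a b) ≤ 1 / Real.log 2 * t := by
    intro a b ha hab hb hba
    refine (gaussMeasure_real_Icc_le ha hab hb).trans ?_
    rw [hba, one_div_mul_eq_div]
    refine div_le_div_of_nonneg_left ht hl ?_
    nlinarith
  calc overhang (Icc α β) ≤ gaussMeasure.real (Icc (α - t) α ∪ Icc β (β + t)) :=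
        measureReal_mono hsub
    _ ≤ gaussMeasure.real (Icc (α - t) α) + gaussMeasure.real (Icc β (β + t)) :=
        measureReal_union_le _ _
    _ ≤ 1 / Real.log 2 * t + 1 / Real.log 2 * t := by
        refine add_le_add (hb _ _ ?_ ?_ ?_ ?_) (hb _ _ ?_ ?_ ?_ ?_) <;> linarith
    _ = _ := by ring

section NearFixedPoint

variable {ι : Type*} {l : Filter ι} {α β : ι → ℝ}

lemma eventually_staysRight (hα : Tendsto α l (𝓝 z)) (hβ : Tendsto β l (𝓝 z)) (k : ℕ) :
    ∀ᶠ i in l, StaysRight (Icc (α i) (β i)) k :=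
  (hα.Icc hβ).eventually (eventually_smallSets_forall.2 (eventually_rightBranch_iterate k))

lemma eventually_half_lt (hα : Tendsto α l (𝓝 z)) (hβ : Tendsto β l (𝓝 z)) :
    ∀ᶠ i in l, 1 / 2 < α i ∧ β i < 1 :=
  ((tendsto_order.1 hα).1 _ half_lt_z).and ((tendsto_order.1 hβ).2 _ z_lt_one)

lemma tendsto_hole_div (hα : Tendsto α l (𝓝 z)) (hβ : Tendsto β l (𝓝 z))
    (hlt : ∀ᶠ i in l, α i < β i) :
    Tendsto (fun i => gaussMeasure.real (Icc (α i) (β i)) / (β i - α i)) l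
      (𝓝 (1 / (Real.log 2 * (1 + z)))) := by
  refine tendsto_gaussMeasure_Icc_div z_pos.le ?_ hα hβ
  filter_upwards [hlt, eventually_half_lt hα hβ] with i h1 h2
  exact ⟨by linarith [h2.1], h1, h2.2.le⟩

lemma tendsto_hole (hα : Tendsto α l (𝓝 z)) (hβ : Tendsto β l (𝓝 z))
    (hlt : ∀ᶠ i in l, α i < β i) :
    Tendsto (fun i => gaussMeasure.real (Icc (α i) (β i))) l (𝓝 0) := by
  have h := (tendsto_hole_div hα hβ hlt).mul (hβ.sub hα)
  rw [sub_self, mul_zero] at h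
  refine h.congr' ?_
  filter_upwards [hlt] with i hi
  rw [div_mul_cancel₀]
  linarith

theorem eventually_exists_decay (hα : Tendsto α l (𝓝 z)) (hβ : Tendsto β l (𝓝 z))
    (hlt : ∀ᶠ i in l, α i < β i) :
    ∀ᶠ i in l, ∃ lam, HasGeometricDecay (survival (Icc (α i) (β i))) lam := by
  filter_upwards [eventually_staysRight hα hβ 8,
    (tendsto_order.1 (tendsto_hole hα hβ hlt)).2 (1 / 400) (by norm_num)] with i h1 h2
  exact exists_decay_of_staysRight measurableSet_Icc ordConnected_Icc (by linarith) h1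

lemma tendsto_overhang_div (hα : Tendsto α l (𝓝 z)) (hβ : Tendsto β l (𝓝 z))
    (hlt : ∀ᶠ i in l, α i < β i)
    (H : ∀ η : ℝ, 0 < η → ∀ᶠ i in l, rightInverseBranch (α i) ≤ β i + η * (β i - α i) ∧
      α i - η * (β i - α i) ≤ rightInverseBranch (β i)) :
    Tendsto (fun i => overhang (Icc (α i) (β i)) / (β i - α i)) l (𝓝 0) := by
  have hl := log_two_pos
  rw [tendsto_order]
  constructor
  · intro a ha
    filter_upwards [hlt] with i hi
    exact ha.trans_le (div_nonneg measureReal_nonneg (by linarith))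
  · intro a ha
    have hη : 0 < a * Real.log 2 / 4 := by positivity
    have h0 : Tendsto (fun i => a * Real.log 2 / 4 * (β i - α i)) l (𝓝 0) := by
      have := (hβ.sub hα).const_mul (a * Real.log 2 / 4)
      rwa [sub_self, mul_zero] at this
    have h1 := hα.sub h0
    have h2 := hβ.add h0
    rw [sub_zero] at h1
    rw [add_zero] at h2
    filter_upwards [hlt, H _ hη, (tendsto_order.1 h1).1 _ half_lt_z,
      (tendsto_order.1 h2).2 _ z_lt_one] with i h3 h4 h5 h6
    have h7 : 0 < β i - α i := by linarith
    rw [div_lt_iff₀ h7]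
    refine (overhang_le h5 h3.le h6 (by positivity) h4.1 h4.2).trans_lt ?_
    have : 2 / Real.log 2 * (a * Real.log 2 / 4 * (β i - α i)) = a * (β i - α i) / 2 := by
      field_simp; norm_num
    rw [this]
    have := mul_pos ha h7
    linarith

lemma tendsto_rightInverseBranch (hα : Tendsto α l (𝓝 z)) :
    Tendsto (fun i => rightInverseBranch (α i)) l (𝓝 z) := by
  have h := z_pos
  have h0 : 1 + z ≠ 0 := by positivity
  have h1 := (tendsto_const_nhds (x := (1 : ℝ))).div (hα.const_add 1) h0
  have h2 : 1 / (1 + z) = z := rightInverseBranch_z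
  rw [h2] at h1
  exact h1

/-- The inverse branch shortens `[α, β]` by the factor `1 / ((1 + α) * (1 + β))`, which tends to `z
^ 2`. -/
lemma tendsto_preimage_div (hα : Tendsto α l (𝓝 z)) (hβ : Tendsto β l (𝓝 z))
    (hlt : ∀ᶠ i in l, α i < β i) :
    Tendsto (fun i => gaussMeasure.real
      (Icc (rightInverseBranch (β i)) (rightInverseBranch (α i))) / (β i - α i)) l
      (𝓝 (z ^ 2 * (1 / (Real.log 2 * (1 + z))))) := by
  have hz := z_pos
  have hev := eventually_half_lt hα hβ
  have e : ∀ a b : ℝ, 1 / 2 < a → a < b → rightInverseBranch a - rightInverseBranch b =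
      (b - a) * (1 / ((1 + a) * (1 + b))) := by
    intro a b ha hab
    have h1 : 1 + a ≠ 0 := by linarith
    have h2 : 1 + b ≠ 0 := by linarith
    unfold rightInverseBranch
    field_simp
    ring
  have hlt' : ∀ᶠ i in l, rightInverseBranch (β i) < rightInverseBranch (α i) := by
    filter_upwards [hlt, hev] with i h1 h2
    rw [← sub_pos, e _ _ h2.1 h1]
    have : 0 < 1 + α i := by linarith
    have : 0 < 1 + β i := by linarith
    have : 0 < β i - α i := by linarith
    positivity
  have h1 := tendsto_hole_div (tendsto_rightInverseBranch hβ) (tendsto_rightInverseBranch hα) hlt'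
  have h0 : (1 + z) * (1 + z) ≠ 0 := by positivity
  have h2 : Tendsto (fun i => 1 / ((1 + α i) * (1 + β i))) l (𝓝 (1 / ((1 + z) * (1 + z)))) :=
    tendsto_const_nhds.div ((hα.const_add 1).mul (hβ.const_add 1)) h0
  have e2 : 1 / ((1 + z) * (1 + z)) = z ^ 2 := by
    have h3 : 1 / (1 + z) = z := rightInverseBranch_z
    rw [← div_div, h3, div_eq_mul_one_div, h3, sq]
  rw [e2] at h2
  refine (h2.mul h1).congr' ?_
  filter_upwards [hlt, hev] with i h3 h4
  rw [e _ _ h4.1 h3]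
  have : 1 + α i ≠ 0 := by linarith
  have : 1 + β i ≠ 0 := by linarith
  have : β i - α i ≠ 0 := by linarith
  field_simp

/-- Condition `H` makes the overhang negligible, so the proportion of the hole without return within
any fixed number of steps tends to `1 - z ^ 2`. Multiplication by the Gauss density at `z` passes
from Gauss measure to length. -/
theorem tendsto_rate_near_fixedPoint (hα : Tendsto α l (𝓝 z)) (hβ : Tendsto β l (𝓝 z))
    (hlt : ∀ᶠ i in l, α i < β i)
    (H : ∀ η : ℝ, 0 < η → ∀ᶠ i in l, rightInverseBranch (α i) ≤ β i + η * (β i - α i) ∧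
      α i - η * (β i - α i) ≤ rightInverseBranch (β i))
    {lam : ι → ℝ} (hlam : ∀ᶠ i in l, HasGeometricDecay (survival (Icc (α i) (β i))) (lam i)) :
    Tendsto (fun i => (1 - lam i) / (β i - α i)) l (𝓝 (z ^ 2 / Real.log 2)) := by
  have hz := z_pos
  have hl := log_two_pos
  set d : ℝ := 1 / (Real.log 2 * (1 + z)) with hd
  have hd0 : 0 < d := by positivity
  set δ : ι → ℝ := fun i => gaussMeasure.real (Icc (α i) (β i)) with hδ
  have hδε := tendsto_hole_div hα hβ hlt
  have hov := tendsto_overhang_div hα hβ hlt H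
  have hev := eventually_half_lt hα hβ
  set r : ℕ → ι → ℝ := fun M i => noReturn (measurableSet_Icc (a := α i) (b := β i)) M with hr
  have hr1 : Tendsto (fun i => r 1 i / (β i - α i)) l (𝓝 (d - z ^ 2 * d)) := by
    have h1 := (hδε.sub (tendsto_preimage_div hα hβ hlt)).add hov
    rw [add_zero] at h1
    refine h1.congr' ?_
    filter_upwards [hlt, hev] with i h2 h3
    simp only [hr]
    rw [noReturn_one, ← measure_inter_add_overhang h3.1 h2.le h3.2]
    ring
  have hrM : ∀ M : ℕ, 1 ≤ M → Tendsto (fun i => r M i / (β i - α i)) l (𝓝 (d - z ^ 2 * d)) := by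
    intro M hM
    obtain ⟨M, rfl⟩ : ∃ k, M = k + 1 := ⟨M - 1, by omega⟩
    have h1 := hr1.sub (hov.const_mul (M : ℝ))
    rw [mul_zero, sub_zero] at h1
    refine tendsto_of_tendsto_of_tendsto_of_le_of_le' h1 hr1 ?_ ?_
    · filter_upwards [hlt, eventually_staysRight hα hβ (M + 1)] with i h2 h3
      rw [← mul_div_assoc, ← sub_div]
      exact div_le_div_of_nonneg_right (noReturn_ge _ M h3) (by linarith)
    · filter_upwards [hlt] with i h2
      exact div_le_div_of_nonneg_right (noReturn_antitone _ (by omega)) (by linarith)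
  have hδpos : ∀ᶠ i in l, 0 < δ i := by
    filter_upwards [hlt, hev] with i h2 h3
    refine lt_of_lt_of_le ?_ (le_gaussMeasure_real_Icc (by linarith) h2.le h3.2.le)
    have : 0 < β i - α i := by linarith
    have : 0 < 1 + β i := by linarith
    positivity
  have hδ0 := tendsto_hole hα hβ hlt
  have hmain : Tendsto (fun i => (1 - lam i) / δ i) l (𝓝 (1 - z ^ 2)) := by
    refine tendsto_rate hδpos hδ0 ?_ ?_ (r := r) ?_
    · filter_upwards [hlam] with i hi
      exact ⟨hi.1, hi.le_one (fun n => measureReal_nonneg) (survival_antitone measurableSet_Icc)⟩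
    · intro M hM
      have hMp : (0 : ℝ) < M := by exact_mod_cast (show 0 < M by omega)
      filter_upwards [hlam, (tendsto_order.1 hδ0).2 (1 / (25 * M)) (by positivity)] with i h1 h2
      refine decay_bounds measurableSet_Icc ordConnected_Icc hM ?_ h1
      rw [lt_div_iff₀ (by positivity)] at h2
      linarith
    · intro M hM
      have h1 := (hrM M hM).div hδε hd0.ne'
      have e : (d - z ^ 2 * d) / d = 1 - z ^ 2 := by field_simp
      rw [e] at h1
      refine h1.congr' ?_
      filter_upwards [hlt] with i h2
      have : β i - α i ≠ 0 := by linarith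
      simp only [Pi.div_apply]
      rw [div_div_div_cancel_right₀ this]
  have h1 := hmain.mul hδε
  have e : (1 - z ^ 2) * (1 / (Real.log 2 * (1 + z))) = z ^ 2 / Real.log 2 := by
    rw [z_sq]
    field_simp
    linarith [z_sq]
  rw [e] at h1
  refine h1.congr' ?_
  filter_upwards [hlt, hδpos] with i h2 h3
  have : β i - α i ≠ 0 := by linarith
  rw [div_mul_div_cancel₀ h3.ne']

end NearFixedPoint

/-! ### Cones of log-Lipschitz functions -/

/-- A cone of nonnegative functions whose logarithm is Lipschitz with constant `a` with respect to
`log (1 + x)`. -/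
def distCone (a : ℕ) : Set BddMeas :=
  {f | (∀ x ∈ Ioo (0 : ℝ) 1, 0 ≤ f x) ∧ ∀ x ∈ Ioo (0 : ℝ) 1, ∀ y ∈ Ioo (0 : ℝ) 1, x ≤ y →
    f x * (1 + x) ^ a ≤ f y * (1 + y) ^ a ∧ f y * (1 + x) ^ a ≤ f x * (1 + y) ^ a}

lemma distCone_add {a : ℕ} {f g : BddMeas} (hf : f ∈ distCone a) (hg : g ∈ distCone a) :
    f + g ∈ distCone a := by
  refine ⟨fun x hx => add_nonneg (hf.1 x hx) (hg.1 x hx), fun x hx y hy hxy => ?_⟩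
  obtain ⟨h1, h2⟩ := hf.2 x hx y hy hxy
  obtain ⟨h3, h4⟩ := hg.2 x hx y hy hxy
  change (f x + g x) * _ ≤ (f y + g y) * _ ∧ (f y + g y) * _ ≤ (f x + g x) * _
  constructor <;> linarith

lemma distCone_smul {a : ℕ} {c : ℝ} (hc : 0 ≤ c) {f : BddMeas} (hf : f ∈ distCone a) :
    c • f ∈ distCone a := by
  refine ⟨fun x hx => mul_nonneg hc (hf.1 x hx), fun x hx y hy hxy => ?_⟩
  obtain ⟨h1, h2⟩ := hf.2 x hx y hy hxy
  change (c * f x) * _ ≤ (c * f y) * _ ∧ (c * f y) * _ ≤ (c * f x) * _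
  rw [mul_assoc, mul_assoc, mul_assoc, mul_assoc]
  exact ⟨mul_le_mul_of_nonneg_left h1 hc, mul_le_mul_of_nonneg_left h2 hc⟩

lemma zero_mem_distCone (a : ℕ) : (0 : BddMeas) ∈ distCone a :=
  ⟨fun _ _ => le_rfl, fun _ _ _ _ _ => by
    change (0 : ℝ) * _ ≤ 0 * _ ∧ (0 : ℝ) * _ ≤ 0 * _
    simp⟩

lemma distCone_sum {ι : Type*} {a : ℕ} (s : Finset ι) {f : ι → BddMeas}
    (hf : ∀ i ∈ s, f i ∈ distCone a) : ∑ i ∈ s, f i ∈ distCone a :=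
  Finset.sum_induction f (· ∈ distCone a) (fun _ _ => distCone_add) (zero_mem_distCone a) hf

lemma lebDensity_mem_distCone : lebDensity ∈ distCone 4 := by
  have hl := log_two_pos
  refine ⟨fun x hx => ?_, fun x hx y hy hxy => ?_⟩
  · rw [lebDensity_apply (Ioo_subset_Icc_self hx)]
    exact mul_nonneg hl.le (by linarith [hx.1])
  · have h0 : 0 ≤ 1 + x := by linarith [hx.1]
    rw [lebDensity_apply (Ioo_subset_Icc_self hx), lebDensity_apply (Ioo_subset_Icc_self hy)]
    constructor
    · have : 0 ≤ 1 + y := by linarith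
      gcongr
    · have h1 : (1 + x) ^ 3 ≤ (1 + y) ^ 3 := by gcongr
      have h2 : 0 ≤ Real.log 2 * ((1 + x) * (1 + y)) := by
        have := hy.1
        positivity
      nlinarith [mul_le_mul_of_nonneg_left h1 h2]

lemma distCone_le {f : BddMeas} (hf : f ∈ distCone 4) {x y : ℝ} (hx : x ∈ Ioo (0 : ℝ) 1)
    (hy : y ∈ Ioo (0 : ℝ) 1) : f x ≤ 16 * f y := by
  have b1 : ∀ t ∈ Ioo (0 : ℝ) 1, 1 ≤ (1 + t) ^ 4 ∧ (1 + t) ^ 4 ≤ 16 := fun t ht =>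
    ⟨one_le_pow₀ (by linarith [ht.1]), by
      calc (1 + t) ^ 4 ≤ 2 ^ 4 := by
            have := ht.1
            gcongr
            linarith [ht.2]
        _ = 16 := by norm_num⟩
  have fx := hf.1 x hx
  have fy := hf.1 y hy
  obtain ⟨x1, x2⟩ := b1 x hx
  obtain ⟨y1, y2⟩ := b1 y hy
  rcases le_total x y with h | h
  · have := (hf.2 x hx y hy h).1
    nlinarith
  · have := (hf.2 y hy x hx h).2
    nlinarith

lemma distCone_bounds {f : BddMeas} (hf : f ∈ distCone 4) {x : ℝ} (hx : x ∈ Ioo (0 : ℝ) 1) :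
    mean f / 16 ≤ f x ∧ f x ≤ 16 * mean f := by
  have h1 : mean f ≤ mean (BddMeas.const (16 * f x)) :=
    mean_mono fun y hy => distCone_le hf hy hx
  have h2 : mean (BddMeas.const (f x / 16)) ≤ mean f := mean_mono fun y hy => by
    have := distCone_le hf hx hy
    change f x / 16 ≤ f y
    linarith
  rw [mean_const] at h1 h2
  constructor <;> linarith

/-- The logarithm of each weight is Lipschitz with constant `1` in `log (1 + x)`. -/
lemma weight_distortion (n : ℕ) {x y : ℝ} (hx : 0 < x) (hxy : x ≤ y) :
    weight n x * (1 + x) ≤ weight n y * (1 + y) ∧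
      weight n y * (1 + x) ≤ weight n x * (1 + y) := by
  have hy : 0 < y := hx.trans_le hxy
  have hn : (0 : ℝ) ≤ n := n.cast_nonneg
  have h1 : (0 : ℝ) < n + 1 + x := by positivity
  have h2 : (0 : ℝ) < n + 2 + x := by positivity
  have h3 : (0 : ℝ) < n + 1 + y := by positivity
  have h4 : (0 : ℝ) < n + 2 + y := by positivity
  unfold weight
  constructor
  · have e : ∀ t : ℝ, (1 + t) / ((n + 1 + t) * (n + 2 + t)) * (1 + t) =
        (1 + t) / (n + 1 + t) * ((1 + t) / (n + 2 + t)) := fun t => by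
      rw [div_mul_div_comm, div_mul_eq_mul_div]
    rw [e, e]
    have hd1 : (1 + x) / (n + 1 + x) ≤ (1 + y) / (n + 1 + y) := by
      rw [div_le_div_iff₀ h1 h3]; nlinarith
    have hd2 : (1 + x) / (n + 2 + x) ≤ (1 + y) / (n + 2 + y) := by
      rw [div_le_div_iff₀ h2 h4]; nlinarith
    gcongr
  · rw [div_mul_eq_mul_div, div_mul_eq_mul_div, mul_comm (1 + y)]
    gcongr

/-- Each branch contracts the metric `log (1 + x)` at least by the factor `1 / 2`. -/
lemma branch_distortion (n : ℕ) {x y : ℝ} (hx : 0 < x) (hxy : x ≤ y) :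
    (1 + branch n x) ^ 2 * (1 + x) ≤ (1 + branch n y) ^ 2 * (1 + y) := by
  have hy : 0 < y := hx.trans_le hxy
  have hn : (0 : ℝ) ≤ n := n.cast_nonneg
  have h1 : (0 : ℝ) < n + 1 + x := by positivity
  have h3 : (0 : ℝ) < n + 1 + y := by positivity
  unfold branch
  have e : ∀ t : ℝ, 0 < (n : ℝ) + 1 + t → (1 + 1 / ((n : ℝ) + 1 + t)) ^ 2 * (1 + t) =
      (1 + t) + (1 + t) / (n + 1 + t) * (2 + 1 / (n + 1 + t)) := fun t ht => by
    field_simp; ring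
  rw [e x h1, e y h3]
  -- the difference is a product of `y - x` with a positive factor
  have key : (1 + y) + (1 + y) / (n + 1 + y) * (2 + 1 / (n + 1 + y)) -
      ((1 + x) + (1 + x) / (n + 1 + x) * (2 + 1 / (n + 1 + x))) =
      (y - x) * ((n + 1 + x) ^ 2 * (n + 1 + y) ^ 2 + 2 * n * (n + 1 + x) * (n + 1 + y) +
        n * (n + 1 + x) + n * (n + 1 + y) - (n + 1 + x) * (n + 1 + y)) /
      ((n + 1 + x) ^ 2 * (n + 1 + y) ^ 2) := by
    field_simp
    ring
  have hp : 1 ≤ (n + 1 + x) * (n + 1 + y) := by nlinarith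
  have hq : 0 ≤ (n + 1 + x) ^ 2 * (n + 1 + y) ^ 2 + 2 * n * (n + 1 + x) * (n + 1 + y) +
      n * (n + 1 + x) + n * (n + 1 + y) - (n + 1 + x) * (n + 1 + y) := by
    have a1 : 0 ≤ 2 * n * (n + 1 + x) * (n + 1 + y) := by positivity
    have a2 : 0 ≤ n * (n + 1 + x) := by positivity
    have a3 : 0 ≤ n * (n + 1 + y) := by positivity
    nlinarith
  have : 0 ≤ (y - x) * ((n + 1 + x) ^ 2 * (n + 1 + y) ^ 2 + 2 * n * (n + 1 + x) * (n + 1 + y) +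
        n * (n + 1 + x) + n * (n + 1 + y) - (n + 1 + x) * (n + 1 + y)) /
      ((n + 1 + x) ^ 2 * (n + 1 + y) ^ 2) :=
    div_nonneg (mul_nonneg (by linarith) hq) (by positivity)
  linarith

/-- The composition halves the Lipschitz constant and the weight adds `1`, so `4` becomes `4 / 2 + 1
= 3`. This holds for every branch separately, hence for any selection of digits. -/
lemma branch_term_mem {f : BddMeas} (hf : f ∈ distCone 4) (n : ℕ) {x y : ℝ}
    (hx : x ∈ Ioo (0 : ℝ) 1) (hy : y ∈ Ioo (0 : ℝ) 1) (hxy : x ≤ y) :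
    weight n x * f (branch n x) * (1 + x) ^ 3 ≤ weight n y * f (branch n y) * (1 + y) ^ 3 ∧
      weight n y * f (branch n y) * (1 + x) ^ 3 ≤ weight n x * f (branch n x) * (1 + y) ^ 3 := by
  have x0 := hx.1
  have y0 := hy.1
  obtain ⟨w1, w2⟩ := weight_distortion n x0 hxy
  have hb := branch_distortion n x0 hxy
  have bx := branch_mem_Ioo n hx
  have by' := branch_mem_Ioo n hy
  obtain ⟨f1, f2⟩ := hf.2 _ by' _ bx (branch_antitone n x0.le hxy)
  have fx := hf.1 _ bx
  have fy := hf.1 _ by'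
  have wx := weight_nonneg n x0.le
  have wy := weight_nonneg n y0.le
  have p1 : 0 < 1 + branch n x := by linarith [bx.1]
  have p2 : 0 < 1 + branch n y := by linarith [by'.1]
  have hb2 : (1 + branch n x) ^ 4 * (1 + x) ^ 2 ≤ (1 + branch n y) ^ 4 * (1 + y) ^ 2 := by
    have := pow_le_pow_left₀ (by positivity) hb 2
    calc _ = ((1 + branch n x) ^ 2 * (1 + x)) ^ 2 := by ring
      _ ≤ _ := this
      _ = _ := by ring
  -- distortion of the composed function
  have g1 : f (branch n x) * (1 + x) ^ 2 ≤ f (branch n y) * (1 + y) ^ 2 := by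
    have h := mul_le_mul_of_nonneg_left hb2 fy
    have h' := mul_le_mul_of_nonneg_right f2 (show 0 ≤ (1 + x) ^ 2 by positivity)
    refine le_of_mul_le_mul_right ?_ (pow_pos p2 4)
    linarith
  have g2 : f (branch n y) * (1 + x) ^ 2 ≤ f (branch n x) * (1 + y) ^ 2 := by
    have h := mul_le_mul_of_nonneg_left hb2 fx
    have h' := mul_le_mul_of_nonneg_right f1 (show 0 ≤ (1 + x) ^ 2 by positivity)
    refine le_of_mul_le_mul_right ?_ (pow_pos p2 4)
    linarith
  constructor
  · calc _ = (weight n x * (1 + x)) * (f (branch n x) * (1 + x) ^ 2) := by ring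
      _ ≤ (weight n y * (1 + y)) * (f (branch n y) * (1 + y) ^ 2) := by gcongr
      _ = _ := by ring
  · calc _ = (weight n y * (1 + x)) * (f (branch n y) * (1 + x) ^ 2) := by ring
      _ ≤ (weight n x * (1 + y)) * (f (branch n x) * (1 + y) ^ 2) := by gcongr
      _ = _ := by ring

lemma measurableSet_digit (p : Set ℕ) : MeasurableSet {y | digit y ∈ p} :=
  measurable_digit (MeasurableSet.of_discrete (s := p))

/-- The part of the transfer operator that belongs to a set of digits. -/
def digitOp (p : Set ℕ) : BddMeas →ₗ[ℝ] BddMeas := transfer ∘ₗ cut (measurableSet_digit p)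

open Classical in
lemma hasSum_digitOp (p : Set ℕ) (f : BddMeas) {x : ℝ} (hx : x ∈ Ioo (0 : ℝ) 1) :
    HasSum (fun n => if n ∈ p then weight n x * f (branch n x) else 0) (digitOp p f x) := by
  refine (hasSum_transfer (cut (measurableSet_digit p) f) (Ioo_subset_Icc_self hx)).congr_fun
    fun n => ?_
  have hd := digit_branch n (Ioo_subset_Ico_self hx)
  by_cases hn : n ∈ p
  · rw [if_pos hn, cut_apply_of_mem]
    rw [mem_ofPred_eq, hd]
    exact hn
  · rw [if_neg hn, cut_apply_of_notMem, mul_zero]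
    rw [mem_ofPred_eq, hd]
    exact hn

lemma digitOp_mem {f : BddMeas} (hf : f ∈ distCone 4) (p : Set ℕ) :
    digitOp p f ∈ distCone 3 := by
  classical
  refine ⟨fun x hx => ?_, fun x hx y hy hxy => ?_⟩
  · refine (hasSum_digitOp p f hx).nonneg fun n => ?_
    split_ifs
    · exact mul_nonneg (weight_nonneg n hx.1.le) (hf.1 _ (branch_mem_Ioo n hx))
    · exact le_rfl
  · have sx := hasSum_digitOp p f hx
    have sy := hasSum_digitOp p f hy
    refine ⟨hasSum_le (fun n => ?_) (sx.mul_right _) (sy.mul_right _),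
      hasSum_le (fun n => ?_) (sy.mul_right _) (sx.mul_right _)⟩
    · split_ifs
      · exact (branch_term_mem hf n hx hy hxy).1
      · simp
    · split_ifs
      · exact (branch_term_mem hf n hx hy hxy).2
      · simp

/-- One admissible digit already contributes its weight, which is at least `1 / ((d + 2) * (d + 3))`
on the interval. -/
lemma digitOp_ge {f : BddMeas} {t : ℝ} (hf : ∀ x ∈ Ioo (0 : ℝ) 1, t ≤ f x) (ht : 0 ≤ t)
    {p : Set ℕ} {d : ℕ} (hd : d ∈ p) {x : ℝ} (hx : x ∈ Ioo (0 : ℝ) 1) :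
    1 / (((d : ℝ) + 2) * (d + 3)) * t ≤ digitOp p f x := by
  classical
  have hx0 := hx.1
  have h1 := hasSum_le (fun n => ?_) (hasSum_ite_eq d (weight d x * f (branch d x)))
    (hasSum_digitOp p f hx)
  · refine le_trans ?_ h1
    have hd0 : (0 : ℝ) ≤ d := d.cast_nonneg
    refine mul_le_mul ?_ (hf _ (branch_mem_Ioo d hx)) ht (weight_nonneg d hx0.le)
    unfold weight
    have := hx.2
    rw [div_le_div_iff₀ (by positivity) (by positivity)]
    have e1 : ((d : ℝ) + 1 + x) * (d + 2 + x) ≤ (d + 2) * (d + 3) :=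
      mul_le_mul (by linarith) (by linarith) (by positivity) (by positivity)
    have e2 : 0 ≤ x * (((d : ℝ) + 2) * (d + 3)) := by positivity
    linarith
  · by_cases hn : n = d
    · subst hn; simp [hd]
    · rw [if_neg hn]
      split_ifs
      · exact mul_nonneg (weight_nonneg n hx0.le) (ht.trans (hf _ (branch_mem_Ioo n hx)))
      · exact le_rfl

lemma distCone_mono {a b : ℕ} (hab : a ≤ b) : distCone a ⊆ distCone b := by
  intro f hf
  refine ⟨hf.1, fun x hx y hy hxy => ?_⟩
  obtain ⟨h1, h2⟩ := hf.2 x hx y hy hxy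
  obtain ⟨c, rfl⟩ := Nat.exists_eq_add_of_le hab
  have x0 : 0 < 1 + x := by linarith [hx.1]
  have y0 : 0 < 1 + y := by linarith [hy.1]
  have h3 : (1 + x) ^ c ≤ (1 + y) ^ c := by gcongr
  have fx := hf.1 x hx
  have fy := hf.1 y hy
  rw [pow_add, pow_add, ← mul_assoc, ← mul_assoc, ← mul_assoc, ← mul_assoc]
  constructor <;> gcongr

/-- The gain from exponent `3` to `4` pays for the constant. The number `15 = 8 + 4 + 2 + 1` comes
from `1 + y ≤ 2 * (1 + x)` in the factorisation of the difference of fourth powers. -/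
lemma sub_const_mem_distCone {g : BddMeas} (hg : g ∈ distCone 3) {α : ℝ} (hα : 0 ≤ α)
    (h : ∀ x ∈ Ioo (0 : ℝ) 1, 15 * α ≤ g x) : g - α • BddMeas.const 1 ∈ distCone 4 := by
  refine ⟨fun x hx => ?_, fun x hx y hy hxy => ?_⟩
  · change 0 ≤ g x - α * 1
    linarith [h x hx]
  · obtain ⟨h1, h2⟩ := hg.2 x hx y hy hxy
    have x0 : 0 < 1 + x := by linarith [hx.1]
    have y0 : 0 < 1 + y := by linarith [hy.1]
    change (g x - α * 1) * _ ≤ (g y - α * 1) * _ ∧ (g y - α * 1) * _ ≤ (g x - α * 1) * _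
    have hx1 := h x hx
    -- `(1 + y) ^ 4 - (1 + x) ^ 4 ≤ 15 (1 + x) ^ 3 (y - x)`
    have hpoly : (1 + y) ^ 4 - (1 + x) ^ 4 ≤ 15 * ((1 + x) ^ 3 * (y - x)) := by
      have e : (1 + y) ^ 4 - (1 + x) ^ 4 = (y - x) *
          ((1 + y) ^ 3 + (1 + y) ^ 2 * (1 + x) + (1 + y) * (1 + x) ^ 2 + (1 + x) ^ 3) := by ring
      have hr : 1 + y ≤ 2 * (1 + x) := by linarith [hx.1, hy.2]
      have r2 : (1 + y) ^ 2 ≤ 4 * (1 + x) ^ 2 := by nlinarith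
      have r3 : (1 + y) ^ 3 ≤ 8 * (1 + x) ^ 3 := by
        calc (1 + y) ^ 3 ≤ (2 * (1 + x)) ^ 3 := by gcongr
          _ = _ := by ring
      have s2 : (1 + y) ^ 2 * (1 + x) ≤ 4 * (1 + x) ^ 3 := by nlinarith
      have s1 : (1 + y) * (1 + x) ^ 2 ≤ 2 * (1 + x) ^ 3 := by nlinarith [pow_pos x0 2]
      rw [e]
      nlinarith
    have hα4 : α * ((1 + y) ^ 4 - (1 + x) ^ 4) ≤ g x * ((1 + x) ^ 3 * (y - x)) := by
      have hp : 0 ≤ (1 + x) ^ 3 * (y - x) := mul_nonneg (by positivity) (by linarith)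
      calc α * ((1 + y) ^ 4 - (1 + x) ^ 4) ≤ α * (15 * ((1 + x) ^ 3 * (y - x))) := by gcongr
        _ = 15 * α * ((1 + x) ^ 3 * (y - x)) := by ring
        _ ≤ _ := by gcongr
    constructor
    · -- `g y (1 + y) ^ 4 ≥ g x (1 + x) ^ 3 (1 + y)`
      have := mul_le_mul_of_nonneg_right h1 y0.le
      nlinarith
    · have := mul_le_mul_of_nonneg_right h2 x0.le
      have h3 : g x * ((1 + x) ^ 3 * (y - x)) ≤ g x * ((1 + y) ^ 3 * (y - x)) := by
        have : 0 ≤ y - x := by linarith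
        have : 0 ≤ g x := by linarith
        gcongr
      nlinarith

/-- The relative variation of `g` is controlled by `7`, doubled to `14` through `1 + y ≤ 2 * (1 +
x)`. The estimates need only `c ≥ 15 * g`, so `127` is generous. -/
lemma const_sub_mem_distCone {g : BddMeas} (hg : g ∈ distCone 3) {c : ℝ}
    (h : ∀ x ∈ Ioo (0 : ℝ) 1, 127 * g x ≤ c) : c • BddMeas.const 1 - g ∈ distCone 4 := by
  refine ⟨fun x hx => ?_, fun x hx y hy hxy => ?_⟩
  · change 0 ≤ c * 1 - g x
    linarith [h x hx, hg.1 x hx]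
  · obtain ⟨h1, h2⟩ := hg.2 x hx y hy hxy
    have x0 : 0 < 1 + x := by linarith [hx.1]
    have y0 : 0 < 1 + y := by linarith [hy.1]
    have gx := hg.1 x hx
    have gy := hg.1 y hy
    change (c * 1 - g x) * _ ≤ (c * 1 - g y) * _ ∧ (c * 1 - g y) * _ ≤ (c * 1 - g x) * _
    have hd : 0 ≤ y - x := by linarith
    have hr : 1 + y ≤ 2 * (1 + x) := by linarith [hx.1, hy.2]
    have hX3 : 0 < (1 + x) ^ 3 := by positivity
    have hXY : (1 + x) ^ 3 ≤ (1 + y) ^ 3 := by gcongr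
    -- `(1 + y) ^ 4 - (1 + x) ^ 4 ≥ (1 + y) ^ 3 (y - x)`
    have hlow : (1 + y) ^ 3 * (y - x) ≤ (1 + y) ^ 4 - (1 + x) ^ 4 := by nlinarith
    have hpoly : (1 + y) ^ 3 - (1 + x) ^ 3 ≤ 7 * ((1 + x) ^ 2 * (y - x)) := by
      have e : (1 + y) ^ 3 - (1 + x) ^ 3 = (y - x) *
          ((1 + y) ^ 2 + (1 + y) * (1 + x) + (1 + x) ^ 2) := by ring
      have r2 : (1 + y) ^ 2 ≤ 4 * (1 + x) ^ 2 := by nlinarith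
      have r1 : (1 + y) * (1 + x) ≤ 2 * (1 + x) ^ 2 := by nlinarith
      rw [e]
      nlinarith
    -- Lipschitz estimates for `g`
    have k1 : (g y - g x) * (1 + x) ≤ 7 * g x * (y - x) := by
      have : (g y - g x) * (1 + x) ^ 3 ≤ g x * (7 * ((1 + x) ^ 2 * (y - x))) := by
        nlinarith [mul_le_mul_of_nonneg_left hpoly gx]
      refine le_of_mul_le_mul_right ?_ (pow_pos x0 2)
      linarith
    have k2 : (g x - g y) * (1 + x) ≤ 7 * g y * (y - x) := by
      have : (g x - g y) * (1 + x) ^ 3 ≤ g y * (7 * ((1 + x) ^ 2 * (y - x))) := by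
        nlinarith [mul_le_mul_of_nonneg_left hpoly gy]
      refine le_of_mul_le_mul_right ?_ (pow_pos x0 2)
      linarith
    have hcx := h x hx
    have hcy := h y hy
    have hYX : (1 + y) ^ 4 ≤ 2 * (1 + x) * (1 + y) ^ 3 := by
      nlinarith [pow_pos y0 3]
    have hP : 0 ≤ (1 + y) ^ 3 * (y - x) := mul_nonneg (by positivity) hd
    constructor
    · have m1 : (g y - g x) * (1 + y) ^ 4 ≤ 14 * g x * ((1 + y) ^ 3 * (y - x)) := by
        rcases le_or_gt (g y - g x) 0 with hneg | hpos
        · exact (mul_nonpos_of_nonpos_of_nonneg hneg (by positivity)).trans (by positivity)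
        · calc (g y - g x) * (1 + y) ^ 4 ≤ (g y - g x) * (2 * (1 + x) * (1 + y) ^ 3) := by gcongr
            _ = (g y - g x) * (1 + x) * (2 * (1 + y) ^ 3) := by ring
            _ ≤ 7 * g x * (y - x) * (2 * (1 + y) ^ 3) := by gcongr
            _ = _ := by ring
      have m2 : 15 * g x * ((1 + y) ^ 3 * (y - x)) ≤ c * ((1 + y) ^ 3 * (y - x)) := by
        gcongr; linarith
      have m3 : (c - g x) * ((1 + y) ^ 3 * (y - x)) ≤ (c - g x) * ((1 + y) ^ 4 - (1 + x) ^ 4) := by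
        gcongr; linarith
      nlinarith
    · have m1 : (g x - g y) * (1 + y) ^ 4 ≤ 14 * g y * ((1 + y) ^ 3 * (y - x)) := by
        rcases le_or_gt (g x - g y) 0 with hneg | hpos
        · exact (mul_nonpos_of_nonpos_of_nonneg hneg (by positivity)).trans (by positivity)
        · calc (g x - g y) * (1 + y) ^ 4 ≤ (g x - g y) * (2 * (1 + x) * (1 + y) ^ 3) := by gcongr
            _ = (g x - g y) * (1 + x) * (2 * (1 + y) ^ 3) := by ring
            _ ≤ 7 * g y * (y - x) * (2 * (1 + y) ^ 3) := by gcongr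
            _ = _ := by ring
      have m2 : 15 * g y * ((1 + y) ^ 3 * (y - x)) ≤ c * ((1 + y) ^ 3 * (y - x)) := by
        gcongr; linarith
      have m3 : (c - g y) * ((1 + y) ^ 3 * (y - x)) ≤ (c - g y) * ((1 + y) ^ 4 - (1 + x) ^ 4) := by
        gcongr; linarith
      nlinarith

/-! ### Transfer operators of digit automata -/

section Automaton

/-- The product cone. -/
def prodCone (ι : Type) (a : ℕ) : Set (ι → BddMeas) := {F | ∀ i, F i ∈ distCone a}

lemma prodCone_mono {ι : Type} {a b : ℕ} (hab : a ≤ b) : prodCone ι a ⊆ prodCone ι b :=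
  fun _ hF i => distCone_mono hab (hF i)

variable {ι : Type} [Fintype ι]

/-- The transfer operator of a deterministic automaton that reads continued fraction digits and
may get stuck. -/
def autOp (step : ι → ℕ → Option ι) : Module.End ℝ (ι → BddMeas) :=
  LinearMap.pi fun j => ∑ i, digitOp {n | step i n = some j} ∘ₗ LinearMap.proj i

/-- The total mass. -/
def totalMean : (ι → BddMeas) →ₗ[ℝ] ℝ := ∑ i, mean ∘ₗ LinearMap.proj i

lemma autOp_apply (step : ι → ℕ → Option ι) (F : ι → BddMeas) (j : ι) :
    autOp step F j = ∑ i, digitOp {n | step i n = some j} (F i) := by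
  simp [autOp]

lemma totalMean_apply (F : ι → BddMeas) : totalMean F = ∑ i, mean (F i) := by
  simp [totalMean]

lemma autOp_mem {step : ι → ℕ → Option ι} {F : ι → BddMeas} (hF : F ∈ prodCone ι 4) :
    autOp step F ∈ prodCone ι 3 := fun j => by
  rw [autOp_apply]
  exact distCone_sum _ fun i _ => digitOp_mem (hF i) _

lemma autOp_pow_mem {step : ι → ℕ → Option ι} {F : ι → BddMeas} (hF : F ∈ prodCone ι 4) (n : ℕ) :
    (autOp step ^ n) F ∈ prodCone ι 4 := by
  induction n with
  | zero => exact hF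
  | succ n ih =>
    rw [pow_succ', Module.End.mul_apply]
    exact prodCone_mono (by norm_num) (autOp_mem ih)

lemma autOp_pow_mem_three {step : ι → ℕ → Option ι} {F : ι → BddMeas} (hF : F ∈ prodCone ι 4)
    {n : ℕ} (hn : 0 < n) : (autOp step ^ n) F ∈ prodCone ι 3 := by
  obtain ⟨m, rfl⟩ : ∃ m, n = m + 1 := ⟨n - 1, by omega⟩
  rw [pow_succ', Module.End.mul_apply]
  exact autOp_mem (autOp_pow_mem hF m)

lemma mean_nonneg_of_mem {a : ℕ} {f : BddMeas} (hf : f ∈ distCone a) : 0 ≤ mean f :=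
  mean_nonneg hf.1

lemma totalMean_nonneg {a : ℕ} {F : ι → BddMeas} (hF : F ∈ prodCone ι a) : 0 ≤ totalMean F := by
  rw [totalMean_apply]
  exact Finset.sum_nonneg fun i _ => mean_nonneg_of_mem (hF i)

/-- The automaton can go from state `i` to state `j` in `n` steps. -/
inductive Reach (step : ι → ℕ → Option ι) : ℕ → ι → ι → Prop
  | refl (i : ι) : Reach step 0 i i
  | tail {n : ℕ} {i j k : ι} (d : ℕ) : Reach step n i j → step j d = some k →
      Reach step (n + 1) i k

lemma Reach.exists_lower_bound {step : ι → ℕ → Option ι} {n : ℕ} {i j : ι}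
    (h : Reach step n i j) : ∃ c : ℝ, 0 < c ∧ ∀ F ∈ prodCone ι 4, ∀ t : ℝ, 0 ≤ t →
      (∀ x ∈ Ioo (0 : ℝ) 1, t ≤ F i x) →
      ∀ x ∈ Ioo (0 : ℝ) 1, c * t ≤ (autOp step ^ n) F j x := by
  induction h with
  | refl i => exact ⟨1, one_pos, fun F _ t _ h => by simpa using h⟩
  | @tail n i j k d _ hd ih =>
    obtain ⟨c, hc, ih⟩ := ih
    refine ⟨1 / (((d : ℝ) + 2) * (d + 3)) * c, by positivity, fun F hF t ht h x hx => ?_⟩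
    rw [pow_succ', Module.End.mul_apply, autOp_apply]
    have h1 := digitOp_ge (ih F hF t ht h) (by positivity) (p := {n | step j n = some k})
      (d := d) hd hx
    have h2 : digitOp {n | step j n = some k} ((autOp step ^ n) F j) x ≤
        (∑ i, digitOp {n | step i n = some k} ((autOp step ^ n) F i)) x := by
      have e : (∑ i, digitOp {n | step i n = some k} ((autOp step ^ n) F i)) x =
          ∑ i, digitOp {n | step i n = some k} ((autOp step ^ n) F i) x := by
        simp [Finset.sum_apply]
      rw [e]
      exact Finset.single_le_sum (f := fun i =>
        digitOp {n | step i n = some k} ((autOp step ^ n) F i) x)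
        (fun i _ => (digitOp_mem (autOp_pow_mem hF n i) _).1 x hx) (Finset.mem_univ j)
    rw [mul_assoc]
    exact h1.trans h2

/-- Uniform positivity of a power of the operator of a primitive automaton. -/
lemma exists_uniform_lower_bound [Nonempty ι] {step : ι → ℕ → Option ι} {m : ℕ}
    (h : ∀ i j, Reach step m i j) : ∃ c : ℝ, 0 < c ∧ ∀ F ∈ prodCone ι 4, ∀ j,
      ∀ x ∈ Ioo (0 : ℝ) 1, c * totalMean F ≤ (autOp step ^ m) F j x := by
  choose c hc hb using fun i j => (h i j).exists_lower_bound
  obtain ⟨p, hp⟩ := Finite.exists_min fun p : ι × ι => c p.1 p.2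
  have hcard : (0 : ℝ) < Fintype.card ι := by exact_mod_cast Fintype.card_pos
  refine ⟨c p.1 p.2 / (16 * Fintype.card ι), by have := hc p.1 p.2; positivity,
    fun F hF j x hx => ?_⟩
  -- The state of largest mean carries at least the average share of the total mass, and its
  -- function is at least `1 / 16` of its mean everywhere on `(0,1)`.
  obtain ⟨i, hi⟩ := Finite.exists_max fun i => mean (F i)
  have h1 : totalMean F ≤ Fintype.card ι * mean (F i) := by
    rw [totalMean_apply, ← nsmul_eq_mul]
    exact Finset.sum_le_card_nsmul _ _ _ fun i' _ => hi i'
  have hm := mean_nonneg_of_mem (hF i)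
  have h2 := hb i j F hF (mean (F i) / 16) (by positivity)
    (fun y hy => (distCone_bounds (hF i) hy).1) x hx
  refine le_trans ?_ h2
  have h3 := hp (i, j)
  have h4 := (hc p.1 p.2).le
  calc c p.1 p.2 / (16 * Fintype.card ι) * totalMean F
      ≤ c p.1 p.2 / (16 * Fintype.card ι) * (Fintype.card ι * mean (F i)) := by gcongr
    _ = c p.1 p.2 * (mean (F i) / 16) := by field_simp
    _ ≤ _ := by gcongr

/-- Balance of mass: each digit leads to exactly one state or gets stuck. -/
lemma mean_sum_digitOp {step : ι → ℕ → Option ι} (i : ι) (f : BddMeas) :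
    ∑ j, mean (digitOp {n | step i n = some j} f) + mean (digitOp {n | step i n = none} f) =
      mean f := by
  classical
  have e : ∀ p, mean (digitOp p f) = mean (cut (measurableSet_digit p) f) := fun p =>
    mean_transfer _
  simp only [e]
  rw [← map_sum, ← map_add]
  congr 1
  ext x
  have e2 : ((∑ j, cut (measurableSet_digit {n | step i n = some j}) f +
      cut (measurableSet_digit {n | step i n = none}) f : BddMeas) : ℝ → ℝ) x =
      ∑ j, cut (measurableSet_digit {n | step i n = some j}) f x +
        cut (measurableSet_digit {n | step i n = none}) f x := by
    simp [Finset.sum_apply]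
  rw [e2]
  have e3 : ∀ q : Option ι, cut (measurableSet_digit {n | step i n = q}) f x =
      if step i (digit x) = q then f x else 0 := by
    intro q
    split_ifs with h
    · exact cut_apply_of_mem _ _ h
    · exact cut_apply_of_notMem _ _ h
  simp only [e3]
  cases h : step i (digit x) with
  | none => simp
  | some j => simp

lemma totalMean_autOp (step : ι → ℕ → Option ι) (F : ι → BddMeas) :
    totalMean (autOp step F) =
      totalMean F - ∑ i, mean (digitOp {n | step i n = none} (F i)) := by
  rw [totalMean_apply, totalMean_apply]
  simp only [autOp_apply, map_sum]
  rw [Finset.sum_comm, ← Finset.sum_sub_distrib]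
  refine Finset.sum_congr rfl fun i _ => ?_
  rw [← mean_sum_digitOp (step := step) i (F i)]
  ring

lemma totalMean_autOp_le {step : ι → ℕ → Option ι} {F : ι → BddMeas} (hF : F ∈ prodCone ι 4) :
    totalMean (autOp step F) ≤ totalMean F := by
  rw [totalMean_autOp]
  linarith [Finset.sum_nonneg fun i (_ : i ∈ Finset.univ) =>
    mean_nonneg_of_mem (digitOp_mem (hF i) {n | step i n = none})]

lemma totalMean_autOp_pow_antitone {step : ι → ℕ → Option ι} {F : ι → BddMeas}
    (hF : F ∈ prodCone ι 4) : Antitone fun n => totalMean ((autOp step ^ n) F) :=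
  antitone_nat_of_succ_le fun n => by
    rw [pow_succ', Module.End.mul_apply]
    exact totalMean_autOp_le (autOp_pow_mem hF n)

lemma mean_ge_of_forall {f : BddMeas} {t : ℝ} (h : ∀ x ∈ Ioo (0 : ℝ) 1, t ≤ f x) : t ≤ mean f := by
  rw [← mean_const t]
  exact mean_mono h

/-- Exact exponential asymptotics for primitive automata that may get stuck. -/
theorem isDecayRate_autOp [Nonempty ι] {step : ι → ℕ → Option ι} {m : ℕ} (hm : 0 < m)
    (h : ∀ i j, Reach step m i j) {i₁ : ι} {d : ℕ} (hstuck : step i₁ d = none)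
    {F : ι → BddMeas} (hF : F ∈ prodCone ι 4) (hF0 : 0 < totalMean F) :
    ∃ lam, IsDecayRate (fun n => totalMean ((autOp step ^ n) F)) lam := by
  obtain ⟨c, hc, hlow⟩ := exists_uniform_lower_bound h
  obtain ⟨j₀⟩ := ‹Nonempty ι›
  have hmono := totalMean_autOp_pow_antitone (step := step) hF
  have hpos : ∀ n, 0 < totalMean ((autOp step ^ n) F) := by
    have hmul : ∀ k, 0 < totalMean ((autOp step ^ (m * k)) F) := by
      intro k
      induction k with
      | zero => simpa using hF0
      | succ k ih =>
        rw [mul_add, mul_one, add_comm, pow_add, Module.End.mul_apply]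
        have hk := autOp_pow_mem (step := step) hF (m * k)
        refine lt_of_lt_of_le (mul_pos hc ih) ((mean_ge_of_forall (hlow _ hk j₀)).trans ?_)
        rw [totalMean_apply]
        exact Finset.single_le_sum (f := fun i => mean ((autOp step ^ m)
          ((autOp step ^ (m * k)) F) i)) (fun i _ => mean_nonneg_of_mem (autOp_pow_mem hk m i))
          (Finset.mem_univ j₀)
    exact fun n => (hmul n).trans_le (hmono (Nat.le_mul_of_pos_left n hm))
  have hupper : ∀ G ∈ prodCone ι 4, ∀ j, ∀ x ∈ Ioo (0 : ℝ) 1,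
      (autOp step ^ m) G j x ≤ 16 * totalMean G := by
    intro G hG j x hx
    have hQ := autOp_pow_mem (step := step) hG m
    refine (distCone_bounds (hQ j) hx).2.trans ?_
    have h1 : mean ((autOp step ^ m) G j) ≤ totalMean ((autOp step ^ m) G) := by
      rw [totalMean_apply]
      exact Finset.single_le_sum (f := fun i => mean ((autOp step ^ m) G i))
        (fun i _ => mean_nonneg_of_mem (hQ i)) (Finset.mem_univ j)
    have h2 := totalMean_autOp_pow_antitone (step := step) hG (Nat.zero_le m)
    simp only [pow_zero, Module.End.one_apply] at h2
    linarith
  -- With `α = c * totalMean G / 15` the lower bound meets the requirement `15 * α ≤ g`. The upper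
  -- one asks for `R * α` to be at least `127 * 16 * totalMean G`; the summand `2` ensures `1 < R`.
  obtain ⟨lam, hlam⟩ := exists_hasGeometricDecay_of_cone (autOp step) (prodCone ι 4) totalMean
    (fun _ => BddMeas.const 1) F m (127 * 16 * 15 / c + 2) hm
    (by linarith [show 0 < 127 * 16 * 15 / c by positivity])
    (fun f hf g hg i => distCone_add (hf i) (hg i)) (fun a ha f hf i => distCone_smul ha (hf i))
    (fun i _ f hf => autOp_pow_mem hf i) (fun f hf => totalMean_nonneg hf)
    (fun G hG => by
      have hG0 := totalMean_nonneg hG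
      have h3 := autOp_pow_mem_three (step := step) hG hm
      refine ⟨c * totalMean G / 15, by positivity, fun j => ?_, fun j => ?_⟩
      · refine sub_const_mem_distCone (h3 j) (by positivity) fun x hx => ?_
        have := hlow G hG j x hx
        linarith
      · refine const_sub_mem_distCone (h3 j) fun x hx => ?_
        have h4 := hupper G hG j x hx
        have e : (127 * 16 * 15 / c + 2) * (c * totalMean G / 15) =
            127 * 16 * totalMean G + 2 * (c * totalMean G / 15) := by
          field_simp
        have h5 : 0 ≤ c * totalMean G / 15 := by positivity
        rw [e]
        linarith)
    (fun i _ => autOp_pow_mem hF i)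
    (by
      rw [totalMean_apply]
      simp [Fintype.card_pos_iff.2 ⟨j₀⟩]) hpos
  refine ⟨lam, hlam.1, ?_, hlam.2⟩
  -- a fixed proportion of the mass is lost in each step
  set q : ℝ := 1 / (((d : ℝ) + 2) * (d + 3)) with hq
  have hq0 : 0 < q := by positivity
  have ht := hlam.tendsto_ratio one_pos
  rw [pow_one] at ht
  have hle : lam ≤ 1 - q * c := by
    refine le_of_tendsto ht (eventually_atTop.2 ⟨m, fun n hn => ?_⟩)
    rw [one_mul, div_le_iff₀ (hpos n), add_comm n, pow_add, pow_one, Module.End.mul_apply,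
      totalMean_autOp]
    obtain ⟨k, rfl⟩ : ∃ k, n = m + k := ⟨n - m, by omega⟩
    have hk := autOp_pow_mem (step := step) hF k
    have h1 : ∀ x ∈ Ioo (0 : ℝ) 1, c * totalMean ((autOp step ^ k) F) ≤
        (autOp step ^ (m + k)) F i₁ x := by
      rw [pow_add, Module.End.mul_apply]
      exact hlow _ hk i₁
    have h2 := mean_ge_of_forall fun x hx => digitOp_ge h1 (by have := hpos k; positivity)
      (p := {n | step i₁ n = none}) (d := d) hstuck hx
    have h3 := Finset.single_le_sum (f := fun i => mean (digitOp {n | step i n = none}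
      ((autOp step ^ (m + k)) F i))) (fun i _ => mean_nonneg_of_mem
        (digitOp_mem (autOp_pow_mem hF (m + k) i) _)) (Finset.mem_univ i₁)
    have h4 : totalMean ((autOp step ^ (m + k)) F) ≤ totalMean ((autOp step ^ k) F) :=
      hmono (by omega)
    have h5 : q * c * totalMean ((autOp step ^ (m + k)) F) ≤
        q * (c * totalMean ((autOp step ^ k) F)) := by
      rw [mul_assoc]; gcongr
    linarith
  have := mul_pos hq0 hc
  linarith

/-- The automaton, started in state `i`, can read the first `n` digits of `x`. -/
def Runs (step : ι → ℕ → Option ι) : ℕ → ι → ℝ → Prop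
  | 0, _, _ => True
  | n + 1, i, x => ∃ j, step i (digit x) = some j ∧ Runs step n j (gaussMap x)

lemma measurableSet_runs (step : ι → ℕ → Option ι) (n : ℕ) (i : ι) :
    MeasurableSet {x | Runs step n i x} := by
  induction n generalizing i with
  | zero => simp [Runs]
  | succ n ih =>
    have e : {x | Runs step (n + 1) i x} =
        ⋃ j, {y | digit y ∈ {n | step i n = some j}} ∩ gaussMap ⁻¹' {x | Runs step n j x} := by
      ext x
      simp [Runs]
    rw [e]
    exact MeasurableSet.iUnion fun j =>
      (measurableSet_digit _).inter (measurable_gaussMap (ih j))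

/-- The analogue of `mean_openOp_pow` for automata: duality moves acceptance of the remaining digits
across one step. -/
lemma totalMean_autOp_pow (step : ι → ℕ → Option ι) (n : ℕ) (F : ι → BddMeas) :
    totalMean ((autOp step ^ n) F) =
      ∑ i, mean (cut (measurableSet_runs step n i) (F i)) := by
  classical
  induction n generalizing F with
  | zero =>
    rw [totalMean_apply]
    refine Finset.sum_congr rfl fun i _ => mean_congr fun x _ => ?_
    rw [cut_apply_of_mem _ _ (show x ∈ {x | Runs step 0 i x} from trivial)]
    rfl
  | succ n ih =>
    rw [pow_succ, Module.End.mul_apply, ih]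
    simp only [autOp_apply, map_sum]
    rw [Finset.sum_comm]
    refine Finset.sum_congr rfl fun i _ => ?_
    have e : ∀ j, mean (cut (measurableSet_runs step n j)
        (digitOp {n | step i n = some j} (F i))) =
        mean (cut (measurableSet_preimage_gaussMap (measurableSet_runs step n j))
          (cut (measurableSet_digit {n | step i n = some j}) (F i))) := fun j =>
      mean_cut_transfer _ _
    simp only [e]
    rw [← map_sum]
    congr 1
    ext x
    have e2 : ((∑ j, cut (measurableSet_preimage_gaussMap (measurableSet_runs step n j))
          (cut (measurableSet_digit {n | step i n = some j}) (F i)) : BddMeas) : ℝ → ℝ) x =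
        ∑ j, cut (measurableSet_preimage_gaussMap (measurableSet_runs step n j))
          (cut (measurableSet_digit {n | step i n = some j}) (F i)) x := by
      simp [Finset.sum_apply]
    have e3 : ∀ j, cut (measurableSet_preimage_gaussMap (measurableSet_runs step n j))
          (cut (measurableSet_digit {n | step i n = some j}) (F i)) x =
        if step i (digit x) = some j then
          (if Runs step n j (gaussMap x) then F i x else 0) else 0 := by
      intro j
      by_cases h1 : Runs step n j (gaussMap x)
      · rw [cut_apply_of_mem _ _
          (show x ∈ gaussMap ⁻¹' {x | Runs step n j x} from h1), if_pos h1]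
        split_ifs with h2
        · exact cut_apply_of_mem _ _ h2
        · exact cut_apply_of_notMem _ _ h2
      · rw [cut_apply_of_notMem _ _
          (show x ∉ gaussMap ⁻¹' {x | Runs step n j x} from h1), if_neg h1, ite_self]
    rw [e2]
    simp only [e3]
    cases h : step i (digit x) with
    | none =>
      rw [cut_apply_of_notMem]
      · simp
      · rintro ⟨j, hj, _⟩
        rw [h] at hj
        simp at hj
    | some j =>
      simp only [Option.some.injEq, Finset.sum_ite_eq, Finset.mem_univ, if_true]
      split_ifs with h1
      · rw [cut_apply_of_mem]
        exact ⟨j, h, h1⟩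
      · rw [cut_apply_of_notMem]
        rintro ⟨j', hj', h2⟩
        rw [h, Option.some.injEq] at hj'
        exact h1 (hj' ▸ h2)

/-- The measure of the set of points whose digits are accepted by a primitive automaton has exact
exponential asymptotics. -/
theorem isDecayRate_runs [DecidableEq ι] {step : ι → ℕ → Option ι} {m : ℕ} (hm : 0 < m)
    (h : ∀ i j, Reach step m i j) {i₁ : ι} {d : ℕ} (hstuck : step i₁ d = none) (i₀ : ι) :
    ∃ lam, IsDecayRate
      (fun n => volume.real {x : ℝ | x ∈ Icc (0 : ℝ) 1 ∧ Runs step n i₀ x}) lam := by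
  have : Nonempty ι := ⟨i₀⟩
  have hF : Pi.single i₀ lebDensity ∈ prodCone ι 4 := by
    intro i
    by_cases hi : i = i₀
    · subst hi
      rw [Pi.single_eq_same]
      exact lebDensity_mem_distCone
    · rw [Pi.single_eq_of_ne hi]
      exact zero_mem_distCone 4
  have hsum : ∀ n, totalMean ((autOp step ^ n) (Pi.single i₀ lebDensity)) =
      volume.real {x : ℝ | x ∈ Icc (0 : ℝ) 1 ∧ Runs step n i₀ x} := by
    intro n
    rw [totalMean_autOp_pow, Finset.sum_eq_single i₀]
    · rw [Pi.single_eq_same, mean_cut_lebDensity]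
      rfl
    · intro j _ hj
      rw [Pi.single_eq_of_ne hj, map_zero, map_zero]
    · intro hi
      exact absurd (Finset.mem_univ _) hi
  obtain ⟨lam, hlam⟩ := isDecayRate_autOp hm h hstuck hF (by
    rw [totalMean_apply, Finset.sum_eq_single i₀]
    · rw [Pi.single_eq_same, mean_lebDensity]
      exact one_pos
    · intro j _ hj
      rw [Pi.single_eq_of_ne hj, map_zero]
    · intro hi
      exact absurd (Finset.mem_univ _) hi)
  refine ⟨lam, ?_⟩
  simpa only [hsum] using hlam

end Automaton

/-! ### Holes of prescribed length around the fixed point -/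

lemma IsDecayRate.hasGeometricDecay {a : ℕ → ℝ} {lam : ℝ}
    (h : IsDecayRate a lam) : HasGeometricDecay a lam := ⟨h.1, h.2.2⟩

lemma HasGeometricDecay.isDecayRate {a : ℕ → ℝ} {lam : ℝ} (h : HasGeometricDecay a lam)
    (h1 : lam < 1) : IsDecayRate a lam := ⟨h.1, h1, h.2⟩

/-- Holes around the fixed point. -/
theorem centred_holes (α β : ℝ → ℝ)
    (h : ∀ᶠ ε in 𝓝[>] (0 : ℝ), z ∈ Icc (α ε) (β ε) ∧ β ε - α ε = ε)
    (hc : ∀ c : ℝ, c < z ^ 2 / (1 + z ^ 2) →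
      ∀ᶠ ε in 𝓝[>] (0 : ℝ), c * ε ≤ min (z - α ε) (β ε - z)) :
    ∃ lam : ℝ → ℝ,
      (∀ᶠ ε in 𝓝[>] (0 : ℝ), IsDecayRate (fun n => survival (Icc (α ε) (β ε)) n) (lam ε)) ∧
      Tendsto (fun ε : ℝ => (1 - lam ε) / ε) (𝓝[>] (0 : ℝ)) (𝓝 (z ^ 2 / Real.log 2)) := by
  have hz := z_pos
  have hid : Tendsto (fun ε : ℝ => ε) (𝓝[>] 0) (𝓝 0) := nhdsWithin_le_nhds
  have hε : ∀ᶠ ε in 𝓝[>] (0 : ℝ), 0 < ε := eventually_mem_nhdsWithin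
  have hα : Tendsto α (𝓝[>] 0) (𝓝 z) := by
    have h1 : Tendsto (fun ε : ℝ => z - ε) (𝓝[>] 0) (𝓝 z) := by
      simpa using hid.const_sub z
    refine tendsto_of_tendsto_of_tendsto_of_le_of_le' h1 tendsto_const_nhds ?_ ?_
    · filter_upwards [h] with ε hε
      linarith [hε.1.2, hε.2]
    · filter_upwards [h] with ε hε
      exact hε.1.1
  have hβ : Tendsto β (𝓝[>] 0) (𝓝 z) := by
    have h1 : Tendsto (fun ε : ℝ => z + ε) (𝓝[>] 0) (𝓝 z) := by
      simpa using hid.const_add z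
    refine tendsto_of_tendsto_of_tendsto_of_le_of_le' tendsto_const_nhds h1 ?_ ?_
    · filter_upwards [h] with ε hε
      exact hε.1.2
    · filter_upwards [h] with ε hε
      linarith [hε.1.1, hε.2]
  have hlt : ∀ᶠ ε in 𝓝[>] (0 : ℝ), α ε < β ε := by
    filter_upwards [h, hε] with ε h1 h2
    linarith [h1.2]
  have H : ∀ η : ℝ, 0 < η → ∀ᶠ ε in 𝓝[>] (0 : ℝ),
      rightInverseBranch (α ε) ≤ β ε + η * (β ε - α ε) ∧
      α ε - η * (β ε - α ε) ≤ rightInverseBranch (β ε) := by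
    intro η hη
    -- With this `c` one has `c * (1 + z ^ 2) = z ^ 2 - η / 2`; the other `η / 2` pays for the
    -- factor `z * rightInverseBranch t` in `e`, which only tends to `z ^ 2`. The threshold is
    -- natural: `z ^ 2 * (z - α) ≤ β - z` for length `ε` means `β - z ≥ z ^ 2 / (1 + z ^ 2) * ε`.
    have hcη := hc ((z ^ 2 - η / 2) / (1 + z ^ 2)) (by gcongr; linarith)
    have e : ∀ t : ℝ, 0 < 1 + t → rightInverseBranch t - z = z * rightInverseBranch t * (z - t) := by
      intro t ht
      unfold rightInverseBranch
      field_simp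
      linarith [z_sq]
    have hev : ∀ u : ℝ → ℝ, Tendsto u (𝓝[>] 0) (𝓝 z) → ∀ᶠ ε in 𝓝[>] (0 : ℝ),
        z * rightInverseBranch (u ε) < z ^ 2 + η / 2 := by
      intro u hu
      have h1 := (tendsto_rightInverseBranch hu).const_mul z
      exact (tendsto_order.1 h1).2 _ (by nlinarith)
    filter_upwards [h, hε, hcη, hev α hα, hev β hβ, eventually_half_lt hα hβ] with
      ε h1 h2 h3 h4 h5 h6
    have hc1 : (z ^ 2 - η / 2) / (1 + z ^ 2) * ε * (1 + z ^ 2) = (z ^ 2 - η / 2) * ε := by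
      field_simp
    have hp : 0 < 1 + z ^ 2 := by positivity
    have k1 := mul_le_mul_of_nonneg_right (h3.trans (min_le_left _ _)) hp.le
    have k2 := mul_le_mul_of_nonneg_right (h3.trans (min_le_right _ _)) hp.le
    rw [hc1] at k1 k2
    obtain ⟨⟨hαz, hzβ⟩, hlen⟩ := h1
    rw [hlen]
    constructor
    · have e1 := e (α ε) (by linarith)
      have e2 := mul_le_mul_of_nonneg_right h4.le (show 0 ≤ z - α ε by linarith)
      have e3 : η / 2 * (z - α ε) ≤ η / 2 * ε := by gcongr; linarith
      have e4 : β ε = ε + α ε := by linarith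
      nlinarith
    · have e1 := e (β ε) (by linarith)
      have e2 := mul_le_mul_of_nonneg_right h5.le (show 0 ≤ β ε - z by linarith)
      have e3 : η / 2 * (β ε - z) ≤ η / 2 * ε := by gcongr; linarith
      have e4 : β ε = ε + α ε := by linarith
      nlinarith
  classical
  have hex := eventually_exists_decay hα hβ hlt
  set lam : ℝ → ℝ := fun ε =>
    if h : ∃ lam, HasGeometricDecay (survival (Icc (α ε) (β ε))) lam then h.choose else 0 with hlam
  have hdec : ∀ᶠ ε in 𝓝[>] (0 : ℝ), HasGeometricDecay (survival (Icc (α ε) (β ε))) (lam ε) := by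
    filter_upwards [hex] with ε h1
    simp only [hlam, dif_pos h1]
    exact h1.choose_spec
  have ht : Tendsto (fun ε : ℝ => (1 - lam ε) / ε) (𝓝[>] (0 : ℝ)) (𝓝 (z ^ 2 / Real.log 2)) := by
    refine (tendsto_rate_near_fixedPoint hα hβ hlt H hdec).congr' ?_
    filter_upwards [h] with ε h1
    rw [h1.2]
  refine ⟨lam, ?_, ht⟩
  -- The cone theorem gives no bound `lam < 1`; it follows here from the positivity of the limit.
  have hpos : 0 < z ^ 2 / Real.log 2 := div_pos (by positivity) log_two_pos
  filter_upwards [hdec, (tendsto_order.1 ht).1 _ hpos, hε] with ε h1 h2 h3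
  refine h1.isDecayRate ?_
  have := (div_pos_iff_of_pos_right h3).1 h2
  linarith

/-! ### Bounded digits and the holes at zero -/

lemma ae_irrational : ∀ᵐ x : ℝ, Irrational x :=
  (countable_range ((↑) : ℚ → ℝ)).ae_notMem volume

lemma irrational_mem_Ioo {x : ℝ} (hx : Irrational x) (h : x ∈ Icc (0 : ℝ) 1) :
    x ∈ Ioo (0 : ℝ) 1 :=
  ⟨lt_of_le_of_ne h.1 (hx.ne_zero).symm, lt_of_le_of_ne h.2 hx.ne_one⟩

lemma irrational_gaussMap {x : ℝ} (hx : Irrational x) : Irrational (gaussMap x) := by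
  rw [gaussMap, Int.fract, one_div]
  exact hx.inv.sub_intCast _

lemma gaussMap_mem_Ioo {x : ℝ} (hx : Irrational x) : gaussMap x ∈ Ioo (0 : ℝ) 1 :=
  irrational_mem_Ioo (irrational_gaussMap hx) (Ico_subset_Icc_self (gaussMap_mem x))

lemma irrational_gaussMap_iterate {x : ℝ} (hx : Irrational x) (h : x ∈ Ioo (0 : ℝ) 1) (n : ℕ) :
    Irrational (gaussMap^[n] x) ∧ gaussMap^[n] x ∈ Ioo (0 : ℝ) 1 := by
  induction n with
  | zero => exact ⟨hx, h⟩
  | succ n ih =>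
    rw [Function.iterate_succ_apply']
    exact ⟨irrational_gaussMap ih.1, gaussMap_mem_Ioo ih.1⟩

/-- Irrational orbits never meet `0` or the end points of branches, so digit descriptions need no
exceptional cases. -/
lemma volume_real_congr {p q : ℝ → Prop}
    (h : ∀ x, Irrational x → x ∈ Ioo (0 : ℝ) 1 → (p x ↔ q x)) :
    volume.real {x : ℝ | x ∈ Icc (0 : ℝ) 1 ∧ p x} =
      volume.real {x : ℝ | x ∈ Icc (0 : ℝ) 1 ∧ q x} := by
  refine measureReal_congr ?_
  filter_upwards [ae_irrational] with x hx
  refine propext (and_congr_right fun hx1 => h x hx (irrational_mem_Ioo hx hx1))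

lemma digit_add_one {x : ℝ} (hx : x ∈ Ioo (0 : ℝ) 1) : digit x + 1 = ⌊1 / x⌋₊ := by
  have h1 : 1 < 1 / x := by rw [lt_div_iff₀ hx.1]; linarith [hx.2]
  have : 1 ≤ ⌊1 / x⌋₊ := Nat.le_floor (by simpa using h1.le)
  unfold digit
  omega

/-- The automaton that reads digits less than `N`. -/
def boundedDigits (N : ℕ) (_ : Unit) (n : ℕ) : Option Unit := if n + 1 < N then some () else none

lemma runs_boundedDigits_iff {N : ℕ} (hN : 2 ≤ N) (n : ℕ) {x : ℝ} (hx : Irrational x)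
    (h : x ∈ Ioo (0 : ℝ) 1) :
    (∀ j < n, gaussMap^[j] x ∉ Icc (0 : ℝ) (1 / (N : ℝ))) ↔ Runs (boundedDigits N) n () x := by
  induction n generalizing x with
  | zero => simp [Runs]
  | succ n ih =>
    have hN0 : (0 : ℝ) < N := by exact_mod_cast (show 0 < N by omega)
    have h1 : x ∉ Icc (0 : ℝ) (1 / (N : ℝ)) ↔ digit x + 1 < N := by
      rw [digit_add_one h, Nat.floor_lt (by have := h.1; positivity), mem_Icc, not_and, not_le,
        div_lt_comm₀ h.1 hN0]
      exact ⟨fun h2 => h2 h.1.le, fun h2 _ => h2⟩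
    have h2 := ih (irrational_gaussMap hx) (gaussMap_mem_Ioo hx)
    have h3 : (∀ j < n + 1, gaussMap^[j] x ∉ Icc (0 : ℝ) (1 / (N : ℝ))) ↔
        x ∉ Icc (0 : ℝ) (1 / (N : ℝ)) ∧
          ∀ j < n, gaussMap^[j] (gaussMap x) ∉ Icc (0 : ℝ) (1 / (N : ℝ)) := by
      rw [Nat.forall_lt_succ_left]
      rfl
    rw [h3, h1, h2]
    simp only [Runs, boundedDigits]
    constructor
    · rintro ⟨h4, h5⟩
      exact ⟨(), by rw [if_pos h4], h5⟩
    · rintro ⟨_, h4, h5⟩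
      refine ⟨?_, h5⟩
      by_contra h6
      simp [h6] at h4

lemma exists_isDecayRate_zero_hole {N : ℕ} (hN : 2 ≤ N) :
    ∃ lam, IsDecayRate (fun n => survival (Icc (0 : ℝ) (1 / (N : ℝ))) n) lam := by
  obtain ⟨lam, h⟩ := isDecayRate_runs (step := boundedDigits N) (m := 1) one_pos
    (fun i j => Reach.tail 0 (Reach.refl i) (by
      simp only [boundedDigits]; rw [if_pos (by omega)]))
    (i₁ := ()) (d := N - 1) (by simp only [boundedDigits]; rw [if_neg (by omega)]) ()
  refine ⟨lam, ?_⟩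
  convert h using 2 with n
  exact volume_real_congr fun x hx h1 => runs_boundedDigits_iff hN n hx h1

/-- Only branches of index at least `N - 2` reach the hole, and the tail of the weights is `(1 + x)
/ (N - 1 + x)`. -/
lemma transfer_ind_zero_hole_le {N : ℕ} (hN : 2 ≤ N) {x : ℝ} (hx : x ∈ Icc (0 : ℝ) 1) :
    transfer (ind (measurableSet_Icc (a := (0 : ℝ)) (b := 1 / (N : ℝ)))) x ≤ 2 / (N - 1) := by
  obtain ⟨K, rfl⟩ : ∃ K, N = K + 2 := ⟨N - 2, by omega⟩
  set I := ind (measurableSet_Icc (a := (0 : ℝ)) (b := 1 / ((K + 2 : ℕ) : ℝ))) with hI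
  have h1 := (hasSum_nat_add_iff' K).2 (hasSum_weight hx.1)
  have h2 := (hasSum_nat_add_iff' K).2 (hasSum_transfer I hx)
  have h3 : ∑ n ∈ Finset.range K, weight n x * I (branch n x) = 0 := by
    refine Finset.sum_eq_zero fun n hn => ?_
    have hnK : (n : ℝ) + 1 ≤ K := by exact_mod_cast Finset.mem_range.1 hn
    have hb : branch n x ∉ Icc (0 : ℝ) (1 / ((K + 2 : ℕ) : ℝ)) := by
      rw [mem_Icc, not_and, not_le]
      intro _
      unfold branch
      have := hx.1
      apply one_div_lt_one_div_of_lt (by positivity)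
      push_cast
      linarith [hx.2]
    rw [hI, ind_apply, indicator_of_notMem hb, mul_zero]
  rw [h3, sub_zero] at h2
  rw [sum_weight K hx.1, sub_sub_cancel] at h1
  refine (hasSum_le (fun n => ?_) h2 h1).trans ?_
  · refine mul_le_of_le_one_right (weight_nonneg _ hx.1) ?_
    rw [hI, ind_apply]
    exact indicator_le_self' (fun _ _ => zero_le_one) _
  · have := hx.1
    have hK : (0 : ℝ) ≤ K := K.cast_nonneg
    push_cast
    rw [div_le_div_iff₀ (by positivity) (by linarith)]
    nlinarith [hx.2]

/-- The transferred indicator is uniformly of order `1 / N`, so each step returns only this fraction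
of the mass: the limiting proportion without return is `1`. -/
lemma noReturn_zero_hole_ge {N : ℕ} (hN : 2 ≤ N) (r : ℕ) :
    gaussMeasure.real (Icc (0 : ℝ) (1 / (N : ℝ))) -
      r * (2 / (N - 1) * gaussMeasure.real (Icc (0 : ℝ) (1 / (N : ℝ)))) ≤
      noReturn (measurableSet_Icc (a := (0 : ℝ)) (b := 1 / (N : ℝ))) r := by
  induction r with
  | zero => simp [noReturn_zero]
  | succ r ih =>
    rw [noReturn_succ]
    set hI := measurableSet_Icc (a := (0 : ℝ)) (b := 1 / (N : ℝ))
    have hsup : ∀ n, ∀ x ∈ Icc (0 : ℝ) 1, (transfer ^ n) (transfer (ind hI)) x ≤ 2 / (N - 1) := by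
      intro n
      induction n with
      | zero => exact fun x hx => transfer_ind_zero_hole_le hN hx
      | succ n ihn =>
        intro x hx
        rw [pow_succ', Module.End.mul_apply, ← transfer_const (2 / ((N : ℝ) - 1)) hx]
        exact transfer_mono ihn hx
    have h1 := mean_cut_le (f := (openOp hI ^ r) (transfer (ind hI))) (S := 2 / ((N : ℝ) - 1))
      (fun x hx => (openOp_pow_le hI (nonnegOn_ind hI).transfer r hx).trans (hsup r x hx)) hI
    push_cast
    linarith

/-- Holes at the discontinuity `0`. -/
theorem tendsto_rate_zero_hole {lam : ℕ → ℝ}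
    (hlam : ∀ N : ℕ, 2 ≤ N → IsDecayRate (fun n => survival (Icc (0 : ℝ) (1 / (N : ℝ))) n) (lam N)) :
    Tendsto (fun N : ℕ => (1 - lam N) / (1 / (N : ℝ))) atTop (𝓝 (1 / Real.log 2)) := by
  have hl := log_two_pos
  set δ : ℕ → ℝ := fun N => gaussMeasure.real (Icc (0 : ℝ) (1 / (N : ℝ))) with hδ
  have hinv : Tendsto (fun N : ℕ => 1 / (N : ℝ)) atTop (𝓝 0) :=
    tendsto_const_div_atTop_nhds_zero_nat 1
  have hb : ∀ N : ℕ, 2 ≤ N → 0 < 1 / (N : ℝ) ∧ 1 / (N : ℝ) ≤ 1 := by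
    intro N hN
    have h2 : (2 : ℝ) ≤ N := by exact_mod_cast hN
    exact ⟨by positivity, by rw [div_le_one (by linarith)]; linarith⟩
  have hδε : Tendsto (fun N : ℕ => δ N / (1 / (N : ℝ))) atTop (𝓝 (1 / Real.log 2)) := by
    have h1 := tendsto_gaussMeasure_Icc_div (l := atTop) (a := fun _ : ℕ => (0 : ℝ))
      (b := fun N : ℕ => 1 / (N : ℝ)) le_rfl (by
        filter_upwards [eventually_ge_atTop 2] with N hN
        exact ⟨le_rfl, (hb N hN).1, (hb N hN).2⟩) tendsto_const_nhds hinv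
    simpa [hδ] using h1
  have hδpos : ∀ᶠ N in atTop, 0 < δ N := by
    filter_upwards [eventually_ge_atTop 2] with N hN
    obtain ⟨h1, h2⟩ := hb N hN
    refine lt_of_lt_of_le ?_ (le_gaussMeasure_real_Icc le_rfl h1.le h2)
    rw [sub_zero]
    positivity
  have hδ0 : Tendsto δ atTop (𝓝 0) := by
    have h1 := hδε.mul hinv
    rw [mul_zero] at h1
    refine h1.congr' ?_
    filter_upwards [eventually_ge_atTop 2] with N hN
    exact div_mul_cancel₀ _ (hb N hN).1.ne'
  set r : ℕ → ℕ → ℝ := fun M N =>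
    noReturn (measurableSet_Icc (a := (0 : ℝ)) (b := 1 / (N : ℝ))) M with hr
  have hmain : Tendsto (fun N => (1 - lam N) / δ N) atTop (𝓝 1) := by
    refine tendsto_rate hδpos hδ0 ?_ ?_ (r := r) ?_
    · filter_upwards [eventually_ge_atTop 2] with N hN
      exact ⟨(hlam N hN).1, (hlam N hN).2.1.le⟩
    · intro M hM
      have hMp : (0 : ℝ) < M := by exact_mod_cast (show 0 < M by omega)
      filter_upwards [eventually_ge_atTop 2,
        (tendsto_order.1 hδ0).2 (1 / (25 * M)) (by positivity)] with N h1 h2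
      refine decay_bounds measurableSet_Icc ordConnected_Icc hM ?_ (hlam N h1).hasGeometricDecay
      rw [lt_div_iff₀ (by positivity)] at h2
      linarith
    · intro M _
      have h1 : Tendsto (fun N : ℕ => 1 - (M : ℝ) * (2 / ((N : ℝ) - 1))) atTop
          (𝓝 (1 - (M : ℝ) * 0)) := by
        refine Tendsto.const_sub _ (Tendsto.const_mul _ (Tendsto.const_div_atTop ?_ _))
        exact tendsto_atTop_add_const_right _ (-1) tendsto_natCast_atTop_atTop
      rw [mul_zero, sub_zero] at h1
      refine tendsto_of_tendsto_of_tendsto_of_le_of_le' h1 tendsto_const_nhds ?_ ?_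
      · filter_upwards [hδpos, eventually_ge_atTop 2] with N h2 h3
        rw [le_div_iff₀ h2]
        have := noReturn_zero_hole_ge h3 M
        linarith
      · filter_upwards [hδpos] with N h2
        rw [div_le_one h2]
        exact (noReturn_antitone _ (Nat.zero_le M)).trans_eq (noReturn_zero _)
  have h1 := hmain.mul hδε
  rw [one_mul] at h1
  refine h1.congr' ?_
  filter_upwards [hδpos] with N h2
  rw [div_mul_div_cancel₀ h2.ne']

/-! ### Blocks of ones -/

/-- The first `k` digits of `x` are equal to one. -/
def OnesPrefix (k : ℕ) (x : ℝ) : Prop := ∀ j < k, digit (gaussMap^[j] x) = 0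

/-- There are `k` consecutive ones among the first `n` digits of `x`. -/
def OnesBlock (k n : ℕ) (x : ℝ) : Prop := ∃ i, i + k ≤ n ∧ OnesPrefix k (gaussMap^[i] x)

lemma onesPrefix_succ (k : ℕ) (x : ℝ) :
    OnesPrefix (k + 1) x ↔ digit x = 0 ∧ OnesPrefix k (gaussMap x) := by
  unfold OnesPrefix
  rw [Nat.forall_lt_succ_left]
  rfl

lemma OnesPrefix.mono {k l : ℕ} {x : ℝ} (h : OnesPrefix k x) (hl : l ≤ k) : OnesPrefix l x :=
  fun j hj => h j (hj.trans_le hl)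

lemma onesBlock_succ (k n : ℕ) (x : ℝ) :
    OnesBlock k (n + 1) x ↔ (k ≤ n + 1 ∧ OnesPrefix k x) ∨ OnesBlock k n (gaussMap x) := by
  constructor
  · rintro ⟨i, hi, h⟩
    cases i with
    | zero => exact Or.inl ⟨by omega, h⟩
    | succ i => exact Or.inr ⟨i, by omega, h⟩
  · rintro (⟨h1, h2⟩ | ⟨i, hi, h⟩)
    · exact ⟨0, by omega, h2⟩
    · exact ⟨i + 1, by omega, h⟩

/-- The automaton that counts the current run of ones and refuses to read `k + 1` ones in a row. -/
def avoidOnes (k : ℕ) (i : Fin (k + 1)) (n : ℕ) : Option (Fin (k + 1)) :=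
  if n = 0 then (if h : (i : ℕ) + 1 < k + 1 then some ⟨i + 1, h⟩ else none) else some 0

/-- The induction needs every state: with `i` ones already read, the run must avoid both a whole
forbidden block and its completion by `k + 1 - i` initial ones. -/
lemma runs_avoidOnes_iff (k n : ℕ) (i : Fin (k + 1)) (x : ℝ) :
    Runs (avoidOnes k) n i x ↔ ¬ OnesBlock (k + 1) n x ∧
      ¬ (k + 1 - i ≤ n ∧ OnesPrefix (k + 1 - i) x) := by
  induction n generalizing i x with
  | zero =>
    have hi := i.isLt
    simp only [Runs, true_iff]
    refine ⟨?_, fun h => by omega⟩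
    rintro ⟨p, hp, _⟩
    omega
  | succ n ih =>
    have hi := i.isLt
    obtain ⟨r, hr⟩ : ∃ r, k + 1 - (i : ℕ) = r + 1 := ⟨k - i, by omega⟩
    rw [onesBlock_succ, hr, onesPrefix_succ r]
    by_cases hd : digit x = 0
    · by_cases hik : (i : ℕ) + 1 < k + 1
      · have h1 : Runs (avoidOnes k) (n + 1) i x ↔
            Runs (avoidOnes k) n ⟨i + 1, hik⟩ (gaussMap x) := by
          simp [Runs, avoidOnes, hd, hik]
        rw [h1, ih]
        simp only
        rw [show k + 1 - ((i : ℕ) + 1) = r by omega]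
        constructor
        · rintro ⟨h2, h3⟩
          refine ⟨?_, fun h => h3 ⟨by omega, h.2.2⟩⟩
          rintro (⟨h4, h5⟩ | h4)
          · exact h3 ⟨by omega, ((onesPrefix_succ k x).1 h5).2.mono (by omega)⟩
          · exact h2 h4
        · rintro ⟨h2, h3⟩
          exact ⟨fun h => h2 (Or.inr h), fun h => h3 ⟨by omega, hd, h.2⟩⟩
      · have h1 : ¬ Runs (avoidOnes k) (n + 1) i x := by
          simp [Runs, avoidOnes, hd, hik]
        have hr0 : r = 0 := by omega
        subst hr0
        refine iff_of_false h1 fun h => h.2 ⟨by omega, hd, fun j hj => by omega⟩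
    · have h1 : Runs (avoidOnes k) (n + 1) i x ↔ Runs (avoidOnes k) n 0 (gaussMap x) := by
        simp [Runs, avoidOnes, hd]
      rw [h1, ih]
      have h2 : ¬ OnesPrefix (k + 1) x := fun h => hd ((onesPrefix_succ k x).1 h).1
      simp only [h2, hd, false_and, and_false, not_false_eq_true, and_true, false_or]
      simp only [Fin.val_zero, Nat.sub_zero, and_iff_left_iff_imp]
      exact fun h3 h4 => h3 ⟨0, by omega, h4.2⟩

lemma runs_avoidOnes_zero_iff (k n : ℕ) (x : ℝ) :
    Runs (avoidOnes k) n 0 x ↔ ¬ OnesBlock (k + 1) n x := by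
  rw [runs_avoidOnes_iff]
  simp only [Fin.val_zero, Nat.sub_zero, and_iff_left_iff_imp]
  exact fun h3 h4 => h3 ⟨0, by omega, h4.2⟩

/-- Reading the index `1`, that is the digit two, `k - j + 1` times leads to state `0`; then `j`
ones lead to `j`. The total is `k + 1` for all pairs of states. -/
lemma reach_avoidOnes (k : ℕ) (i j : Fin (k + 1)) : Reach (avoidOnes k) (k + 1) i j := by
  have h0 : ∀ n, Reach (avoidOnes k) (n + 1) i 0 := by
    intro n
    have hlast : ∀ l : Fin (k + 1), avoidOnes k l 1 = some 0 := fun l => by simp [avoidOnes]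
    induction n with
    | zero => exact Reach.tail 1 (Reach.refl i) (hlast i)
    | succ n ih => exact Reach.tail 1 ih (hlast 0)
  have h1 : ∀ n l : ℕ, ∀ hl : l < k + 1, Reach (avoidOnes k) (n + 1 + l) i ⟨l, hl⟩ := by
    intro n l
    induction l with
    | zero => exact fun _ => h0 n
    | succ l ih =>
      intro hl
      exact Reach.tail 0 (ih (by omega)) (by simp [avoidOnes, hl])
  have h2 := h1 (k - j) j j.isLt
  rwa [show k - (j : ℕ) + 1 + j = k + 1 by omega] at h2

/-- The recursion for the expansion passes to the inverse of the fractional part, while the Gauss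
map also drops its integer part; the coefficients are insensitive to this. -/
lemma of_s_get?_fract (v : ℝ) (n : ℕ) :
    (GenContFract.of v).s.get? n = (GenContFract.of (Int.fract v)).s.get? n := by
  cases n with
  | zero =>
    by_cases h : Int.fract v = 0
    · have h1 : (GenContFract.of v).s = Stream'.Seq.nil := by
        obtain ⟨a, ha⟩ : ∃ a : ℤ, v = a := ⟨⌊v⌋, by
          have := Int.floor_add_fract v
          rw [h, add_zero] at this
          exact this.symm⟩
        rw [ha]
        exact GenContFract.of_s_of_int ℝ a
      have h2 : (GenContFract.of (0 : ℝ)).s = Stream'.Seq.nil := by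
        have := GenContFract.of_s_of_int ℝ 0
        rwa [Int.cast_zero] at this
      rw [h, h1, h2]
    · have h1 := GenContFract.of_s_head h
      have h2 := GenContFract.of_s_head (v := Int.fract v) (by rwa [Int.fract_fract])
      rw [Int.fract_fract, ← h1] at h2
      exact h2.symm
  | succ n => rw [GenContFract.of_s_succ, GenContFract.of_s_succ, Int.fract_fract]

lemma partDens_get?_eq_one_iff (m : ℕ) {x : ℝ} (hx : Irrational x) (h : x ∈ Ioo (0 : ℝ) 1) :
    (GenContFract.of x).partDens.get? m = some 1 ↔ digit (gaussMap^[m] x) = 0 := by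
  have hfr : Int.fract x = x := Int.fract_eq_self.2 (Ioo_subset_Ico_self h)
  rw [GenContFract.partDens, Stream'.Seq.map_get?]
  induction m generalizing x with
  | zero =>
    have h1 := GenContFract.of_s_head (v := x) (by rw [hfr]; exact h.1.ne')
    have h2 : (GenContFract.of x).s.get? 0 = some ⟨1, ⌊(Int.fract x)⁻¹⌋⟩ := h1
    have h3 := digit_add_one h
    have h4 : ((⌊1 / x⌋₊ : ℕ) : ℤ) = ⌊1 / x⌋ :=
      Int.natCast_floor_eq_floor (by have := h.1; positivity)
    rw [h2, hfr, ← one_div, ← h4, ← h3]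
    simp
  | succ m ih =>
    rw [GenContFract.of_s_succ, hfr, of_s_get?_fract]
    have h1 : Int.fract x⁻¹ = gaussMap x := by rw [gaussMap, one_div]
    rw [h1, Function.iterate_succ_apply]
    exact ih (irrational_gaussMap hx) (gaussMap_mem_Ioo hx)
      (Int.fract_eq_self.2 (Ioo_subset_Ico_self (gaussMap_mem_Ioo hx)))

lemma hasOnesBlock_iff (k n : ℕ) {x : ℝ} (hx : Irrational x) (h : x ∈ Ioo (0 : ℝ) 1) :
    HasOnesBlock k n x ↔ OnesBlock k n x := by
  unfold HasOnesBlock OnesBlock OnesPrefix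
  refine exists_congr fun i => and_congr_right fun _ => forall_congr' fun j =>
    imp_congr_right fun _ => ?_
  rw [partDens_get?_eq_one_iff _ hx h, ← Function.iterate_add_apply, add_comm]

lemma blockFreeMeasure_eq (k n : ℕ) :
    blockFreeMeasure (k + 1) n =
      volume.real {x : ℝ | x ∈ Icc (0 : ℝ) 1 ∧ Runs (avoidOnes k) n 0 x} :=
  volume_real_congr fun x hx h => by
    rw [hasOnesBlock_iff _ _ hx h, runs_avoidOnes_zero_iff]

lemma exists_isDecayRate_blockFree (k : ℕ) :
    ∃ lam, IsDecayRate (fun n => blockFreeMeasure (k + 1) n) lam := by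
  obtain ⟨lam, h⟩ := isDecayRate_runs (step := avoidOnes k) (Nat.succ_pos k)
    (reach_avoidOnes k) (i₁ := Fin.last k) (d := 0) (by simp [avoidOnes]) 0
  refine ⟨lam, ?_⟩
  simpa only [blockFreeMeasure_eq] using h

lemma rightInverseBranch_iterate_nonneg (k : ℕ) {y : ℝ} (hy : 0 ≤ y) :
    0 ≤ rightInverseBranch^[k] y := by
  induction k with
  | zero => exact hy
  | succ k ih =>
    rw [Function.iterate_succ_apply']
    unfold rightInverseBranch
    positivity

lemma rightInverseBranch_antitone {a b : ℝ} (ha : 0 ≤ a) (hab : a ≤ b) :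
    rightInverseBranch b ≤ rightInverseBranch a := by
  unfold rightInverseBranch
  apply one_div_le_one_div_of_le <;> linarith

lemma mem_uIcc_rightInverseBranch_iff {x a b : ℝ} (hx : 0 < x) (ha : 0 ≤ a) (hb : 0 ≤ b) :
    x ∈ uIcc (rightInverseBranch a) (rightInverseBranch b) ↔ rightBranch x ∈ uIcc a b := by
  rcases le_total a b with h | h
  · rw [uIcc_of_le h, uIcc_of_ge (rightInverseBranch_antitone ha h),
      rightBranch_mem_Icc_iff hx ha hb]
  · rw [uIcc_of_ge h, uIcc_of_le (rightInverseBranch_antitone hb h),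
      rightBranch_mem_Icc_iff hx hb ha]

lemma onesHole_succ (k : ℕ) : onesHole (k + 1) =
    uIcc (rightInverseBranch (rightInverseBranch^[k] 0))
      (rightInverseBranch (rightInverseBranch^[k] 1)) := by
  rw [onesHole, Function.iterate_succ_apply', Function.iterate_succ_apply']

lemma rightInverseBranch_iterate_le_one (k : ℕ) {y : ℝ} (hy : 0 ≤ y) (hy1 : y ≤ 1) :
    rightInverseBranch^[k] y ≤ 1 := by
  induction k with
  | zero => exact hy1
  | succ k ih =>
    rw [Function.iterate_succ_apply']
    have := rightInverseBranch_iterate_nonneg k hy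
    change 1 / (1 + rightInverseBranch^[k] y) ≤ 1
    rw [div_le_one (by positivity)]
    linarith

lemma mem_onesHole_iff (k : ℕ) {x : ℝ} (hx : Irrational x) (h : x ∈ Ioo (0 : ℝ) 1) :
    x ∈ onesHole k ↔ OnesPrefix k x := by
  induction k generalizing x with
  | zero =>
    refine iff_of_true ?_ fun j hj => by omega
    simp only [onesHole, Function.iterate_zero, id, uIcc_of_le zero_le_one]
    exact Ioo_subset_Icc_self h
  | succ k ih =>
    have z0 := rightInverseBranch_iterate_nonneg k (le_refl (0 : ℝ))
    have z1 := rightInverseBranch_iterate_nonneg k (zero_le_one' ℝ)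
    have o0 := rightInverseBranch_iterate_le_one k (le_refl (0 : ℝ)) zero_le_one
    have o1 := rightInverseBranch_iterate_le_one k (zero_le_one' ℝ) le_rfl
    rw [onesHole_succ, mem_uIcc_rightInverseBranch_iff h.1 z0 z1, onesPrefix_succ,
      ← ih (irrational_gaussMap hx) (gaussMap_mem_Ioo hx)]
    have hd := digit_add_one h
    have hpos : 0 ≤ 1 / x := by have := h.1; positivity
    by_cases h0 : digit x = 0
    · have hx2 : 1 / x < 2 := by
        rw [h0, zero_add] at hd
        have := Nat.lt_floor_add_one (1 / x)
        rw [← hd] at this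
        norm_num at this ⊢
        exact this
      have hx3 : x ∈ Ioo (1 / 2 : ℝ) 1 := by
        refine ⟨?_, h.2⟩
        rw [div_lt_iff₀ h.1] at hx2
        linarith
      rw [← gaussMap_eq_rightBranch hx3]
      simp only [h0, true_and]
      rfl
    -- A first digit of at least two gives `1 / x ≥ 2`, whereas membership in the hole gives `1 / x
    -- - 1 ≤ 1`; so `x = 1 / 2`, which is rational.
    · refine iff_of_false (fun h1 => ?_) fun h1 => h0 h1.1
      have h2 : rightBranch x ≤ 1 := h1.2.trans (max_le o0 o1)
      unfold rightBranch at h2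
      have h3 : (2 : ℝ) ≤ ⌊1 / x⌋₊ := by exact_mod_cast (show 2 ≤ ⌊1 / x⌋₊ by omega)
      have h4 : 1 / x = 2 := le_antisymm (by linarith) (h3.trans (Nat.floor_le hpos))
      have h5 : x = ((1 / 2 : ℚ) : ℝ) := by
        have := h.1.ne'
        rw [div_eq_iff this] at h4
        push_cast
        linarith
      exact hx ⟨_, h5.symm⟩

/-- A block of `k + 1` ones that starts before time `n` ends within the first `n + k` digits. The
shift by `k` does not affect the decay rate. -/
lemma survival_onesHole (k n : ℕ) :
    survival (onesHole (k + 1)) n = blockFreeMeasure (k + 1) (n + k) := by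
  refine volume_real_congr fun x hx h => ?_
  rw [hasOnesBlock_iff _ _ hx h]
  constructor
  · rintro h1 ⟨i, hi, h2⟩
    have h3 := irrational_gaussMap_iterate hx h i
    exact h1 i (by omega) ((mem_onesHole_iff _ h3.1 h3.2).2 h2)
  · intro h1 j hj h2
    have h3 := irrational_gaussMap_iterate hx h j
    exact h1 ⟨j, by omega, (mem_onesHole_iff _ h3.1 h3.2).1 h2⟩

lemma IsDecayRate.shift {a : ℕ → ℝ} {lam : ℝ} (h : IsDecayRate a lam) (k : ℕ) :
    IsDecayRate (fun n => a (n + k)) lam := by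
  obtain ⟨h0, h1, C, hC, ht⟩ := h
  refine ⟨h0, h1, C * lam ^ k, by positivity, ?_⟩
  have h2 := ((tendsto_add_atTop_iff_nat k).2 ht).mul_const (lam ^ k)
  refine h2.congr fun n => ?_
  rw [pow_add]
  field_simp

/-! ### Endpoints of the holes and the limiting constant -/

/-- An explicit formula for the endpoints of the holes. -/
lemma rightInverseBranch_iterate_zero (k : ℕ) :
    rightInverseBranch^[k] 0 = -(1 + z) + (1 + 2 * z) / (1 + z ^ 2 * (-z ^ 2) ^ k) ∧
      0 < 1 + z ^ 2 * (-z ^ 2) ^ k := by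
  have hz := z_pos
  have hz1 := z_lt_one
  have hz2 : z ^ 2 < 1 := by nlinarith
  have hpos : ∀ k : ℕ, 0 < 1 + z ^ 2 * (-z ^ 2) ^ k := by
    intro k
    have h1 : |z ^ 2 * (-z ^ 2) ^ k| < 1 := by
      rw [abs_mul, abs_of_pos (pow_pos hz 2), abs_pow, abs_neg, abs_of_pos (pow_pos hz 2)]
      calc z ^ 2 * (z ^ 2) ^ k ≤ z ^ 2 * 1 := by
            gcongr
            exact pow_le_one₀ (by positivity) hz2.le
        _ < 1 := by linarith
    linarith [(abs_lt.1 h1).1]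
  refine ⟨?_, hpos k⟩
  have hz5 : z ^ 2 * (1 + z) = z := by
    have : z ^ 2 * (1 + z) = (1 - z) * (1 + z) := by rw [z_sq]
    linarith [z_sq, show (1 - z) * (1 + z) = 1 - z ^ 2 by ring]
  -- The map `y ↦ 1 / (1 + y)` is Möbius with fixed points `z` and `-(1 + z)`; it multiplies the
  -- coordinate `(y - z) / (y + 1 + z)` by `-z ^ 2`.
  induction k with
  | zero =>
    have h1 : 1 + z ^ 2 ≠ 0 := by positivity
    simp only [Function.iterate_zero, id, pow_zero, mul_one]
    field_simp
    linarith
  | succ k ih =>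
    have h1 := hpos k
    have h2 := hpos (k + 1)
    have e1 : z ^ 2 * (-z ^ 2) ^ (k + 1) = -(z ^ 2 * (z ^ 2 * (-z ^ 2) ^ k)) := by ring
    rw [Function.iterate_succ_apply', ih, e1]
    rw [e1] at h2
    generalize z ^ 2 * (-z ^ 2) ^ k = w at h1 h2
    have h3 : 1 + (-(1 + z) + (1 + 2 * z) / (1 + w)) =
        (1 + z) * (1 + -(z ^ 2 * w)) / (1 + w) := by
      field_simp
      linear_combination w * hz5
    have h6 : 1 + z ≠ 0 := by positivity
    rw [rightInverseBranch, h3, one_div_div]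
    have h7 := h2.ne'
    rw [eq_comm, ← sub_eq_zero]
    field_simp
    linear_combination (1 + w) * z_sq + w * (1 + z) * hz5

/-- Two consecutive endpoints are at distance of order `z ^ (2 * k)`. -/
lemma endpoint_sub (k : ℕ) :
    rightInverseBranch^[k + 1] 0 - rightInverseBranch^[k] 0 =
      (-1) ^ k * ((1 + 2 * z) * (1 + z ^ 2) * z ^ 2 * z ^ (2 * k) /
        ((1 + z ^ 2 * (-z ^ 2) ^ k) * (1 + z ^ 2 * (-z ^ 2) ^ (k + 1)))) := by
  obtain ⟨h1, h2⟩ := rightInverseBranch_iterate_zero k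
  obtain ⟨h3, h4⟩ := rightInverseBranch_iterate_zero (k + 1)
  rw [h1, h3]
  have e1 : (-z ^ 2) ^ k = (-1) ^ k * z ^ (2 * k) := by rw [pow_mul, ← mul_pow]; ring
  have e2 : (-z ^ 2) ^ (k + 1) = -z ^ 2 * ((-1) ^ k * z ^ (2 * k)) := by rw [pow_succ, e1]; ring
  rw [e1] at h2 ⊢
  rw [e2] at h4 ⊢
  rw [← mul_div_assoc, mul_left_comm ((-1) ^ k)]
  generalize (-1) ^ k * z ^ (2 * k) = t at h2 h4 ⊢
  have e3 : 1 + z ^ 2 * (-z ^ 2 * t) = 1 - z ^ 4 * t := by ring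
  rw [e3] at h4 ⊢
  have h5 := h2.ne'
  have h6 := h4.ne'
  field_simp
  ring

lemma tendsto_neg_sq_pow : Tendsto (fun k : ℕ => (-z ^ 2) ^ k) atTop (𝓝 0) := by
  apply tendsto_pow_atTop_nhds_zero_of_abs_lt_one
  rw [abs_neg, abs_of_pos (pow_pos z_pos 2)]
  nlinarith [z_pos, z_lt_one]

lemma tendsto_denom : Tendsto (fun k : ℕ => 1 + z ^ 2 * (-z ^ 2) ^ k) atTop (𝓝 1) := by
  simpa using (tendsto_neg_sq_pow.const_mul (z ^ 2)).const_add 1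

lemma tendsto_endpoint : Tendsto (fun k : ℕ => rightInverseBranch^[k] 0) atTop (𝓝 z) := by
  have h1 := ((tendsto_const_nhds (x := 1 + 2 * z)).div tendsto_denom one_ne_zero).const_add
    (-(1 + z))
  rw [show -(1 + z) + (1 + 2 * z) / 1 = z by ring] at h1
  exact h1.congr fun k => (rightInverseBranch_iterate_zero k).1.symm

lemma abs_endpoint_sub (k : ℕ) :
    0 < |rightInverseBranch^[k + 1] 0 - rightInverseBranch^[k] 0| ∧
    |rightInverseBranch^[k + 1] 0 - rightInverseBranch^[k] 0| / z ^ (2 * k) =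
      (1 + 2 * z) * (1 + z ^ 2) * z ^ 2 /
        ((1 + z ^ 2 * (-z ^ 2) ^ k) * (1 + z ^ 2 * (-z ^ 2) ^ (k + 1))) := by
  have hz := z_pos
  have h2 := (rightInverseBranch_iterate_zero k).2
  have h4 := (rightInverseBranch_iterate_zero (k + 1)).2
  rw [endpoint_sub, abs_mul, abs_pow, abs_neg, abs_one, one_pow, one_mul]
  rw [abs_of_pos (by positivity)]
  refine ⟨by positivity, ?_⟩
  field_simp

lemma onesHole_eq_Icc (k : ℕ) : onesHole k =
    Icc (min (rightInverseBranch^[k] 0) (rightInverseBranch^[k + 1] 0))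
      (max (rightInverseBranch^[k] 0) (rightInverseBranch^[k + 1] 0)) := by
  have h : rightInverseBranch 0 = 1 := by norm_num [rightInverseBranch]
  rw [Function.iterate_succ_apply, h]
  rfl

lemma rightInverseBranch_mem_uIcc {a b x : ℝ} (ha : 0 ≤ a) (hb : 0 ≤ b) (hx : x ∈ uIcc a b) :
    rightInverseBranch x ∈ uIcc (rightInverseBranch a) (rightInverseBranch b) := by
  rcases le_total a b with h | h
  · rw [uIcc_of_le h] at hx
    rw [uIcc_of_ge (rightInverseBranch_antitone ha h)]
    exact ⟨rightInverseBranch_antitone (ha.trans hx.1) hx.2, rightInverseBranch_antitone ha hx.1⟩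
  · rw [uIcc_of_ge h] at hx
    rw [uIcc_of_le (rightInverseBranch_antitone hb h)]
    exact ⟨rightInverseBranch_antitone (hb.trans hx.1) hx.2, rightInverseBranch_antitone hb hx.1⟩

/-- This says that the inverse branch maps the hole into itself, so the condition on the overhang
holds trivially. -/
lemma endpoint_mem_uIcc (k : ℕ) : rightInverseBranch^[k + 2] 0 ∈
    uIcc (rightInverseBranch^[k] 0) (rightInverseBranch^[k + 1] 0) := by
  induction k with
  | zero =>
    norm_num [rightInverseBranch, uIcc_of_le]
  | succ k ih =>
    have h := rightInverseBranch_mem_uIcc (rightInverseBranch_iterate_nonneg k le_rfl)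
      (rightInverseBranch_iterate_nonneg (k + 1) le_rfl) ih
    simpa only [← Function.iterate_succ_apply'] using h

lemma tendsto_rate_onesHole {lam : ℕ → ℝ}
    (hlam : ∀ k, 1 ≤ k → IsDecayRate (survival (onesHole k)) (lam k)) :
    Tendsto (fun k : ℕ => (1 - lam k) / z ^ (2 * k)) atTop
      (𝓝 (z ^ 3 * (1 + z ^ 2) ^ 2 / Real.log 2)) := by
  have hz := z_pos
  set x : ℕ → ℝ := fun k => rightInverseBranch^[k] 0 with hx
  have hx0 : Tendsto x atTop (𝓝 z) := tendsto_endpoint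
  have hx1 : Tendsto (fun k => x (k + 1)) atTop (𝓝 z) := (tendsto_add_atTop_iff_nat 1).2 hx0
  have hα := hx0.min hx1
  have hβ := hx0.max hx1
  rw [min_self] at hα
  rw [max_self] at hβ
  have hsub : ∀ k, max (x k) (x (k + 1)) - min (x k) (x (k + 1)) = |x (k + 1) - x k| :=
    fun k => max_sub_min_eq_abs _ _
  have hlt : ∀ k, min (x k) (x (k + 1)) < max (x k) (x (k + 1)) := fun k => by
    have := (abs_endpoint_sub k).1
    linarith [hsub k]
  have hmaps : ∀ k, ∀ y, y = x k ∨ y = x (k + 1) →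
      rightInverseBranch y ∈ Icc (min (x k) (x (k + 1))) (max (x k) (x (k + 1))) := by
    rintro k y (rfl | rfl)
    · have : rightInverseBranch (x k) = x (k + 1) :=
        (Function.iterate_succ_apply' rightInverseBranch k 0).symm
      rw [this]
      exact ⟨min_le_right _ _, le_max_right _ _⟩
    · have : rightInverseBranch (x (k + 1)) = x (k + 2) :=
        (Function.iterate_succ_apply' rightInverseBranch (k + 1) 0).symm
      rw [this]
      exact endpoint_mem_uIcc k
  have h1 := tendsto_rate_near_fixedPoint (lam := lam) hα hβ (Eventually.of_forall hlt)
    (fun η hη => Eventually.of_forall fun k => by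
      have h2 := mul_pos hη (sub_pos.2 (hlt k))
      have h3 := hmaps k _ (min_choice (x k) (x (k + 1)))
      have h4 := hmaps k _ (max_choice (x k) (x (k + 1)))
      exact ⟨by linarith [h3.2], by linarith [h4.1]⟩)
    (by
      filter_upwards [eventually_ge_atTop 1] with k hk
      have := (hlam k hk).hasGeometricDecay
      rwa [onesHole_eq_Icc] at this)
  have h2 : Tendsto (fun k : ℕ => |x (k + 1) - x k| / z ^ (2 * k)) atTop
      (𝓝 ((1 + 2 * z) * (1 + z ^ 2) * z ^ 2)) := by
    have h3 := (tendsto_const_nhds (x := (1 + 2 * z) * (1 + z ^ 2) * z ^ 2)).div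
      (tendsto_denom.mul ((tendsto_add_atTop_iff_nat 1).2 tendsto_denom)) (by norm_num)
    rw [mul_one, div_one] at h3
    exact h3.congr fun k => (abs_endpoint_sub k).2.symm
  have h4 := h1.mul h2
  have e : z ^ 2 / Real.log 2 * ((1 + 2 * z) * (1 + z ^ 2) * z ^ 2) =
      z ^ 3 * (1 + z ^ 2) ^ 2 / Real.log 2 := by
    have : z * (1 + 2 * z) = 1 + z ^ 2 := by linarith [z_sq, show z * (1 + 2 * z) = z + 2 * z ^ 2 by ring]
    rw [sq (1 + z ^ 2)]
    nth_rewrite 3 [← this]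
    ring
  rw [e] at h4
  refine h4.congr fun k => ?_
  have h5 := (abs_endpoint_sub k).1
  rw [hsub k, div_mul_div_cancel₀]
  exact h5.ne'

lemma abs_limit_sub_lt : |z ^ 3 * (1 + z ^ 2) ^ 2 / Real.log 2 - 0.6504| < 0.00005 := by
  -- Reduction of the polynomial modulo `z ^ 2 = 1 - z` leaves an expression linear in `√5`.
  have e : z ^ 3 * (1 + z ^ 2) ^ 2 = 25 * z - 15 := by
    linear_combination (z ^ 5 - z ^ 4 + 4 * z ^ 3 - 5 * z ^ 2 + 10 * z - 15) * z_sq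
  have h1 : (2.2360679 : ℝ) < √5 := Real.lt_sqrt_of_sq_lt (by norm_num)
  have h2 : √5 < 2.2360680 := (Real.sqrt_lt' (by norm_num)).2 (by norm_num)
  have h3 := Real.log_two_gt_d9
  have h4 := Real.log_two_lt_d9
  have h5 := log_two_pos
  have h6 : z = (√5 - 1) / 2 := rfl
  rw [e, abs_lt, lt_sub_iff_add_lt, sub_lt_iff_lt_add, lt_div_iff₀ h5, div_lt_iff₀ h5, h6]
  constructor <;> linarith

theorem block_free_decay :
    ∃ lam : ℕ → ℝ,
      (∀ k : ℕ, 1 ≤ k → IsDecayRate (fun n => blockFreeMeasure k n) (lam k) ∧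
        IsDecayRate (fun n => survival (onesHole k) n) (lam k)) ∧
      Tendsto (fun k : ℕ => (1 - lam k) / z ^ (2 * k)) atTop
        (𝓝 (z ^ 3 * (1 + z ^ 2) ^ 2 / Real.log 2)) := by
  choose lam hlam using exists_isDecayRate_blockFree
  have h : ∀ k : ℕ, 1 ≤ k → IsDecayRate (fun n => blockFreeMeasure k n) (lam (k - 1)) ∧
      IsDecayRate (fun n => survival (onesHole k) n) (lam (k - 1)) := by
    intro k hk
    obtain ⟨k, rfl⟩ := Nat.exists_eq_add_of_le' hk
    refine ⟨hlam k, ?_⟩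
    simpa only [survival_onesHole, Nat.add_sub_cancel] using (hlam k).shift k
  exact ⟨fun k => lam (k - 1), h, tendsto_rate_onesHole fun k hk => (h k hk).2⟩

theorem zero_hole_decay :
    ∃ lam : ℕ → ℝ,
      (∀ N : ℕ, 2 ≤ N → IsDecayRate (fun n => survival (Icc (0 : ℝ) (1 / (N : ℝ))) n) (lam N)) ∧
      Tendsto (fun N : ℕ => (1 - lam N) / (1 / (N : ℝ))) atTop (𝓝 (1 / Real.log 2)) := by
  have h : ∀ N : ℕ, ∃ lam, 2 ≤ N →
      IsDecayRate (fun n => survival (Icc (0 : ℝ) (1 / (N : ℝ))) n) lam := fun N => by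
    by_cases hN : 2 ≤ N
    · obtain ⟨lam, hl⟩ := exists_isDecayRate_zero_hole hN
      exact ⟨lam, fun _ => hl⟩
    · exact ⟨0, fun h => absurd h hN⟩
  choose lam hlam using h
  exact ⟨lam, hlam, tendsto_rate_zero_hole hlam⟩

end GaussHoles

end

theorem mainTheorem4 :
    (∃ lam : ℕ → ℝ,
      (∀ k : ℕ, 1 ≤ k →
        GaussHoles.IsDecayRate (fun n => GaussHoles.blockFreeMeasure k n) (lam k) ∧
        GaussHoles.IsDecayRate (fun n => GaussHoles.survival (GaussHoles.onesHole k) n) (lam k)) ∧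
      Tendsto (fun k : ℕ => (1 - lam k) / GaussHoles.z ^ (2 * k)) atTop
        (𝓝 (GaussHoles.z ^ 3 * (1 + GaussHoles.z ^ 2) ^ 2 / Real.log 2))) ∧
    |GaussHoles.z ^ 3 * (1 + GaussHoles.z ^ 2) ^ 2 / Real.log 2 - 0.6504| < 0.00005 ∧
    (∃ lam : ℕ → ℝ,
      (∀ N : ℕ, 2 ≤ N →
        GaussHoles.IsDecayRate
          (fun n => GaussHoles.survival (Icc (0 : ℝ) (1 / (N : ℝ))) n) (lam N)) ∧
      Tendsto (fun N : ℕ => (1 - lam N) / (1 / (N : ℝ))) atTop (𝓝 (1 / Real.log 2))) ∧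
    (∀ α β : ℝ → ℝ,
      (∀ᶠ ε in 𝓝[>] (0 : ℝ), GaussHoles.z ∈ Icc (α ε) (β ε) ∧ β ε - α ε = ε) →
      (∀ c : ℝ, c < GaussHoles.z ^ 2 / (1 + GaussHoles.z ^ 2) →
        ∀ᶠ ε in 𝓝[>] (0 : ℝ), c * ε ≤ min (GaussHoles.z - α ε) (β ε - GaussHoles.z)) →
      ∃ lam : ℝ → ℝ,
        (∀ᶠ ε in 𝓝[>] (0 : ℝ),
          GaussHoles.IsDecayRate
            (fun n => GaussHoles.survival (Icc (α ε) (β ε)) n) (lam ε)) ∧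
        Tendsto (fun ε : ℝ => (1 - lam ε) / ε) (𝓝[>] (0 : ℝ))
          (𝓝 (GaussHoles.z ^ 2 / Real.log 2))) := by
  exact ⟨GaussHoles.block_free_decay, GaussHoles.abs_limit_sub_lt, GaussHoles.zero_hole_decay,
    GaussHoles.centred_holes⟩
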